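/- **Setting.** Let $M$ be a smooth manifold of dimension $n=m+2\ge 2$, and let the fields be smooth sections $\phi$ of a vector bundle associated with the frame bundle of $M$ (tensorial fields). Fix a family of supports in $M$ containing the compact sets and stable under subsets, finite unions and closures (e.g. all subsets, or the relatively compact ones if $M$ is Hausdorff); variations $v$ of fields and the elements of $\mathfrak{diff}(M)$ are the smooth sections, resp. vector fields, with support in the family. The bracket of $\mathfrak{diff}(M)$ is minus the Lie bracket of vector fields. A finite-dimensional family of fields is smooth if it is jointly smooth and, locally in the parameter, varies only inside a set of the family. Let $\Phi$ be a set of fields that is open along smooth families; a map on $\Phi$ is smooth if it sends smooth families to smooth families, and $C^\infty(\Phi,\mathfrak{diff}(M))$ is the space of smooth field-dependent vector fields $\boldsymbol X:\phi\mapsto\boldsymbol X_\phi$. Each defines the vertical vector field $\boldsymbol X^v_\phi=\mathfrak L_{\boldsymbol X_\phi}\phi$ on $\Phi$. Write $\boldsymbol d$ for the exterior derivative on $\Phi$, $\boldsymbol X^v(\boldsymbol Y)=\boldsymbol{dY}(\boldsymbol X^v)$, and $$\{\boldsymbol X,\boldsymbol Y\}=[\boldsymbol X,\boldsymbol Y]_{\mathfrak{diff}(M)}+\boldsymbol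 X^v(\boldsymbol Y)-\boldsymbol Y^v(\boldsymbol X).$$ Let $L(\phi)$ be an $n$-form, $\ell(\phi)$ an $(n-1)$-form, $\theta_\phi(v)$ an $(n-1)$-form linear in $v$, and $\gamma(X;\phi)$ an $(n-2)$-form linear in $X\in\mathfrak{diff}(M)$, all depending smoothly on their arguments, with $L,\ell,\theta$ infinitesimally $\mathfrak{diff}(M)$-equivariant, and such that the field equations $E_\phi(v)=\boldsymbol dL_\phi(v)-d\theta_\phi(v)$ are algebraic in $v$ (at $x$, $E_\phi(v)$ vanishes if $v(x)=0$). Let $\mathcal S=\{\phi\in\Phi: E_\phi=0\}$ (on shell), $\theta'=\theta+\boldsymbol d\ell$, $\Theta=\boldsymbol d\theta$, $\beta(X;\phi)=\iota_XL+\mathfrak L_X\ell$, $J(X;\phi)=\theta'_\phi(X^v)-\beta(X;\phi)-d\gamma(X;\phi)$. For a smooth cubical $(n-1)$-chain $\Sigma$ in $M$ put $Q_\Sigma(\boldsymbol X;\phi)=\int_\Sigma J(\boldsymbol X_\phi;\phi)$, $\Theta_\Sigma=\int_\Sigma\Theta$, and define the bracket of charges by $\{Q_\Sigma(\boldsymbol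 X),Q_\Sigma(\boldsymbol Y)\}=\Theta_\Sigma(\boldsymbol X^v,\boldsymbol Y^v)$. Let $$K(X,Y;\phi)=-\big(\mathfrak L_Y\theta'(X^v)-\mathfrak L_X\theta'(Y^v)-\beta([X,Y]_{\mathfrak{diff}(M)};\phi)+\iota_YE(X^v)-\iota_XE(Y^v)\big),$$ and, for a map $\mathscr A$ with $d\mathscr A(X,Y;\phi)=K(X,Y;\phi)$ (a *potential*), let, with $\boldsymbol X,\boldsymbol Y$ evaluated at $\phi$, $$\mathscr C(\boldsymbol X,\boldsymbol Y;\phi)=\int_{\partial\Sigma}\mathscr A(\boldsymbol X,\boldsymbol Y;\phi)+\gamma([\boldsymbol X,\boldsymbol Y]_{\mathfrak{diff}(M)};\phi),\qquad \bar{\mathscr C}=\mathscr C-Q_\Sigma\big(\boldsymbol X^v(\boldsymbol Y)-\boldsymbol Y^v(\boldsymbol X)\big).$$ Define the flux 1-form on $\Phi$ by $\mathcal F_{\boldsymbol X}=Q_\Sigma(\boldsymbol{dX})+\int_{\partial\Sigma}\big(\iota_{\boldsymbol X}\theta-\boldsymbol d\gamma(\boldsymbol X)+\gamma(\boldsymbol{dX})\big)$.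 **Theorem.** 1. $C^\infty(\Phi,\mathfrak{diff}(M))$ is a Lie algebra under $\{\ ,\ \}$, and $[\boldsymbol X^v,\boldsymbol Y^v]=\{\boldsymbol X,\boldsymbol Y\}^v$; the map $\boldsymbol X\mapsto\boldsymbol X^v$ is injective if $\mathfrak{diff}(M)$ acts freely on $\Phi$ (i.e. $\mathfrak L_X\phi=0$ for some $\phi\in\Phi$ only if $X=0$), in which case the Lie algebra is identified with that of the vertical vector fields $\boldsymbol X^v$. 2. $\iota_{\boldsymbol X^v}\Theta_\Sigma=-\boldsymbol dQ_\Sigma(\boldsymbol X)+\mathcal F_{\boldsymbol X}-\int_\Sigma\iota_{\boldsymbol X}E$. 3. $dK=0$; if closed $(n-1)$-forms on $M$ are exact, a bilinear antisymmetric potential exists. For every potential $\mathscr A$, and $\boldsymbol X,\boldsymbol Y,\boldsymbol Z\in C^\infty(\Phi,\mathfrak{diff}(M))$: 4. $\bar{\mathscr C}$ is bilinear and antisymmetric with values in $C^\infty(\Phi)$, and $$\{Q_\Sigma(\boldsymbol X),Q_\Sigma(\boldsymbol Y)\}=Q_\Sigma(\{\boldsymbol X,\boldsymbol Y\})+\bar{\mathscr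 C}(\boldsymbol X,\boldsymbol Y)+\int_\Sigma\big(\iota_{\boldsymbol Y}E(\boldsymbol X^v)-\iota_{\boldsymbol X}E(\boldsymbol Y^v)\big);$$ on $\mathcal S$ the last integral vanishes. 5. On $\mathcal S$, with sums over cyclic permutations, $$\sum_{\rm cyc}\bar{\mathscr C}(\boldsymbol X,\{\boldsymbol Y,\boldsymbol Z\})=\sum_{\rm cyc}(\boldsymbol d\iota_{\boldsymbol X^v}\Theta_\Sigma)(\boldsymbol Y^v,\boldsymbol Z^v)=\sum_{\rm cyc}(\boldsymbol d\mathcal F_{\boldsymbol X})(\boldsymbol Y^v,\boldsymbol Z^v).$$ 6. Let $\mathfrak g\subset C^\infty(\Phi,\mathfrak{diff}(M))$ be a linear subspace closed under $\{\ ,\ \}$, and $B\subset\Phi$ a set of fields (boundary conditions) to which $\mathfrak g$ is tangent (if a smooth $f:\Phi\to\mathbb R$ vanishes on $B$, so does $\boldsymbol X^v(f)$ for all $\boldsymbol X\in\mathfrak g$), such that $\mathcal F_{\boldsymbol X}(\boldsymbol Y^v)=0$ on $B$ for $\boldsymbol X,\boldsymbol Y\in\mathfrak g$. Then on $\mathcal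 S\cap B$, for elements of $\mathfrak g$: the charges are moment maps, $\Theta_\Sigma(\boldsymbol X^v,\boldsymbol Y^v)=-\boldsymbol Y^v(Q_\Sigma(\boldsymbol X))$; $\bar{\mathscr C}$ is a 2-cocycle, $\sum_{\rm cyc}\bar{\mathscr C}(\boldsymbol X,\{\boldsymbol Y,\boldsymbol Z\})=0$; and there is a central extension of Lie algebras $$0\to C^\infty(\mathcal S\cap B)\xrightarrow{\ i\ }P\xrightarrow{\ \pi\ }(\mathfrak g,\{\ ,\ \})\to0$$ with a linear section $q$ of $\pi$ such that $[q(\boldsymbol X),q(\boldsymbol Y)]=q(\{\boldsymbol X,\boldsymbol Y\})+i(\bar{\mathscr C}(\boldsymbol X,\boldsymbol Y))$, and a linear evaluation map $\mathrm{ev}:P\to C^\infty(\mathcal S\cap B)$ with $\mathrm{ev}\circ i=\mathrm{id}$, $\mathrm{ev}(q(\boldsymbol X))=Q_\Sigma(\boldsymbol X)$ and $\mathrm{ev}[q(\boldsymbol X),q(\boldsymbol Y)]=\{Q_\Sigma(\boldsymbol X),Q_\Sigma(\boldsymbol Y)\}$. Here $C^\infty(\mathcal S\cap B)$ is the algebra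 of functions that are smooth along smooth families contained in $\mathcal S\cap B$. -/

import Mathlib

open scoped Manifold ContDiff

universe uE uM uF

noncomputable section

namespace CovPhaseSpace

/-! ### Sections of the natural vector bundles on a manifold, and smooth families of them

The fibre at `x` of a natural bundle is identified with its typical fibre by means of the preferred
chart at `x`, as Mathlib does for the tangent space. -/

section Sections

variable {E : Type*} [NormedAddCommGroup E] [NormedSpace ℝ E]
  {M : Type*} [TopologicalSpace M] [ChartedSpace E M]
  {F : Type*} [NormedAddCommGroup F] [NormedSpace ℝ F]

/-- A family of sets that serves as supports of admissible variations of the fields and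
of the generators of diffeomorphisms: e.g. all subsets of `M`, or the relatively compact ones. -/
structure SupportFamily (M : Type*) [TopologicalSpace M] where
  sets : Set (Set M)
  compact_mem : ∀ K, IsCompact K → K ∈ sets
  subset_mem : ∀ K ∈ sets, ∀ K' ⊆ K, K' ∈ sets
  union_mem : ∀ K ∈ sets, ∀ K' ∈ sets, K ∪ K' ∈ sets
  closure_mem : ∀ K ∈ sets, closure K ∈ sets

/-- Bundle transition data: `T a y` takes the components of a fibre element at `y`
(with respect to the preferred chart at `y`) to its components in the preferred chart at `a`. -/
abbrev Transition (M F : Type*) [NormedAddCommGroup F] [NormedSpace ℝ F] := M → M → (F →L[ℝ] F)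

/-- The local representative of a section `s` in the preferred chart at `a`. -/
def locRep (E : Type*) [NormedAddCommGroup E] [NormedSpace ℝ E] [ChartedSpace E M]
    (T : Transition M F) (s : M → F) (a : M) (z : E) : F :=
  T a ((extChartAt 𝓘(ℝ, E) a).symm z) (s ((extChartAt 𝓘(ℝ, E) a).symm z))

/-- The section `s` is smooth. -/
def SmoothSection (E : Type*) [NormedAddCommGroup E] [NormedSpace ℝ E] [ChartedSpace E M]
    (T : Transition M F) (s : M → F) : Prop :=
  ∀ a, ContDiffOn ℝ ∞ (locRep E T s a) (extChartAt 𝓘(ℝ, E) a).target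

/-- The sections `s p` depend smoothly, jointly with the point of `M`, on the parameter `p`. -/
def SmoothFamily (E : Type*) [NormedAddCommGroup E] [NormedSpace ℝ E] [ChartedSpace E M]
    (T : Transition M F) {k : ℕ} (s : (Fin k → ℝ) → M → F) : Prop :=
  ∀ a, ContDiffOn ℝ ∞ (fun q : (Fin k → ℝ) × E => locRep E T (s q.1) a q.2)
    (Set.univ ×ˢ (extChartAt 𝓘(ℝ, E) a).target)

/-- The space of smooth sections. -/
def Sec (E : Type*) [NormedAddCommGroup E] [NormedSpace ℝ E] [ChartedSpace E M]
    (T : Transition M F) : Submodule ℝ (M → F) where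
  carrier := {s | SmoothSection E T s}
  add_mem' := by
    intro s t hs ht a
    refine ((hs a).add (ht a)).congr fun z _ => ?_
    simp [locRep]
  zero_mem' := by
    intro a
    refine (contDiffOn_const (c := (0 : F))).congr fun z _ => ?_
    simp [locRep]
  smul_mem' := by
    intro r s hs a
    refine ((hs a).const_smul r).congr fun z _ => ?_
    simp [locRep]

/-- The space of smooth sections whose support belongs to the support family. -/
def SecK (E : Type*) [NormedAddCommGroup E] [NormedSpace ℝ E] [ChartedSpace E M]
    (𝒦 : SupportFamily M) (T : Transition M F) : Submodule ℝ (M → F) where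
  carrier := {s | s ∈ Sec E T ∧ ∃ K ∈ 𝒦.sets, ∀ x ∉ K, s x = 0}
  add_mem' := by
    rintro s t ⟨hs, K, hK, h⟩ ⟨ht, K', hK', h'⟩
    refine ⟨(Sec E T).add_mem hs ht, K ∪ K', 𝒦.union_mem K hK K' hK', fun x hx => ?_⟩
    have h1 : x ∉ K := fun hxK => hx (Or.inl hxK)
    have h2 : x ∉ K' := fun hxK => hx (Or.inr hxK)
    simp [h x h1, h' x h2]
  zero_mem' := ⟨(Sec E T).zero_mem, ∅, 𝒦.compact_mem ∅ isCompact_empty, fun _ _ => rfl⟩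
  smul_mem' := by
    rintro r s ⟨hs, K, hK, h⟩
    exact ⟨(Sec E T).smul_mem r hs, K, hK, fun x hx => by simp [h x hx]⟩

theorem SecK_le (𝒦 : SupportFamily M) (T : Transition M F) : SecK E 𝒦 T ≤ Sec E T :=
  fun _ hs => hs.1

open Classical in
/-- A raw section that is smooth with admissible support, as an element of `SecK`
(the default value `0` is taken when it is not). -/
def toSecK (E : Type*) [NormedAddCommGroup E] [NormedSpace ℝ E] [ChartedSpace E M]
    (𝒦 : SupportFamily M) (T : Transition M F) (s : M → F) : SecK E 𝒦 T :=
  if h : s ∈ SecK E 𝒦 T then ⟨s, h⟩ else 0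

/-- A plot: a smooth finite-dimensional family of sections that, locally in the parameter,
varies only inside a set of the support family. -/
def IsPlot (E : Type*) [NormedAddCommGroup E] [NormedSpace ℝ E] [ChartedSpace E M]
    (𝒦 : SupportFamily M) (T : Transition M F) {k : ℕ} (s : (Fin k → ℝ) → M → F) : Prop :=
  SmoothFamily E T s ∧
    ∀ p₀, ∃ K ∈ 𝒦.sets, ∀ᶠ p in nhds p₀, ∀ x ∉ K, s p x = s p₀ x

theorem IsPlot.lin {𝒦 : SupportFamily M} {T : Transition M F} {k : ℕ} {s t : (Fin k → ℝ) → M → F} (r : ℝ)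
    (hs : IsPlot E 𝒦 T s) (ht : IsPlot E 𝒦 T t) : IsPlot E 𝒦 T (fun p => r • s p + t p) := by
  refine ⟨fun a => ?_, fun p₀ => ?_⟩
  · refine (((hs.1 a).const_smul r).add (ht.1 a)).congr fun z _ => ?_
    simp [locRep]
  · obtain ⟨K, hK, h⟩ := hs.2 p₀
    obtain ⟨K', hK', h'⟩ := ht.2 p₀
    refine ⟨K ∪ K', 𝒦.union_mem K hK K' hK', ?_⟩
    filter_upwards [h, h'] with p hp hp' x hx
    have h1 : x ∉ K := fun hxK => hx (Or.inl hxK)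
    have h2 : x ∉ K' := fun hxK => hx (Or.inr hxK)
    simp [hp x h1, hp' x h2]

theorem IsPlot.zero {𝒦 : SupportFamily M} {T : Transition M F} {k : ℕ} :
    IsPlot E 𝒦 T (fun _ : Fin k → ℝ => (0 : M → F)) := by
  refine ⟨fun a => ?_, fun p₀ => ⟨∅, 𝒦.compact_mem ∅ isCompact_empty, by simp⟩⟩
  refine (contDiffOn_const (c := (0 : F))).congr fun z _ => ?_
  simp [locRep]

end Sections

/-! ### Vector fields, differential forms, tensorial fields -/

section Calculus

variable {E : Type*} [NormedAddCommGroup E] [NormedSpace ℝ E] [FiniteDimensional ℝ E]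
  {M : Type*} [TopologicalSpace M] [ChartedSpace E M] [IsManifold 𝓘(ℝ, E) ∞ M]
  {F : Type*} [NormedAddCommGroup F] [NormedSpace ℝ F]

/-- A tensor type: a smooth finite-dimensional representation of `GL(E)`. -/
structure TensorType (E F : Type*) [NormedAddCommGroup E] [NormedSpace ℝ E]
    [NormedAddCommGroup F] [NormedSpace ℝ F] where
  rep : (E →L[ℝ] E) → (F →L[ℝ] F)
  rep_one : rep 1 = 1
  rep_mul : ∀ g h, IsUnit g → IsUnit h → rep (g * h) = rep g * rep h
  smooth : ContDiffOn ℝ ∞ rep {g | IsUnit g}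

variable (E M) in
/-- The tangent bundle. -/
def vecT : Transition M E := fun a y => tangentCoordChange 𝓘(ℝ, E) y a y

variable (M) in
/-- The vector bundle of type `ρ` associated with the frame bundle. -/
def fieldT (ρ : TensorType E F) : Transition M F :=
  fun a y => ρ.rep (tangentCoordChange 𝓘(ℝ, E) y a y)

variable (E M) in
/-- The bundle of alternating `k`-forms on the tangent spaces. -/
def formT (k : ℕ) : Transition M (E [⋀^Fin k]→L[ℝ] ℝ) := fun a y =>
  ContinuousAlternatingMap.compContinuousLinearMapCLM (tangentCoordChange 𝓘(ℝ, E) a y y)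

/-- The Lie algebra of diffeomorphisms: vector fields on `M` with admissible support. -/
abbrev VF (E : Type*) {M : Type*} [NormedAddCommGroup E] [NormedSpace ℝ E] [TopologicalSpace M]
    [ChartedSpace E M] [IsManifold 𝓘(ℝ, E) ∞ M] (𝒦 : SupportFamily M) :=
  SecK E 𝒦 (vecT E M)

/-- Differential forms without smoothness condition. -/
abbrev RawForm (E M : Type*) [NormedAddCommGroup E] [NormedSpace ℝ E] (k : ℕ) :=
  M → E [⋀^Fin k]→L[ℝ] ℝ

variable (E M) in
/-- Smooth differential `k`-forms on `M`. -/
abbrev Form (k : ℕ) := Sec E (formT E M k)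

variable (M) in
/-- All smooth sections of the bundle of type `ρ`. -/
abbrev Fld (ρ : TensorType E F) := Sec E (fieldT M ρ)

/-- Infinitesimal variations of fields: smooth sections with admissible support. -/
abbrev Var (𝒦 : SupportFamily M) (ρ : TensorType E F) := SecK E 𝒦 (fieldT M ρ)

/-- Exterior derivative, computed at `x` in the preferred chart at `x`. -/
def extD {k : ℕ} (η : RawForm E M k) : RawForm E M (k + 1) := fun x =>
  extDeriv (locRep E (formT E M k) η x) (extChartAt 𝓘(ℝ, E) x x)

/-- Interior product. -/
def iota {k : ℕ} (X : M → E) (η : RawForm E M (k + 1)) : RawForm E M k :=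
  fun x => (η x).curryLeft (X x)

/-- Lie derivative of a form of positive degree, by Cartan's formula. -/
def lieForm {k : ℕ} (X : M → E) (η : RawForm E M (k + 1)) : RawForm E M (k + 1) :=
  extD (iota X η) + iota X (extD η)

/-- Lie derivative of a tensorial field of type `ρ`. In the preferred chart at `x` it is
`X^μ ∂_μ φ - ρ_*(∂X) φ`, where `ρ_*` is the derivative of `ρ` at the identity. -/
def lieFld (ρ : TensorType E F) (X : M → E) (φ : M → F) : M → F := fun x =>
  fderiv ℝ (locRep E (fieldT M ρ) φ x) (extChartAt 𝓘(ℝ, E) x x) (X x) -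
    (fderiv ℝ ρ.rep 1 (fderiv ℝ (locRep E (vecT E M) X x) (extChartAt 𝓘(ℝ, E) x x))) (φ x)

/-- The bracket of the Lie algebra of the group of diffeomorphisms: minus the Lie bracket of
vector fields. -/
def diffBracket {𝒦 : SupportFamily M} (X Y : VF E 𝒦) : VF E 𝒦 :=
  toSecK E 𝒦 (vecT E M) (fun x => -(VectorField.mlieBracket 𝓘(ℝ, E) (M := M) X.1 Y.1 x : E))

end Calculus

/-! ### Integration over smooth cubical chains -/

section Chains

variable {E : Type*} [NormedAddCommGroup E] [NormedSpace ℝ E]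
  {M : Type*} [TopologicalSpace M] [ChartedSpace E M]

/-- Smooth singular cubes. -/
abbrev Cube (E M : Type*) [NormedAddCommGroup E] [NormedSpace ℝ E]
    [TopologicalSpace M] [ChartedSpace E M] (k : ℕ) :=
  ContMDiffMap 𝓘(ℝ, Fin k → ℝ) 𝓘(ℝ, E) (Fin k → ℝ) M ∞

/-- Smooth cubical chains with integer coefficients. -/
abbrev Chain (E M : Type*) [NormedAddCommGroup E] [NormedSpace ℝ E]
    [TopologicalSpace M] [ChartedSpace E M] (k : ℕ) := Cube E M k →₀ ℤ

/-- The inclusion of the face `u i = t` of the cube. -/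
def faceMap {k : ℕ} (i : Fin (k + 1)) (t : ℝ) (u : Fin k → ℝ) : Fin (k + 1) → ℝ :=
  Fin.insertNth i t u

theorem contDiff_faceMap {k : ℕ} (i : Fin (k + 1)) (t : ℝ) :
    ContDiff ℝ ∞ (faceMap i t : (Fin k → ℝ) → Fin (k + 1) → ℝ) := by
  rw [contDiff_pi]
  intro j
  refine Fin.succAboveCases i ?_ (fun j => ?_) j
  · simpa [faceMap] using contDiff_const
  · simpa [faceMap] using contDiff_apply ℝ ℝ j

/-- A face of a cube. -/
def cubeFace {k : ℕ} (σ : Cube E M (k + 1)) (i : Fin (k + 1)) (t : ℝ) : Cube E M k :=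
  ⟨fun u => σ (faceMap i t u), σ.contMDiff.comp (contDiff_faceMap i t).contMDiff⟩

/-- The boundary of a chain. -/
def chainBdry {k : ℕ} (c : Chain E M (k + 1)) : Chain E M k :=
  c.sum fun σ n => n • ∑ i : Fin (k + 1), (-1 : ℤ) ^ (i : ℕ) •
    (Finsupp.single (cubeFace σ i 1) 1 - Finsupp.single (cubeFace σ i 0) 1)

/-- The integral of a form over a cube. -/
def cubeIntegral {k : ℕ} (σ : Cube E M k) (η : RawForm E M k) : ℝ :=
  ∫ u in Set.Icc (0 : Fin k → ℝ) 1, η (σ u)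
    (fun i => (mfderiv 𝓘(ℝ, Fin k → ℝ) 𝓘(ℝ, E) σ u (Pi.single i (1 : ℝ)) : E))

/-- The integral of a form over a chain. -/
def chainIntegral {k : ℕ} (c : Chain E M k) (η : RawForm E M k) : ℝ :=
  c.sum fun σ n => (n : ℝ) * cubeIntegral σ η

end Chains

/-! ### Calculus on the space of fields -/

section FieldSpace

variable {E : Type*} [NormedAddCommGroup E] [NormedSpace ℝ E] [FiniteDimensional ℝ E]
  {M : Type*} [TopologicalSpace M] [ChartedSpace E M] [IsManifold 𝓘(ℝ, E) ∞ M]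
  {F : Type*} [NormedAddCommGroup F] [NormedSpace ℝ F]
  {𝒦 : SupportFamily M} {ρ : TensorType E F}

/-- A smooth finite-dimensional family of fields. -/
def FieldPlot (𝒦 : SupportFamily M) {k : ℕ} (c : (Fin k → ℝ) → Fld M ρ) : Prop :=
  IsPlot E 𝒦 (fieldT M ρ) (fun p => (c p).1)

/-- A smooth finite-dimensional family of variations. -/
def VarPlot {k : ℕ} (c : (Fin k → ℝ) → Var 𝒦 ρ) : Prop :=
  IsPlot E 𝒦 (fieldT M ρ) (fun p => (c p).1)

/-- A smooth finite-dimensional family of vector fields. -/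
def VFPlot {k : ℕ} (c : (Fin k → ℝ) → VF E 𝒦) : Prop :=
  IsPlot E 𝒦 (vecT E M) (fun p => (c p).1)

/-- A set of fields is open if its preimage by every smooth finite-dimensional family is. -/
def IsOpenFld (𝒦 : SupportFamily M) (Φ : Set (Fld M ρ)) : Prop :=
  ∀ (k : ℕ) (c : (Fin k → ℝ) → Fld M ρ), FieldPlot 𝒦 c → IsOpen (c ⁻¹' Φ)

/-- The field `φ + t v`. -/
def shift (φ : Fld M ρ) (v : Var 𝒦 ρ) (t : ℝ) : Fld M ρ :=
  φ + t • Submodule.inclusion (SecK_le 𝒦 (fieldT M ρ)) v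

open Classical in
/-- Extension by zero of a function on the field space. -/
def extendZero {W : Type*} [Zero W] {Φ : Set (Fld M ρ)} (f : Φ → W) (φ : Fld M ρ) : W :=
  if h : φ ∈ Φ then f ⟨φ, h⟩ else 0

/-- The derivative of `f` at `φ` along the variation `v`. -/
def ddir {W : Type*} [NormedAddCommGroup W] [NormedSpace ℝ W] {Φ : Set (Fld M ρ)}
    (f : Φ → W) (φ : Φ) (v : Var 𝒦 ρ) : W :=
  deriv (fun t : ℝ => extendZero f (shift φ.1 v t)) 0

/-- The pointwise derivative of a section-valued map. -/
def ddirSec {W : Type*} [NormedAddCommGroup W] [NormedSpace ℝ W] {Φ : Set (Fld M ρ)}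
    (f : Φ → M → W) (φ : Φ) (v : Var 𝒦 ρ) : M → W :=
  fun x => ddir (fun ψ => f ψ x) φ v

/-- The exterior derivative of a 1-form `η` on field space,
`v(η(w)) - w(η(v))` for constant vector fields `v`, `w`. -/
def dForm1 {Φ : Set (Fld M ρ)} (η : Φ → Var 𝒦 ρ → ℝ) (φ : Φ) (v w : Var 𝒦 ρ) : ℝ :=
  ddir (fun ψ => η ψ w) φ v - ddir (fun ψ => η ψ v) φ w

/-- The vertical vector at `φ` generated by `X`: the variation given by the Lie derivative. -/
def vertAt (X : VF E 𝒦) (φ : Fld M ρ) : Var 𝒦 ρ :=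
  toSecK E 𝒦 (fieldT M ρ) (lieFld ρ X.1 φ.1)

/-- The vertical vector field generated by the field-dependent parameter `X`. -/
def vert {Φ : Set (Fld M ρ)} (X : Φ → VF E 𝒦) (φ : Φ) : Var 𝒦 ρ := vertAt (X φ) φ.1

/-- The derivative of the field-dependent vector field `X` along `v`. -/
def dParam {Φ : Set (Fld M ρ)} (X : Φ → VF E 𝒦) (φ : Φ) (v : Var 𝒦 ρ) : VF E 𝒦 :=
  toSecK E 𝒦 (vecT E M) (ddirSec (fun ψ => (X ψ).1) φ v)

/-- `X^v(Y) - Y^v(X)`. -/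
def antiDeriv {Φ : Set (Fld M ρ)} (X Y : Φ → VF E 𝒦) : Φ → VF E 𝒦 :=
  fun φ => dParam Y φ (vert X φ) - dParam X φ (vert Y φ)

/-- The extended bracket of field-dependent vector fields. -/
def extBracket {Φ : Set (Fld M ρ)} (X Y : Φ → VF E 𝒦) : Φ → VF E 𝒦 :=
  fun φ => diffBracket (X φ) (Y φ) + antiDeriv X Y φ

variable (𝒦) in
/-- Smooth functions on field space. -/
def SmoothOn {Φ : Set (Fld M ρ)} (f : Φ → ℝ) : Prop :=
  ∀ (k : ℕ) (c : (Fin k → ℝ) → Φ), FieldPlot 𝒦 (fun p => (c p).1) →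
    ContDiff ℝ ∞ (fun p => f (c p))

variable (𝒦) in
/-- The algebra of smooth functions on a subset of field space. -/
def SmoothFun {Φ : Set (Fld M ρ)} (P : Set Φ) : Subalgebra ℝ (P → ℝ) where
  carrier := {f | ∀ (k : ℕ) (c : (Fin k → ℝ) → P), FieldPlot 𝒦 (fun p => (c p).1.1) →
    ContDiff ℝ ∞ (fun p => f (c p))}
  add_mem' := fun hf hg k c hc => (hf k c hc).add (hg k c hc)
  mul_mem' := fun hf hg k c hc => (hf k c hc).mul (hg k c hc)
  algebraMap_mem' := fun _ _ _ _ => contDiff_const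

/-- The algebra of functions, regarded as an abelian Lie algebra. -/
instance instLieRingSmoothFun {Φ : Set (Fld M ρ)} (P : Set Φ) : LieRing (SmoothFun 𝒦 P) :=
  LieRing.ofAssociativeRing

instance instLieAlgebraSmoothFun {Φ : Set (Fld M ρ)} (P : Set Φ) :
    LieAlgebra ℝ (SmoothFun 𝒦 P) :=
  LieAlgebra.ofAssociativeAlgebra

/-- Restriction to a smaller set. -/
def restr {Φ : Set (Fld M ρ)} (P : Set Φ) (f : Φ → ℝ) : P → ℝ := fun φ => f φ.1

variable (𝒦) in
/-- The maps from `Φ` to the vector fields that take smooth families to smooth families. -/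
def IsSmoothParam {Φ : Set (Fld M ρ)} (X : Φ → VF E 𝒦) : Prop :=
  ∀ (k : ℕ) (c : (Fin k → ℝ) → Φ), FieldPlot 𝒦 (fun p => (c p).1) → VFPlot (fun p => X (c p))

variable (𝒦) in
/-- The field-dependent parameters: smooth maps from field space to the vector fields of `M`. -/
def FieldDepParam (Φ : Set (Fld M ρ)) : Submodule ℝ (Φ → VF E 𝒦) where
  carrier := {X | IsSmoothParam 𝒦 X}
  add_mem' := by
    intro X Y hX hY k c hc
    simpa [VFPlot] using IsPlot.lin 1 (hX k c hc) (hY k c hc)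
  zero_mem' := fun k c _ => IsPlot.zero
  smul_mem' := by
    intro r X hX k c hc
    have h := IsPlot.lin r (hX k c hc) IsPlot.zero
    simpa [VFPlot] using h

/-- A smooth map into differential forms on `M`. -/
def SmoothForms {k j : ℕ} (η : (Fin k → ℝ) → Form E M j) : Prop :=
  SmoothFamily E (formT E M j) (fun p => (η p).1)

end FieldSpace

/-! ### Lagrangian theories -/

section Theories

variable {E : Type*} [NormedAddCommGroup E] [NormedSpace ℝ E] [FiniteDimensional ℝ E]
  {M : Type*} [TopologicalSpace M] [ChartedSpace E M] [IsManifold 𝓘(ℝ, E) ∞ M]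
  {F : Type*} [NormedAddCommGroup F] [NormedSpace ℝ F]

/-- The data of a Lagrangian field theory on a manifold of dimension `m + 2`: the field space `Φ`,
the Lagrangian `L`, the boundary Lagrangian `ℓ`, the presymplectic potential `θ`, and the
ambiguity `γ` in the Noether current. -/
structure LagrangianData (𝒦 : SupportFamily M) (ρ : TensorType E F) (m : ℕ) where
  Φ : Set (Fld M ρ)
  L : Φ → Form E M (m + 2)
  ℓ : Φ → Form E M (m + 1)
  θ : Φ → Var 𝒦 ρ →ₗ[ℝ] Form E M (m + 1)
  γ : Φ → VF E 𝒦 →ₗ[ℝ] Form E M m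

namespace LagrangianData

variable {𝒦 : SupportFamily M} {ρ : TensorType E F} {m : ℕ} (𝒯 : LagrangianData 𝒦 ρ m)

/-- The field equations `E = dL - d θ` as a 1-form on field space. -/
def eom (φ : 𝒯.Φ) (v : Var 𝒦 ρ) : RawForm E M (m + 2) :=
  ddirSec (fun ψ => (𝒯.L ψ).1) φ v - extD (𝒯.θ φ v).1

/-- The theory is smooth and its Lagrangian, boundary Lagrangian and presymplectic potential are
equivariant for the action of the diffeomorphisms of `M` (infinitesimally); the field equations
depend algebraically on the variation. -/
structure IsCovariant : Prop where
  isOpen : IsOpenFld 𝒦 𝒯.Φ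
  smooth_L : ∀ (k : ℕ) (c : (Fin k → ℝ) → 𝒯.Φ), FieldPlot 𝒦 (fun p => (c p).1) →
    SmoothForms (fun p => 𝒯.L (c p))
  smooth_ℓ : ∀ (k : ℕ) (c : (Fin k → ℝ) → 𝒯.Φ), FieldPlot 𝒦 (fun p => (c p).1) →
    SmoothForms (fun p => 𝒯.ℓ (c p))
  smooth_θ : ∀ (k : ℕ) (c : (Fin k → ℝ) → 𝒯.Φ) (v : (Fin k → ℝ) → Var 𝒦 ρ),
    FieldPlot 𝒦 (fun p => (c p).1) → VarPlot v → SmoothForms (fun p => 𝒯.θ (c p) (v p))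
  smooth_γ : ∀ (k : ℕ) (c : (Fin k → ℝ) → 𝒯.Φ) (X : (Fin k → ℝ) → VF E 𝒦),
    FieldPlot 𝒦 (fun p => (c p).1) → VFPlot X → SmoothForms (fun p => 𝒯.γ (c p) (X p))
  covariant_L : ∀ (X : VF E 𝒦) (φ : 𝒯.Φ),
    ddirSec (fun ψ => (𝒯.L ψ).1) φ (vertAt X φ.1) = lieForm X.1 (𝒯.L φ).1
  covariant_ℓ : ∀ (X : VF E 𝒦) (φ : 𝒯.Φ),
    ddirSec (fun ψ => (𝒯.ℓ ψ).1) φ (vertAt X φ.1) = lieForm X.1 (𝒯.ℓ φ).1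
  covariant_θ : ∀ (X : VF E 𝒦) (φ : 𝒯.Φ) (v : Var 𝒦 ρ),
    ddirSec (fun ψ => (𝒯.θ ψ v).1) φ (vertAt X φ.1) +
        (𝒯.θ φ (toSecK E 𝒦 (fieldT M ρ) (lieFld ρ X.1 v.1))).1
      = lieForm X.1 (𝒯.θ φ v).1
  source_form : ∀ (φ : 𝒯.Φ) (v : Var 𝒦 ρ) (x : M), v.1 x = 0 → 𝒯.eom φ v x = 0

/-- The space of solutions of the field equations. -/
def onShell : Set 𝒯.Φ := {φ | ∀ v : Var 𝒦 ρ, 𝒯.eom φ v = 0}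

/-- The presymplectic potential of the Lagrangian `L + dℓ`. -/
def theta' (φ : 𝒯.Φ) (v : Var 𝒦 ρ) : RawForm E M (m + 1) :=
  (𝒯.θ φ v).1 + ddirSec (fun ψ => (𝒯.ℓ ψ).1) φ v

/-- The form `β(X; φ)`, with `dβ` the variation of `L + dℓ` along `X`. -/
def beta (X : VF E 𝒦) (φ : 𝒯.Φ) : RawForm E M (m + 1) :=
  iota X.1 (𝒯.L φ).1 + lieForm X.1 (𝒯.ℓ φ).1

/-- The Noether current. -/
def current (X : VF E 𝒦) (φ : 𝒯.Φ) : RawForm E M (m + 1) :=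
  𝒯.theta' φ (vertAt X φ.1) - 𝒯.beta X φ - extD (𝒯.γ φ X).1

/-- The Noether charge of a field-dependent parameter. -/
def charge (S : Chain E M (m + 1)) (X : 𝒯.Φ → VF E 𝒦) (φ : 𝒯.Φ) : ℝ :=
  chainIntegral S (𝒯.current (X φ) φ)

/-- The presymplectic current, the exterior derivative of `θ` on field space. -/
def Theta (φ : 𝒯.Φ) (v w : Var 𝒦 ρ) : RawForm E M (m + 1) :=
  ddirSec (fun ψ => (𝒯.θ ψ w).1) φ v - ddirSec (fun ψ => (𝒯.θ ψ v).1) φ w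

/-- The presymplectic 2-form. -/
def presymplectic (S : Chain E M (m + 1)) (φ : 𝒯.Φ) (v w : Var 𝒦 ρ) : ℝ :=
  chainIntegral S (𝒯.Theta φ v w)

/-- The bracket of the charges of `X` and `Y`. -/
def chargeBracket (S : Chain E M (m + 1)) (X Y : 𝒯.Φ → VF E 𝒦) (φ : 𝒯.Φ) : ℝ :=
  𝒯.presymplectic S φ (vert X φ) (vert Y φ)

/-- The closed form of which the integrand of the cocycle is a potential. -/
def anomaly (X Y : VF E 𝒦) (φ : 𝒯.Φ) : RawForm E M (m + 1) :=
  -(lieForm Y.1 (𝒯.theta' φ (vertAt X φ.1)) - lieForm X.1 (𝒯.theta' φ (vertAt Y φ.1))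
    - 𝒯.beta (diffBracket X Y) φ
    + iota Y.1 (𝒯.eom φ (vertAt X φ.1)) - iota X.1 (𝒯.eom φ (vertAt Y φ.1)))

/-- `A` is a potential of the anomaly. -/
def IsPotential (A : VF E 𝒦 → VF E 𝒦 → 𝒯.Φ → Form E M m) : Prop :=
  ∀ X Y φ, extD (A X Y φ).1 = 𝒯.anomaly X Y φ

/-- The map `𝒞`, evaluated at the values at `φ` of field-dependent parameters. -/
def cocycle (A : VF E 𝒦 → VF E 𝒦 → 𝒯.Φ → Form E M m) (S : Chain E M (m + 1))
    (X Y : 𝒯.Φ → VF E 𝒦) (φ : 𝒯.Φ) : ℝ :=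
  chainIntegral (chainBdry S) ((A (X φ) (Y φ) φ).1 + (𝒯.γ φ (diffBracket (X φ) (Y φ))).1)

/-- The map `𝒞̄`. -/
def cocycleBar (A : VF E 𝒦 → VF E 𝒦 → 𝒯.Φ → Form E M m) (S : Chain E M (m + 1))
    (X Y : 𝒯.Φ → VF E 𝒦) (φ : 𝒯.Φ) : ℝ :=
  chainIntegral (chainBdry S) ((A (X φ) (Y φ) φ).1 + (𝒯.γ φ (diffBracket (X φ) (Y φ))).1)
    - chainIntegral S (𝒯.current (antiDeriv X Y φ) φ)

/-- The Noetherian flux of `X`, a 1-form on field space: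
`Q(dX) + ∫_{∂Σ} (ι_X θ - d γ(X) + γ(dX))`. -/
def flux (S : Chain E M (m + 1)) (X : 𝒯.Φ → VF E 𝒦) (φ : 𝒯.Φ) (v : Var 𝒦 ρ) : ℝ :=
  chainIntegral S (𝒯.current (dParam X φ v) φ)
    + chainIntegral (chainBdry S) (iota (X φ).1 (𝒯.θ φ v).1
        - ddirSec (fun ψ => (𝒯.γ ψ (X ψ)).1) φ v
        + (𝒯.γ φ (dParam X φ v)).1)

end LagrangianData

end Theories

end CovPhaseSpace

end

open CovPhaseSpace

open scoped Manifold ContDiff Topology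
open Filter Set MeasureTheory

noncomputable section

namespace CovPhaseSpace

set_option linter.unusedSectionVars false

/-! ### Parametric integrals, Hadamard's lemma, smooth retractions. -/

section Analysis

variable {P V W : Type*} [NormedAddCommGroup P] [NormedSpace ℝ P]
  [NormedAddCommGroup V] [NormedSpace ℝ V] [FiniteDimensional ℝ V]
  [NormedAddCommGroup W] [NormedSpace ℝ W]

/-! Field space is probed only through smooth finite-dimensional families. Since `Φ` is open along
them, the family φ + t v can be reparametrized so as to stay in `Φ` without changing near t = 0
(`exists_confPlot_shift`), and every derivative on field space becomes a partial derivative of such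
a family. Two-parameter families φ + s v + t w give linearity and symmetry of derivatives
(`ddir_lin`, `ddir_symm`). Hadamard's lemma for families of sections (`Plot.exists_hadamard`) writes
s(t) = s(0) + t s₁(t) with s₁ again a smooth family; this gives the Leibniz rule
(`IsSmoothLin.ddirSec_apply`) and lets the derivative pass through linear operations on sections and
through integrals (`ddirSec_map`, `ddir_chainIntegral`).

On M, the Lie derivative of tensorial fields is natural under changes of chart and satisfies [L_X,
L_Y] = L_[X,Y] (`lieFld_commutator`). The derivative of X^v along v is (dX(v))^v + L_X v
(`dSec_vert`), so that [X^v, Y^v] = {X, Y}^v (`vert_extBracket`). The Jacobi identity cannot be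
pulled back along X ↦ X^v, since the action need not be free; instead it is expanded directly, the
second derivatives cancel by symmetry, and the Jacobi identity on M remains (`extBracket_jacobi`).

The physics rests on two identities between forms on M. Differentiating the Noether current with the
covariance of θ gives dJ(X)(v) = -Θ(X^v, v) + J(dX(v)) + d(ι_X θ(v) - dγ(X)(v) + γ(dX(v))) - ι_X
E(v) (`ddirSec_current`); integrated with Stokes' theorem, this is the formula for ι_{X^v} Θ_Σ. And
the anomaly is K(X, Y) = Θ(X^v, Y^v) - J([X, Y]) - dγ([X, Y]) - ι_Y E(X^v) + ι_X E(Y^v)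
(`anomaly_eq`). Hence, for any potential, the modified cocycle is the integral of an explicit form
`cocycleForm` in which the potential no longer occurs (`cocycleBar_eq`). Smoothness, bilinearity,
antisymmetry and the bracket of charges are read off from that form.

On shell the modified cocycle is Θ_Σ(X^v, Y^v) - Q({X, Y}). In the cyclic sum the charges drop out
by Jacobi, and closedness of Θ turns the rest into the cyclic sum of d(ι_{X^v} Θ_Σ)
(`cocycle_obstruction`). The flux differs from ι_{X^v} Θ_Σ by dQ, which is closed, and by the
integral of ι_X E, whose derivative along vertical directions vanishes on shell because E is
equivariant (`covariant_eom`, `dForm1_flux`).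

If the fluxes vanish on B, then dF_X(Y^v, Z^v) = Y^v(F_X(Z^v)) - Z^v(F_X(Y^v)) - F_X({Y, Z}^v)
vanishes there too, because 𝔤 is tangent to B and closed under the bracket
(`dForm1_flux_of_vanish`). The resulting 2-cocycle defines the extension on 𝔤 × C^∞, on which
evaluation adds the charge of the first component to the second component
(`exists_centralExtension`). -/

theorem exists_smooth_cutoff {K U : Set V} (hK : IsCompact K) (hU : IsOpen U) (hKU : K ⊆ U) :
    ∃ (χ : V → ℝ) (K' : Set V), ContDiff ℝ ∞ χ ∧ IsCompact K' ∧ K' ⊆ U ∧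
      (∀ x ∈ K, χ x = 1) ∧ ∀ x ∉ K', χ x = 0 := by
  obtain ⟨V', hV'o, hKV', hV'U, hV'c⟩ := exists_open_between_and_isCompact_closure hK hU hKU
  obtain ⟨f, hf0, hf1, -⟩ := exists_contMDiffMap_zero_one_of_isClosed (n := (⊤ : ℕ∞)) 𝓘(ℝ, V)
    (s := V'ᶜ) (t := K) hV'o.isClosed_compl hK.isClosed
    (disjoint_compl_left_iff_subset.2 hKV')
  refine ⟨f, closure V', f.contMDiff.contDiff, hV'c, hV'U, fun x hx => hf1 hx, fun x hx => ?_⟩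
  exact hf0 (fun h => hx (subset_closure h))

/-- The integral is the value at 0 of the convolution of the indicator of `K` with a cut-off,
reflected copy of `G`, and convolutions with a parameter are known to be smooth. The tube lemma
supplies a product neighbourhood of `p₀` and `K` on which `G` is smooth, which makes room for the
cutoff. -/
theorem contDiffAt_setIntegral_nat [MeasurableSpace V] [BorelSpace V] {μ : Measure V}
    [IsFiniteMeasureOnCompacts μ] {K : Set V} (hK : IsCompact K)
    {G : P × V → W} {p₀ : P} {n : ℕ} [CompleteSpace W]
    (hG : ∀ u ∈ K, ContDiffAt ℝ n G (p₀, u)) :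
    ContDiffAt ℝ n (fun p => ∫ u in K, G (p, u) ∂μ) p₀ := by
  have hev : ∀ u ∈ K, ∀ᶠ q in 𝓝 (p₀, u), ContDiffAt ℝ n G q := fun u hu =>
    (hG u hu).eventually (by simp)
  have hopen : IsOpen {q | ContDiffAt ℝ n G q} := by
    rw [isOpen_iff_mem_nhds]
    intro q hq
    exact ContDiffAt.eventually hq (by simp)
  obtain ⟨A, B, hA, hB, hpA, hKB, hAB⟩ := generalized_tube_lemma (isCompact_singleton (x := p₀)) hK
    hopen (by rintro ⟨p, u⟩ ⟨hp, hu⟩; rw [mem_singleton_iff] at hp; subst hp; exact hG u hu)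
  obtain ⟨χ, K', hχ, hK', hK'B, hχ1, hχ0⟩ := exists_smooth_cutoff hK hB hKB
  -- The convolution at 0 evaluates its second factor at `-u`, hence the reflection here. The cutoff
  -- equals 1 on `K`, so the integral does not change.
  let g : P → V → W := fun p y => χ (-y) • G (p, -y)
  have hg : ContDiffOn ℝ (n : ℕ∞) (Function.uncurry g) (A ×ˢ univ) := by
    rintro ⟨p, y⟩ ⟨hp, -⟩
    refine ContDiffAt.contDiffWithinAt ?_
    by_cases hy : -y ∈ B
    · have h1 : ContDiffAt ℝ n G (p, -y) := hAB ⟨hp, hy⟩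
      have h2 : ContDiffAt ℝ n (fun q : P × V => G (q.1, -q.2)) (p, y) :=
        ContDiffAt.comp (p, y) (f := fun q : P × V => (q.1, -q.2)) h1 (by fun_prop)
      have h3 : ContDiffAt ℝ n (fun q : P × V => χ (-q.2)) (p, y) := by
        have : ContDiff ℝ n χ := hχ.of_le (by exact_mod_cast le_top)
        fun_prop
      exact h3.smul h2
    · have hy' : -y ∉ K' := fun h => hy (hK'B h)
      have : Function.uncurry g =ᶠ[𝓝 (p, y)] fun _ => 0 := by
        have h4 : ∀ᶠ q : P × V in 𝓝 (p, y), -q.2 ∈ K'ᶜ := by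
          have : Continuous fun q : P × V => -q.2 := by fun_prop
          exact this.continuousAt.eventually (hK'.isClosed.isOpen_compl.mem_nhds hy')
        filter_upwards [h4] with q hq
        simp [Function.uncurry, g, hχ0 _ hq]
      exact contDiffAt_const.congr_of_eventuallyEq this
  have hloc : LocallyIntegrable (K.indicator (fun _ => (1 : ℝ))) μ :=
    ((continuous_const (y := (1:ℝ))).locallyIntegrable).indicator hK.measurableSet
  have key := contDiffOn_convolution_right_with_param_comp (μ := μ) (𝕜 := ℝ)
    (ContinuousLinearMap.lsmul ℝ ℝ (E := W))
    (s := A) (v := fun _ => (0 : V)) contDiffOn_const (f := K.indicator (fun _ => (1 : ℝ)))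
    (g := g) (k := -K') hA hK'.neg (fun p x _ hx => by simp [g, hχ0 (-x) (by simpa using hx)])
    hloc hg
  have key' := (key.contDiffAt (hA.mem_nhds (hpA rfl)))
  refine key'.congr_of_eventuallyEq (Eventually.of_forall fun p => ?_)
  simp only [convolution, g, zero_sub, neg_neg, ContinuousLinearMap.lsmul_apply]
  rw [← integral_indicator hK.measurableSet]
  refine integral_congr_ae (Eventually.of_forall fun t => ?_)
  by_cases ht : t ∈ K
  · simp [ht, hχ1 t ht]
  · simp [ht]

/-- A parametric integral over a compact set depends smoothly on the parameter. -/
theorem contDiffAt_setIntegral [MeasurableSpace V] [BorelSpace V] {μ : Measure V}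
    [IsFiniteMeasureOnCompacts μ] {K : Set V} (hK : IsCompact K)
    {G : P × V → W} {p₀ : P} [CompleteSpace W] (hG : ∀ u ∈ K, ContDiffAt ℝ ∞ G (p₀, u)) :
    ContDiffAt ℝ ∞ (fun p => ∫ u in K, G (p, u) ∂μ) p₀ := by
  rw [contDiffAt_infty]
  exact fun n => contDiffAt_setIntegral_nat hK fun u hu => contDiffAt_infty.1 (hG u hu) n

/-- Fundamental theorem of calculus for u ↦ t⁻¹ h(u t). The integral also makes sense at t = 0,
where it is the derivative. -/
theorem dslope_eq_integral [CompleteSpace W] {h : ℝ → W} {t : ℝ} (ht : ∀ u ∈ Icc (0:ℝ) 1, ContDiffAt ℝ 1 h (u * t)) :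
    dslope h 0 t = ∫ u in Icc (0:ℝ) 1, deriv h (u * t) := by
  rcases eq_or_ne t 0 with rfl | hne
  · simp
  rw [dslope_of_ne _ hne, slope_def_module, integral_Icc_eq_integral_Ioc,
    ← intervalIntegral.integral_of_le zero_le_one]
  have h1 : ∀ u ∈ uIcc (0:ℝ) 1, HasDerivAt (fun u => t⁻¹ • h (u * t)) (deriv h (u * t)) u := by
    intro u hu
    rw [uIcc_of_le zero_le_one] at hu
    have h2 := ((ht u hu).differentiableAt one_ne_zero).hasDerivAt
    have h3 := (h2.scomp u ((hasDerivAt_id u).mul_const t)).const_smul t⁻¹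
    refine (h3.congr_deriv (by simp [smul_smul, hne]))
  rw [intervalIntegral.integral_eq_sub_of_hasDerivAt h1]
  · simp [smul_sub]
  · refine ContinuousOn.intervalIntegrable fun u hu => ?_
    rw [uIcc_of_le zero_le_one] at hu
    have h4 : ContDiffAt ℝ 0 (deriv h) (u * t) := by
      have := (ht u hu).fderiv_right (m := 0) (by simp)
      exact this.clm_apply contDiffAt_const
    exact (h4.continuousAt.comp (f := fun u => u * t) (by fun_prop)).continuousWithinAt

/-- Hadamard's lemma: the difference quotient in one variable of a smooth function of several
variables is smooth. -/
theorem contDiffAt_dslope [CompleteSpace W] {g : ℝ × P → W} {t₀ : ℝ} {z₀ : P}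
    (h0 : ContDiffAt ℝ ∞ g (0, z₀)) (ht : ContDiffAt ℝ ∞ g (t₀, z₀)) :
    ContDiffAt ℝ ∞ (fun q : ℝ × P => dslope (fun t => g (t, q.2)) 0 q.1) (t₀, z₀) := by
  rcases eq_or_ne t₀ 0 with rfl | hne
  · have hd : ContDiffAt ℝ ∞ (fun q : ℝ × P => fderiv ℝ g q (1, 0)) (0, z₀) :=
      (h0.fderiv_right (m := ∞) (by simp)).clm_apply contDiffAt_const
    -- Near t = 0 the quotient is the integral over u of ∂_t g(u t, z), which is smooth in (t, z);
    -- the segments from 0 to t stay in a ball on which g is C¹.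
    have hG : ContDiffAt ℝ ∞ (fun q : ℝ × P =>
        ∫ u in Icc (0:ℝ) 1, fderiv ℝ g (u * q.1, q.2) (1, 0)) (0, z₀) := by
      refine contDiffAt_setIntegral (G := fun r : (ℝ × P) × ℝ =>
        fderiv ℝ g (r.2 * r.1.1, r.1.2) (1, 0)) isCompact_Icc fun u _ => ?_
      refine ContDiffAt.comp ((0, z₀), u) (f := fun r : (ℝ × P) × ℝ => (r.2 * r.1.1, r.1.2))
        (g := fun q : ℝ × P => fderiv ℝ g q (1, 0)) ?_ (by fun_prop)
      simpa using hd
    refine hG.congr_of_eventuallyEq ?_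
    have hev : ∀ᶠ q in 𝓝 ((0 : ℝ), z₀), ContDiffAt ℝ 1 g q :=
      (h0.of_le (by norm_cast)).eventually (by simp)
    rw [nhds_prod_eq] at hev
    obtain ⟨p1, hp1, p2, hp2, h12⟩ := eventually_prod_iff.1 hev
    obtain ⟨ε, hε, hball⟩ := Metric.eventually_nhds_iff_ball.1 hp1
    have : ∀ᶠ q in 𝓝 ((0 : ℝ), z₀), q.1 ∈ Metric.ball (0:ℝ) ε ∧ p2 q.2 := by
      rw [nhds_prod_eq]
      exact prod_mem_prod (Metric.ball_mem_nhds (0:ℝ) hε) hp2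
    filter_upwards [this] with q hq
    have hu : ∀ u ∈ Icc (0:ℝ) 1, ContDiffAt ℝ 1 g (u * q.1, q.2) := by
      intro u hu
      refine h12 (hball _ ?_) hq.2
      have := hq.1
      simp only [mem_ball_zero_iff, Real.norm_eq_abs, abs_mul] at this ⊢
      calc |u| * |q.1| ≤ 1 * |q.1| := by
            gcongr; rw [abs_of_nonneg hu.1]; exact hu.2
        _ < ε := by simpa using this
    rw [dslope_eq_integral (h := fun t => g (t, q.2))]
    · refine setIntegral_congr_fun measurableSet_Icc fun u hu' => ?_
      have h1 : HasFDerivAt g (fderiv ℝ g (u * q.1, q.2)) (u * q.1, q.2) :=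
        ((hu u hu').differentiableAt one_ne_zero).hasFDerivAt
      have h2 : HasDerivAt (fun t : ℝ => (t, q.2)) ((1 : ℝ), (0 : P)) (u * q.1) :=
        (hasDerivAt_id _).prodMk (hasDerivAt_const _ _)
      exact (h1.comp_hasDerivAt (u * q.1) h2).deriv
    · intro u hu'
      exact (hu u hu').comp (u * q.1) (f := fun t : ℝ => (t, q.2)) (by fun_prop)
  -- Away from t = 0 the difference quotient itself is smooth.
  · have hz : ContDiffAt ℝ ∞ (fun q : ℝ × P => q.1⁻¹ • (g q - g (0, q.2))) (t₀, z₀) := by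
      have h1 : ContDiffAt ℝ ∞ (fun q : ℝ × P => g (0, q.2)) (t₀, z₀) :=
        ContDiffAt.comp (t₀, z₀) (f := fun q : ℝ × P => ((0:ℝ), q.2)) h0 (by fun_prop)
      have h2 : ContDiffAt ℝ ∞ (fun q : ℝ × P => q.1⁻¹) (t₀, z₀) := contDiffAt_fst.inv hne
      exact h2.smul (ht.sub h1)
    refine hz.congr_of_eventuallyEq ?_
    have : ∀ᶠ q in 𝓝 (t₀, z₀), q.1 ≠ 0 :=
      continuous_fst.continuousAt.eventually_ne hne
    filter_upwards [this] with q hq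
    rw [dslope_of_ne _ hq, slope_def_module]
    simp

/-- A smooth map into a neighbourhood of `p₀` that is the identity near `p₀`. -/
theorem exists_smooth_retraction {U : Set V} {p₀ : V} (hU : U ∈ 𝓝 p₀) :
    ∃ r : V → V, ContDiff ℝ ∞ r ∧ (∀ p, r p ∈ U) ∧ r =ᶠ[𝓝 p₀] id := by
  obtain ⟨ε, hε, hball⟩ := Metric.nhds_basis_ball.mem_iff.1 hU
  -- With outer radius ε/2, the point p₀ + χ(p)(p - p₀) lies in the ε-ball, whether or not χ(p)
  -- vanishes.
  let χ : ContDiffBump p₀ := ⟨ε / 3, ε / 2, by positivity, by linarith⟩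
  refine ⟨fun p => p₀ + χ p • (p - p₀), ?_, fun p => hball ?_, ?_⟩
  · have : ContDiff ℝ ∞ (fun p => χ p) := χ.contDiff
    exact contDiff_const.add (this.smul (contDiff_id.sub contDiff_const))
  · simp only [Metric.mem_ball, dist_self_add_left, norm_smul, Real.norm_eq_abs]
    rw [abs_of_nonneg χ.nonneg]
    by_cases hp : dist p p₀ < ε / 2
    · calc χ p * ‖p - p₀‖ ≤ 1 * ‖p - p₀‖ := by gcongr; exact χ.le_one
        _ < ε := by rw [one_mul, ← dist_eq_norm]; linarith
    · rw [χ.zero_of_le_dist (not_lt.1 hp)]; simpa using hε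
  · filter_upwards [χ.eventuallyEq_one] with p hp
    simp [hp]

end Analysis

/-! ### Smooth families of sections over arbitrary parameter spaces. -/

section Plots

variable {E : Type*} [NormedAddCommGroup E] [NormedSpace ℝ E]
  {M : Type*} [TopologicalSpace M] [ChartedSpace E M]
  {F : Type*} [NormedAddCommGroup F] [NormedSpace ℝ F]
  {P P' : Type*} [NormedAddCommGroup P] [NormedSpace ℝ P]
  [NormedAddCommGroup P'] [NormedSpace ℝ P']
  {T : Transition M F} {𝒦 : SupportFamily M}

/-- The family of all subsets. -/
def SupportFamily.univ (M : Type*) [TopologicalSpace M] : SupportFamily M where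
  sets := Set.univ
  compact_mem _ _ := trivial
  subset_mem _ _ _ _ := trivial
  union_mem _ _ _ _ := trivial
  closure_mem _ _ := trivial

/-- A family of sections is smooth at the parameter `p`, jointly with the point of `M`. -/
def SmoothFamAt (E : Type*) [NormedAddCommGroup E] [NormedSpace ℝ E] [ChartedSpace E M]
    (T : Transition M F) (s : P → M → F) (p : P) : Prop :=
  ∀ a, ∀ z ∈ (extChartAt 𝓘(ℝ, E) a).target,
    ContDiffAt ℝ ∞ (fun q : P × E => locRep E T (s q.1) a q.2) (p, z)

/-- A plot whose parameters form an arbitrary normed space. -/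
structure Plot (E : Type*) [NormedAddCommGroup E] [NormedSpace ℝ E] [ChartedSpace E M]
    (𝒦 : SupportFamily M) (T : Transition M F) (s : P → M → F) : Prop where
  smooth : ∀ p, SmoothFamAt E T s p
  supp : ∀ p₀, ∃ K ∈ 𝒦.sets, ∀ᶠ p in 𝓝 p₀, ∀ x ∉ K, s p x = s p₀ x

/-- The transition data are normalized: the components in the preferred chart at `x` of a fibre
element at `x` are the element itself. -/
class NormalizedTransition (T : Transition M F) : Prop where
  self : ∀ x, T x x = 1

theorem smoothFamily_iff {k : ℕ} {s : (Fin k → ℝ) → M → F} :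
    SmoothFamily E T s ↔ ∀ p, SmoothFamAt E T s p := by
  constructor
  · intro h p a z hz
    exact (h a).contDiffAt ((isOpen_univ.prod (isOpen_extChartAt_target a)).mem_nhds ⟨trivial, hz⟩)
  · rintro h a ⟨p, z⟩ ⟨-, hz⟩
    exact (h p a z hz).contDiffWithinAt

theorem isPlot_iff {k : ℕ} {s : (Fin k → ℝ) → M → F} : IsPlot E 𝒦 T s ↔ Plot E 𝒦 T s :=
  ⟨fun h => ⟨smoothFamily_iff.1 h.1, h.2⟩, fun h => ⟨smoothFamily_iff.2 h.1, h.2⟩⟩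

theorem smoothFamily_iff_plot {k : ℕ} {s : (Fin k → ℝ) → M → F} :
    SmoothFamily E T s ↔ Plot E (.univ M) T s :=
  smoothFamily_iff.trans ⟨fun h => ⟨h, fun _ => ⟨Set.univ, trivial, by simp⟩⟩, fun h => h.1⟩

theorem plot_univ_iff {s : P → M → F} :
    Plot E (.univ M) T s ↔ ∀ p, SmoothFamAt E T s p :=
  ⟨fun h => h.1, fun h => ⟨h, fun _ => ⟨Set.univ, trivial, by simp⟩⟩⟩

theorem Plot.toUniv {s : P → M → F} (h : Plot E 𝒦 T s) : Plot E (.univ M) T s :=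
  plot_univ_iff.2 h.1

theorem locRep_add (s t : M → F) (a : M) (z : E) :
    locRep E T (s + t) a z = locRep E T s a z + locRep E T t a z := by simp [locRep]

theorem locRep_smul (r : ℝ) (s : M → F) (a : M) (z : E) :
    locRep E T (r • s) a z = r • locRep E T s a z := by simp [locRep]

theorem locRep_self [NormalizedTransition T] (s : M → F) (x : M) :
    locRep E T s x (extChartAt 𝓘(ℝ, E) x x) = s x := by
  simp [locRep, NormalizedTransition.self]

theorem mem_Sec_iff {s : M → F} : s ∈ Sec E T ↔ ∀ a, ∀ z ∈ (extChartAt 𝓘(ℝ, E) a).target,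
    ContDiffAt ℝ ∞ (locRep E T s a) z := by
  constructor
  · intro h a z hz
    exact (h a).contDiffAt ((isOpen_extChartAt_target a).mem_nhds hz)
  · intro h a z hz
    exact (h a z hz).contDiffWithinAt

namespace SmoothFamAt

theorem comp {s : P → M → F} {r : P' → P} {p : P'} (h : SmoothFamAt E T s (r p))
    (hr : ContDiffAt ℝ ∞ r p) : SmoothFamAt E T (fun p => s (r p)) p := by
  intro a z hz
  exact ContDiffAt.comp (p, z) (f := fun q : P' × E => (r q.1, q.2)) (h a z hz) <|
    (ContDiffAt.comp (p, z) (f := Prod.fst) hr contDiffAt_fst).prodMk contDiffAt_snd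

theorem add {s t : P → M → F} {p : P} (hs : SmoothFamAt E T s p) (ht : SmoothFamAt E T t p) :
    SmoothFamAt E T (fun p => s p + t p) p := by
  intro a z hz
  simpa only [locRep_add] using (hs a z hz).add (ht a z hz)

theorem smul {s : P → M → F} {f : P → ℝ} {p : P} (hf : ContDiffAt ℝ ∞ f p)
    (hs : SmoothFamAt E T s p) : SmoothFamAt E T (fun p => f p • s p) p := by
  intro a z hz
  simp only [locRep_smul]
  exact (ContDiffAt.comp (p, z) (f := Prod.fst) hf contDiffAt_fst).smul (hs a z hz)

theorem congr {s t : P → M → F} {p : P} (hs : SmoothFamAt E T s p) (h : t =ᶠ[𝓝 p] s) :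
    SmoothFamAt E T t p := by
  intro a z hz
  refine (hs a z hz).congr_of_eventuallyEq ?_
  filter_upwards [continuous_fst.continuousAt.eventually h] with q hq
  rw [hq]

theorem const {s : M → F} (hs : s ∈ Sec E T) (p : P) : SmoothFamAt E T (fun _ => s) p := by
  intro a z hz
  exact ContDiffAt.comp (p, z) (f := Prod.snd) (mem_Sec_iff.1 hs a z hz) contDiffAt_snd

theorem locRep_at {s : P → M → F} {p : P} (hs : SmoothFamAt E T s p) {a : M} {z : E}
    (hz : z ∈ (extChartAt 𝓘(ℝ, E) a).target) :
    ContDiffAt ℝ ∞ (fun p => locRep E T (s p) a z) p :=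
  ContDiffAt.comp p (f := fun p => (p, z)) (hs a z hz) (by fun_prop)

theorem eval [NormalizedTransition T] {s : P → M → F} {p : P} (hs : SmoothFamAt E T s p) (x : M) :
    ContDiffAt ℝ ∞ (fun p => s p x) p := by
  simpa only [locRep_self] using hs.locRep_at (mem_extChartAt_target (I := 𝓘(ℝ, E)) x)

theorem mem_Sec {s : P → M → F} {p : P} (hs : SmoothFamAt E T s p) : s p ∈ Sec E T := by
  refine mem_Sec_iff.2 fun a z hz => ?_
  exact ContDiffAt.comp z (f := fun z => (p, z)) (hs a z hz) (by fun_prop)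

/-- At a fixed point of `M` the passage to the chart at `a` is a fixed continuous linear map, so it
commutes with the derivative in the parameter. The derivative section is thus read off from the
jointly smooth local representative. -/
theorem locRep_fderiv [NormalizedTransition T] {s : P → M → F} {p : P} (hs : SmoothFamAt E T s p)
    (u : P) {a : M} {z : E} (hz : z ∈ (extChartAt 𝓘(ℝ, E) a).target) :
    locRep E T (fun x => fderiv ℝ (fun p => s p x) p u) a z =
      fderiv ℝ (fun q : P × E => locRep E T (s q.1) a q.2) (p, z) (u, 0) := by
  set y := (extChartAt 𝓘(ℝ, E) a).symm z
  have h1 : HasFDerivAt (fun p => s p y) (fderiv ℝ (fun p => s p y) p) p :=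
    ((hs.eval y).differentiableAt (by simp)).hasFDerivAt
  have h2 := (T a y).hasFDerivAt.comp p h1
  have h3 : HasFDerivAt (fun q : P × E => locRep E T (s q.1) a q.2) _ (p, z) :=
    ((hs a z hz).differentiableAt (by simp)).hasFDerivAt
  have h4 := h3.comp p (f := fun p => (p, z)) ((hasFDerivAt_id p).prodMk (hasFDerivAt_const z p))
  have h5 := DFunLike.congr_fun (h2.unique h4) u
  simpa [locRep, y] using h5

theorem fderiv_param [NormalizedTransition T] {s : P → M → F} (hs : ∀ p, SmoothFamAt E T s p)
    (u : P) (p : P) : SmoothFamAt E T (fun p x => fderiv ℝ (fun p => s p x) p u) p := by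
  intro a z hz
  have h1 := ((hs p a z hz).fderiv_right (m := ∞) (by simp)).clm_apply
    (contDiffAt_const (c := ((u, 0) : P × E)))
  refine h1.congr_of_eventuallyEq ?_
  have : ∀ᶠ q : P × E in 𝓝 (p, z), q.2 ∈ (extChartAt 𝓘(ℝ, E) a).target :=
    continuous_snd.continuousAt.eventually ((isOpen_extChartAt_target a).mem_nhds hz)
  filter_upwards [this] with q hq
  exact (hs q.1).locRep_fderiv u hq

end SmoothFamAt

namespace Plot

theorem comp {s : P → M → F} {r : P' → P} (h : Plot E 𝒦 T s) (hr : ContDiff ℝ ∞ r) :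
    Plot E 𝒦 T (fun p => s (r p)) := by
  refine ⟨fun p => (h.smooth (r p)).comp hr.contDiffAt, fun p => ?_⟩
  obtain ⟨K, hK, h⟩ := h.supp (r p)
  exact ⟨K, hK, hr.continuous.continuousAt.eventually h⟩

theorem add {s t : P → M → F} (hs : Plot E 𝒦 T s) (ht : Plot E 𝒦 T t) :
    Plot E 𝒦 T (fun p => s p + t p) := by
  refine ⟨fun p => (hs.smooth p).add (ht.smooth p), fun p => ?_⟩
  obtain ⟨K, hK, h⟩ := hs.supp p
  obtain ⟨K', hK', h'⟩ := ht.supp p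
  refine ⟨K ∪ K', 𝒦.union_mem K hK K' hK', ?_⟩
  filter_upwards [h, h'] with p hp hp' x hx
  simp [hp x (fun h => hx (Or.inl h)), hp' x (fun h => hx (Or.inr h))]

theorem of_locally {s : P → M → F} (h : ∀ p, ∃ t, Plot E 𝒦 T t ∧ s =ᶠ[𝓝 p] t) :
    Plot E 𝒦 T s := by
  refine ⟨fun p => ?_, fun p => ?_⟩
  · obtain ⟨t, ht, hst⟩ := h p
    exact (ht.smooth p).congr hst
  · obtain ⟨t, ht, hst⟩ := h p
    obtain ⟨K, hK, hsup⟩ := ht.supp p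
    refine ⟨K, hK, ?_⟩
    filter_upwards [hst, hsup] with q hq hq' x hx
    rw [hq, hq' x hx, hst.self_of_nhds]

theorem const {s : M → F} (hs : s ∈ Sec E T) : Plot E 𝒦 T (fun _ : P => s) :=
  ⟨fun p => .const hs p, fun _ => ⟨∅, 𝒦.compact_mem ∅ isCompact_empty, by simp⟩⟩

/-- A family of sections with admissible supports has locally a common admissible support. -/
theorem exists_support {s : P → M → F} (h : Plot E 𝒦 T s) (hK : ∀ p, s p ∈ SecK E 𝒦 T) (p : P) :
    ∃ K ∈ 𝒦.sets, ∀ᶠ q in 𝓝 p, ∀ x ∉ K, s q x = 0 := by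
  obtain ⟨K, hK1, h1⟩ := h.supp p
  obtain ⟨-, K', hK', h2⟩ := hK p
  refine ⟨K ∪ K', 𝒦.union_mem K hK1 K' hK', ?_⟩
  filter_upwards [h1] with q hq x hx
  rw [hq x (fun h => hx (Or.inl h)), h2 x (fun h => hx (Or.inr h))]

/-- Sections that vanish off a common admissible set agree there with one another, so the support
condition of a plot is automatic. -/
theorem of_support {s : P → M → F} (h : ∀ p, SmoothFamAt E T s p)
    (hK : ∀ p, ∃ K ∈ 𝒦.sets, ∀ᶠ q in 𝓝 p, ∀ x ∉ K, s q x = 0) : Plot E 𝒦 T s := by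
  refine ⟨h, fun p => ?_⟩
  obtain ⟨K, hK, h⟩ := hK p
  refine ⟨K, hK, ?_⟩
  filter_upwards [h] with q hq x hx
  rw [hq x hx, h.self_of_nhds x hx]

theorem mem_SecK_of_support {s : P → M → F} (h : ∀ p, SmoothFamAt E T s p)
    (hK : ∀ p, ∃ K ∈ 𝒦.sets, ∀ᶠ q in 𝓝 p, ∀ x ∉ K, s q x = 0) (p : P) : s p ∈ SecK E 𝒦 T := by
  obtain ⟨K, hK, h'⟩ := hK p
  exact ⟨(h p).mem_Sec, K, hK, h'.self_of_nhds⟩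

theorem smul {s : P → M → F} {f : P → ℝ} (hf : ContDiff ℝ ∞ f) (h : Plot E 𝒦 T s)
    (hK : ∀ p, s p ∈ SecK E 𝒦 T) : Plot E 𝒦 T (fun p => f p • s p) := by
  refine of_support (fun p => (h.smooth p).smul hf.contDiffAt) fun p => ?_
  obtain ⟨K, hK, h'⟩ := h.exists_support hK p
  refine ⟨K, hK, ?_⟩
  filter_upwards [h'] with q hq x hx
  simp [hq x hx]

/-- Off the admissible set the values are locally constant in the parameter, so their derivative
vanishes. In particular the derivative has admissible support even if the members of the family do
not. -/
theorem fderiv_support {s : P → M → F} (h : Plot E 𝒦 T s) (u : P) (p : P) :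
    ∃ K ∈ 𝒦.sets, ∀ᶠ q in 𝓝 p, ∀ x ∉ K, fderiv ℝ (fun p => s p x) q u = 0 := by
  obtain ⟨K, hK, h'⟩ := h.supp p
  refine ⟨K, hK, ?_⟩
  filter_upwards [h'.eventually_nhds] with q hq x hx
  have : (fun p => s p x) =ᶠ[𝓝 q] fun _ => s p x := by
    filter_upwards [hq] with r hr using hr x hx
  simp [this.fderiv_eq]

theorem fderiv_param [NormalizedTransition T] {s : P → M → F} (h : Plot E 𝒦 T s) (u : P) :
    Plot E 𝒦 T (fun p x => fderiv ℝ (fun p => s p x) p u) :=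
  of_support (SmoothFamAt.fderiv_param h.smooth u) (h.fderiv_support u)

theorem fderiv_mem [NormalizedTransition T] {s : P → M → F} (h : Plot E 𝒦 T s) (u : P) (p : P) :
    (fun x => fderiv ℝ (fun p => s p x) p u) ∈ SecK E 𝒦 T :=
  mem_SecK_of_support (SmoothFamAt.fderiv_param h.smooth u) (h.fderiv_support u) p

/-- Hadamard's lemma for smooth families of sections. -/
theorem exists_hadamard [NormalizedTransition T] [CompleteSpace F] {s : ℝ → M → F}
    (h : Plot E 𝒦 T s) :
    ∃ s₁ : ℝ → M → F, Plot E 𝒦 T s₁ ∧ (∀ t, s₁ t ∈ SecK E 𝒦 T) ∧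
      (∀ᶠ t in 𝓝 0, s t = s 0 + t • s₁ t) ∧ s₁ 0 = fun x => deriv (fun t => s t x) 0 := by
  obtain ⟨K, hK, hs⟩ := h.supp 0
  -- After reparametrization by `r`, the family varies only inside the single set `K` for all t. The
  -- quotient `s₁` is then supported in `K`, and nothing changes near t = 0.
  obtain ⟨r, hr, hrU, hrid⟩ := exists_smooth_retraction hs
  have hr0 : r 0 = 0 := hrid.self_of_nhds
  have h' : Plot E 𝒦 T (fun t => s (r t)) := h.comp hr
  let s₁ : ℝ → M → F := fun t x => dslope (fun t => s (r t) x) 0 t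
  have hd : ∀ x t, DifferentiableAt ℝ (fun t => s (r t) x) t := fun x t =>
    ((h'.smooth t).eval x).differentiableAt (by simp)
  have hloc : ∀ t a z, locRep E T (s₁ t) a z =
      dslope (fun t => locRep E T (s (r t)) a z) 0 t := by
    intro t a z
    have := (T a ((extChartAt 𝓘(ℝ, E) a).symm z)).dslope_comp
      (fun t => s (r t) ((extChartAt 𝓘(ℝ, E) a).symm z)) 0 t (fun _ => hd _ _)
    exact this.symm
  have hsm : ∀ t, SmoothFamAt E T s₁ t := by
    intro t a z hz
    simp only [hloc]
    exact contDiffAt_dslope (g := fun q : ℝ × E => locRep E T (s (r q.1)) a q.2)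
      (h'.smooth 0 a z hz) (h'.smooth t a z hz)
  have hsup : ∀ t, ∀ x ∉ K, s₁ t x = 0 := by
    intro t x hx
    have : (fun t => s (r t) x) = fun _ => s 0 x := funext fun t => hrU t x hx
    simp only [s₁, this]
    rcases eq_or_ne t 0 with rfl | ht
    · simp
    · simp [dslope_of_ne _ ht, slope_def_module]
  have hsup' : ∀ t, ∃ K ∈ 𝒦.sets, ∀ᶠ q in 𝓝 t, ∀ x ∉ K, s₁ q x = 0 := fun t =>
    ⟨K, hK, Eventually.of_forall hsup⟩
  refine ⟨s₁, of_support hsm hsup', mem_SecK_of_support hsm hsup', ?_, ?_⟩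
  · filter_upwards [hrid] with t ht
    funext x
    have := sub_smul_dslope (fun t => s (r t) x) 0 t
    simp only [sub_zero, ht, hr0, id] at this
    simp [s₁, this]
  · funext x
    simp only [s₁, dslope_same]
    refine Filter.EventuallyEq.deriv_eq ?_
    filter_upwards [hrid] with t ht
    simp [ht]

/-- A family given on parameter spaces `ℝ^k` is given on all finite-dimensional ones. -/
theorem ofFin [FiniteDimensional ℝ P] {s : P → M → F}
    (h : ∀ (k : ℕ) (e : (Fin k → ℝ) ≃L[ℝ] P), Plot E 𝒦 T (fun p => s (e p))) :
    Plot E 𝒦 T s := by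
  let e : (Fin (Module.finrank ℝ P) → ℝ) ≃L[ℝ] P :=
    ContinuousLinearEquiv.ofFinrankEq (by simp)
  simpa using (h _ e).comp e.symm.contDiff

end Plot

end Plots

/-- This is the order of smoothness required for the symmetry of second derivatives, for d² = 0 and
for the naturality of d. -/
theorem minSmoothness_two_le : minSmoothness ℝ 2 ≤ ∞ := by
  rw [minSmoothness_of_isRCLikeNormedField]
  exact (by norm_cast : (2 : WithTop ℕ∞) ≤ ((⊤ : ℕ∞) : WithTop ℕ∞))

/-! ### Lie derivatives of tensorial fields on a vector space. -/

section LocalLie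

variable {E : Type*} [NormedAddCommGroup E] [NormedSpace ℝ E] [FiniteDimensional ℝ E]
  {F : Type*} [NormedAddCommGroup F] [NormedSpace ℝ F]

theorem TensorType.contDiffAt (ρ : TensorType E F) {g : E →L[ℝ] E} (hg : IsUnit g) :
    ContDiffAt ℝ ∞ ρ.rep g := by
  have : CompleteSpace E := FiniteDimensional.complete ℝ E
  exact ρ.smooth.contDiffAt (Units.isOpen.mem_nhds hg)

theorem eventually_isUnit {g : E →L[ℝ] E} (hg : IsUnit g) : ∀ᶠ h in 𝓝 g, IsUnit h := by
  have : CompleteSpace E := FiniteDimensional.complete ℝ E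
  exact Units.isOpen.mem_nhds hg

/-- The derivative of the representation at the identity. -/
def TensorType.lie (ρ : TensorType E F) : (E →L[ℝ] E) →L[ℝ] (F →L[ℝ] F) := fderiv ℝ ρ.rep 1

theorem TensorType.hasFDerivAt (ρ : TensorType E F) {g : E →L[ℝ] E} (hg : IsUnit g) :
    HasFDerivAt ρ.rep (fderiv ℝ ρ.rep g) g :=
  ((ρ.contDiffAt hg).differentiableAt (by simp)).hasFDerivAt

/-- Differentiate ρ(k g) = ρ(k) ρ(g) at k = 1. The relation is available only for invertible k,
which suffices because the units are open. -/
theorem TensorType.fderiv_rep_mul_left (ρ : TensorType E F) {g : E →L[ℝ] E} (hg : IsUnit g)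
    (h : E →L[ℝ] E) : fderiv ℝ ρ.rep g (h * g) = ρ.lie h * ρ.rep g := by
  have h1 : HasFDerivAt (fun k => ρ.rep k * ρ.rep g) _ 1 :=
    (ρ.hasFDerivAt isUnit_one).mul_const' (ρ.rep g)
  have h2 : HasFDerivAt (fun k : E →L[ℝ] E => k * g) _ 1 := (hasFDerivAt_id (𝕜 := ℝ) (1 : E →L[ℝ] E)).mul_const' g
  have h3 : HasFDerivAt ρ.rep (fderiv ℝ ρ.rep g) (1 * g) := by
    rw [one_mul]; exact ρ.hasFDerivAt hg
  have h4 := h3.comp 1 h2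
  have h5 : (ρ.rep ∘ fun k : E →L[ℝ] E => k * g) =ᶠ[𝓝 1] fun k => ρ.rep k * ρ.rep g := by
    filter_upwards [eventually_isUnit isUnit_one] with k hk
    exact ρ.rep_mul k g hk hg
  simpa [TensorType.lie] using DFunLike.congr_fun (h4.unique (h1.congr_of_eventuallyEq h5)) h

theorem TensorType.fderiv_rep_mul_right (ρ : TensorType E F) {g : E →L[ℝ] E} (hg : IsUnit g)
    (h : E →L[ℝ] E) : fderiv ℝ ρ.rep g (g * h) = ρ.rep g * ρ.lie h := by
  have h1 : HasFDerivAt (fun k => ρ.rep g * ρ.rep k) _ 1 :=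
    (ContinuousLinearMap.mul ℝ (F →L[ℝ] F) (ρ.rep g)).hasFDerivAt.comp 1 (ρ.hasFDerivAt isUnit_one)
  have h2 : HasFDerivAt (fun k : E →L[ℝ] E => g * k) (ContinuousLinearMap.mul ℝ (E →L[ℝ] E) g) 1 :=
    (ContinuousLinearMap.mul ℝ (E →L[ℝ] E) g).hasFDerivAt
  have h3 : HasFDerivAt ρ.rep (fderiv ℝ ρ.rep g) (g * 1) := by
    rw [mul_one]; exact ρ.hasFDerivAt hg
  have h4 := h3.comp 1 h2
  have h5 : (ρ.rep ∘ fun k : E →L[ℝ] E => g * k) =ᶠ[𝓝 1] fun k => ρ.rep g * ρ.rep k := by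
    filter_upwards [eventually_isUnit isUnit_one] with k hk
    exact ρ.rep_mul g k hg hk
  simpa [TensorType.lie] using DFunLike.congr_fun (h4.unique (h1.congr_of_eventuallyEq h5)) h

/-- Differentiate the identity of `fderiv_rep_mul_left`, Dρ_k(B k) = ρ_*(B) ρ(k), once more at k = 1
in the direction A. -/
theorem TensorType.fderiv_fderiv_rep (ρ : TensorType E F) (A B : E →L[ℝ] E) :
    fderiv ℝ (fderiv ℝ ρ.rep) 1 A B + ρ.lie (B * A) = ρ.lie B * ρ.lie A := by
  have hc := (ρ.contDiffAt isUnit_one).fderiv_right (m := ∞) (by simp)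
  have h1 : HasFDerivAt (fderiv ℝ ρ.rep) (fderiv ℝ (fderiv ℝ ρ.rep) 1) 1 :=
    (hc.differentiableAt (by simp)).hasFDerivAt
  have h2 : HasFDerivAt (fun k : E →L[ℝ] E => B * k) (ContinuousLinearMap.mul ℝ (E →L[ℝ] E) B) 1 :=
    (ContinuousLinearMap.mul ℝ (E →L[ℝ] E) B).hasFDerivAt
  have h3 := h1.clm_apply h2
  have h4 : HasFDerivAt (fun k => ρ.lie B * ρ.rep k) _ 1 :=
    (ContinuousLinearMap.mul ℝ (F →L[ℝ] F) (ρ.lie B)).hasFDerivAt.comp 1 (ρ.hasFDerivAt isUnit_one)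
  have h5 : (fun k => fderiv ℝ ρ.rep k (B * k)) =ᶠ[𝓝 1] fun k => ρ.lie B * ρ.rep k := by
    filter_upwards [eventually_isUnit isUnit_one] with k hk
    exact ρ.fderiv_rep_mul_left hk B
  have h6 := DFunLike.congr_fun (h3.unique (h4.congr_of_eventuallyEq h5)) A
  simpa [TensorType.lie, add_comm] using h6

/-- Antisymmetrizing `fderiv_fderiv_rep` removes the symmetric second derivative of ρ: the
derivative of a representation is one of Lie algebras. -/
theorem TensorType.lie_commutator (ρ : TensorType E F) (A B : E →L[ℝ] E) :
    ρ.lie (A * B - B * A) = ρ.lie A * ρ.lie B - ρ.lie B * ρ.lie A := by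
  have hs : IsSymmSndFDerivAt ℝ ρ.rep 1 :=
    (ρ.contDiffAt isUnit_one).isSymmSndFDerivAt minSmoothness_two_le
  rw [map_sub, ← ρ.fderiv_fderiv_rep A B, ← ρ.fderiv_fderiv_rep B A, hs A B]
  abel

/-- The Lie derivative of a tensorial field on a vector space. -/
def lieLoc (ρ : TensorType E F) (X : E → E) (φ : E → F) (z : E) : F :=
  fderiv ℝ φ z (X z) - ρ.lie (fderiv ℝ X z) (φ z)

/-- Differentiating the two transformation laws produces second derivatives of τ. Those in the
derivative of the field are compensated by those in the derivative of the vector field, through ρ_*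
and the symmetry of D²τ. -/
theorem lieLoc_naturality (ρ : TensorType E F) {τ X X' : E → E} {φ φ' : E → F} {z : E}
    (hτ : ContDiffAt ℝ ∞ τ z) (hu : IsUnit (fderiv ℝ τ z))
    (hX : DifferentiableAt ℝ X z) (hX' : DifferentiableAt ℝ X' (τ z))
    (hφ : DifferentiableAt ℝ φ z) (hφ' : DifferentiableAt ℝ φ' (τ z))
    (hXX' : ∀ᶠ w in 𝓝 z, X' (τ w) = fderiv ℝ τ w (X w))
    (hφφ' : ∀ᶠ w in 𝓝 z, φ' (τ w) = ρ.rep (fderiv ℝ τ w) (φ w)) :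
    lieLoc ρ X' φ' (τ z) = ρ.rep (fderiv ℝ τ z) (lieLoc ρ X φ z) := by
  set A := fderiv ℝ τ z with hA
  have hτ1 : HasFDerivAt τ A z := (hτ.differentiableAt (by simp)).hasFDerivAt
  have hτ2 : HasFDerivAt (fderiv ℝ τ) (fderiv ℝ (fderiv ℝ τ) z) z :=
    ((hτ.fderiv_right (m := ∞) (by simp)).differentiableAt (by simp)).hasFDerivAt
  have hsym : IsSymmSndFDerivAt ℝ τ z := hτ.isSymmSndFDerivAt minSmoothness_two_le
  have e1 := (hX'.hasFDerivAt.comp z hτ1).unique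
    ((hτ2.clm_apply hX.hasFDerivAt).congr_of_eventuallyEq hXX')
  have e2 := (hφ'.hasFDerivAt.comp z hτ1).unique
    ((((ρ.hasFDerivAt hu).comp z hτ2).clm_apply hφ.hasFDerivAt).congr_of_eventuallyEq hφφ')
  -- Symmetry of D²τ moves the vector field into the slot in which it also appears after
  -- differentiating the law for φ along X.
  have hDX : fderiv ℝ X' (τ z) * A = fderiv ℝ (fderiv ℝ τ) z (X z) + A * fderiv ℝ X z := by
    ext h
    have := DFunLike.congr_fun e1 h
    have hs := hsym h (X z)
    simp only [ContinuousLinearMap.comp_apply, add_apply,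
      ContinuousLinearMap.flip_apply] at this
    rw [ContinuousLinearMap.mul_def, ContinuousLinearMap.mul_def, ContinuousLinearMap.comp_apply,
      this, add_apply, ContinuousLinearMap.comp_apply, ← hs, add_comm]
  have e3 := DFunLike.congr_fun e2 (X z)
  simp only [ContinuousLinearMap.comp_apply, add_apply,
      ContinuousLinearMap.flip_apply, Function.comp_apply] at e3
  have hrep : ρ.lie (fderiv ℝ X' (τ z)) * ρ.rep A =
      fderiv ℝ ρ.rep A (fderiv ℝ (fderiv ℝ τ) z (X z)) + ρ.rep A * ρ.lie (fderiv ℝ X z) := by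
    rw [← ρ.fderiv_rep_mul_left hu, hDX, map_add, ρ.fderiv_rep_mul_right hu]
  have hrep' := DFunLike.congr_fun hrep (φ z)
  simp only [ContinuousLinearMap.mul_def, ContinuousLinearMap.comp_apply, add_apply] at hrep'
  rw [lieLoc, lieLoc, hXX'.self_of_nhds, hφφ'.self_of_nhds, ← hA, e3, hrep', map_sub]
  abel

theorem fderiv_lieLoc (ρ : TensorType E F) {X : E → E} {φ : E → F} {z : E}
    (hX : ContDiffAt ℝ ∞ X z) (hφ : ContDiffAt ℝ ∞ φ z) (h : E) :
    fderiv ℝ (lieLoc ρ X φ) z h = fderiv ℝ (fderiv ℝ φ) z h (X z) + fderiv ℝ φ z (fderiv ℝ X z h)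
      - (ρ.lie (fderiv ℝ (fderiv ℝ X) z h) (φ z) + ρ.lie (fderiv ℝ X z) (fderiv ℝ φ z h)) := by
  have hX1 : HasFDerivAt X _ z := (hX.differentiableAt (by simp)).hasFDerivAt
  have hX2 : HasFDerivAt (fderiv ℝ X) _ z :=
    ((hX.fderiv_right (m := ∞) (by simp)).differentiableAt (by simp)).hasFDerivAt
  have hφ1 : HasFDerivAt φ _ z := (hφ.differentiableAt (by simp)).hasFDerivAt
  have hφ2 : HasFDerivAt (fderiv ℝ φ) _ z :=
    ((hφ.fderiv_right (m := ∞) (by simp)).differentiableAt (by simp)).hasFDerivAt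
  have h1 := (hφ2.clm_apply hX1).sub ((ρ.lie.hasFDerivAt.comp z hX2).clm_apply hφ1)
  have h2 : HasFDerivAt (lieLoc ρ X φ) _ z := h1
  rw [h2.fderiv]
  simp only [sub_apply, ContinuousLinearMap.comp_apply,
    add_apply, ContinuousLinearMap.flip_apply, Function.comp_apply]
  abel

/-- The tensor type of vector fields. -/
def idType (E : Type*) [NormedAddCommGroup E] [NormedSpace ℝ E] : TensorType E E where
  rep := id
  rep_one := rfl
  rep_mul _ _ _ _ := rfl
  smooth := contDiffOn_id

theorem idType_lie (A : E →L[ℝ] E) : (idType E).lie A = A := by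
  simp [TensorType.lie, idType]

/-- The Lie derivative is a representation of the Lie algebra of vector fields. -/
theorem lieLoc_commutator (ρ : TensorType E F) {X Y : E → E} {φ : E → F} {z : E}
    (hX : ContDiffAt ℝ ∞ X z) (hY : ContDiffAt ℝ ∞ Y z) (hφ : ContDiffAt ℝ ∞ φ z) :
    lieLoc ρ X (lieLoc ρ Y φ) z - lieLoc ρ Y (lieLoc ρ X φ) z =
      lieLoc ρ (lieLoc (idType E) X Y) φ z := by
  have hs : ∀ h k, fderiv ℝ (fderiv ℝ φ) z h k = fderiv ℝ (fderiv ℝ φ) z k h :=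
    (hφ.isSymmSndFDerivAt minSmoothness_two_le : IsSymmSndFDerivAt ℝ φ z)
  have hsX : ∀ h k, fderiv ℝ (fderiv ℝ X) z h k = fderiv ℝ (fderiv ℝ X) z k h :=
    (hX.isSymmSndFDerivAt minSmoothness_two_le : IsSymmSndFDerivAt ℝ X z)
  have hsY : ∀ h k, fderiv ℝ (fderiv ℝ Y) z h k = fderiv ℝ (fderiv ℝ Y) z k h :=
    (hY.isSymmSndFDerivAt minSmoothness_two_le : IsSymmSndFDerivAt ℝ Y z)
  -- The commutator of the Jacobians of X and Y is what `lie_commutator` turns into the commutator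
  -- of the endomorphisms acting on φ.
  have hD : fderiv ℝ (lieLoc (idType E) X Y) z =
      fderiv ℝ (fderiv ℝ Y) z (X z) - fderiv ℝ (fderiv ℝ X) z (Y z)
        - (fderiv ℝ X z * fderiv ℝ Y z - fderiv ℝ Y z * fderiv ℝ X z) := by
    ext h
    rw [fderiv_lieLoc _ hX hY]
    simp only [idType_lie, sub_apply, ContinuousLinearMap.mul_def, ContinuousLinearMap.comp_apply]
    rw [hsY h, hsX h]
    abel
  rw [lieLoc, lieLoc, lieLoc.eq_1 _ (lieLoc (idType E) X Y), hD, fderiv_lieLoc _ hY hφ,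
    lieLoc.eq_1 _ Y (lieLoc ρ X φ), fderiv_lieLoc _ hX hφ]
  rw [map_sub ρ.lie, ρ.lie_commutator]
  simp only [map_sub ρ.lie, lieLoc, idType_lie, map_sub,
    sub_apply, ContinuousLinearMap.mul_def, ContinuousLinearMap.comp_apply]
  rw [hs (X z)]
  abel

end LocalLie

/-! ### Changes of chart and the Lie derivative on the manifold. -/

section Charts

variable {E : Type*} [NormedAddCommGroup E] [NormedSpace ℝ E] [FiniteDimensional ℝ E]
  {M : Type*} [TopologicalSpace M] [ChartedSpace E M] [IsManifold 𝓘(ℝ, E) ∞ M]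
  {F : Type*} [NormedAddCommGroup F] [NormedSpace ℝ F]
  {P : Type*} [NormedAddCommGroup P] [NormedSpace ℝ P]
  {𝒦 : SupportFamily M}

/-- The transition map between preferred charts. -/
def transMap (E : Type*) [NormedAddCommGroup E] [NormedSpace ℝ E] [ChartedSpace E M]
    (a b : M) : E → E := extChartAt 𝓘(ℝ, E) b ∘ (extChartAt 𝓘(ℝ, E) a).symm

theorem tcc_eq_fderiv (a b y : M) : tangentCoordChange 𝓘(ℝ, E) a b y =
    fderiv ℝ (transMap E a b) (extChartAt 𝓘(ℝ, E) a y) := by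
  rw [tangentCoordChange_def, modelWithCornersSelf_coe, Set.range_id, fderivWithin_univ]; rfl

theorem tcc_self {a y : M} (h : y ∈ (extChartAt 𝓘(ℝ, E) a).source) :
    tangentCoordChange 𝓘(ℝ, E) a a y = 1 := by
  ext v; exact tangentCoordChange_self h

theorem tcc_mul {a b c y : M} (ha : y ∈ (extChartAt 𝓘(ℝ, E) a).source)
    (hb : y ∈ (extChartAt 𝓘(ℝ, E) b).source) (hc : y ∈ (extChartAt 𝓘(ℝ, E) c).source) :
    tangentCoordChange 𝓘(ℝ, E) b c y * tangentCoordChange 𝓘(ℝ, E) a b y =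
      tangentCoordChange 𝓘(ℝ, E) a c y := by
  ext v; exact tangentCoordChange_comp ⟨⟨ha, hb⟩, hc⟩

theorem tcc_mul_inv {a b y : M} (ha : y ∈ (extChartAt 𝓘(ℝ, E) a).source)
    (hb : y ∈ (extChartAt 𝓘(ℝ, E) b).source) :
    tangentCoordChange 𝓘(ℝ, E) b a y * tangentCoordChange 𝓘(ℝ, E) a b y = 1 := by
  rw [tcc_mul ha hb ha, tcc_self ha]

theorem tcc_isUnit {a b y : M} (ha : y ∈ (extChartAt 𝓘(ℝ, E) a).source)
    (hb : y ∈ (extChartAt 𝓘(ℝ, E) b).source) : IsUnit (tangentCoordChange 𝓘(ℝ, E) a b y) :=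
  ⟨⟨_, _, tcc_mul_inv hb ha, tcc_mul_inv ha hb⟩, rfl⟩

instance (ρ : TensorType E F) : NormalizedTransition (fieldT M ρ) :=
  ⟨fun x => by rw [fieldT, tcc_self (mem_extChartAt_source x), ρ.rep_one]⟩

instance : NormalizedTransition (vecT E M) :=
  ⟨fun x => by rw [vecT, tcc_self (mem_extChartAt_source x)]⟩

instance (k : ℕ) : NormalizedTransition (formT E M k) :=
  ⟨fun x => by
    ext η v
    rw [formT, tcc_self (mem_extChartAt_source x)]
    rfl⟩

theorem transMap_mem {a b : M} {z : E}
    (hb : (extChartAt 𝓘(ℝ, E) a).symm z ∈ (extChartAt 𝓘(ℝ, E) b).source) :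
    transMap E a b z ∈ (extChartAt 𝓘(ℝ, E) b).target :=
  (extChartAt 𝓘(ℝ, E) b).map_source hb

theorem symm_transMap {a b : M} {z : E}
    (hb : (extChartAt 𝓘(ℝ, E) a).symm z ∈ (extChartAt 𝓘(ℝ, E) b).source) :
    (extChartAt 𝓘(ℝ, E) b).symm (transMap E a b z) = (extChartAt 𝓘(ℝ, E) a).symm z :=
  (extChartAt 𝓘(ℝ, E) b).left_inv hb

theorem eventually_overlap {a b : M} {z : E} (hz : z ∈ (extChartAt 𝓘(ℝ, E) a).target)
    (hb : (extChartAt 𝓘(ℝ, E) a).symm z ∈ (extChartAt 𝓘(ℝ, E) b).source) :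
    ∀ᶠ w in 𝓝 z, w ∈ (extChartAt 𝓘(ℝ, E) a).target ∧
      (extChartAt 𝓘(ℝ, E) a).symm w ∈ (extChartAt 𝓘(ℝ, E) b).source :=
  Filter.Eventually.and ((isOpen_extChartAt_target a).mem_nhds hz)
    ((continuousAt_extChartAt_symm'' hz).eventually
      ((isOpen_extChartAt_source (I := 𝓘(ℝ, E)) b).mem_nhds hb))

theorem contDiffAt_transMap {a b : M} {z : E} (hz : z ∈ (extChartAt 𝓘(ℝ, E) a).target)
    (hb : (extChartAt 𝓘(ℝ, E) a).symm z ∈ (extChartAt 𝓘(ℝ, E) b).source) :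
    ContDiffAt ℝ ∞ (transMap E a b) z := by
  have := contDiffWithinAt_ext_coord_change (I := 𝓘(ℝ, E)) (n := ∞) b a (y := z)
    (by rw [PartialEquiv.trans_source]; exact ⟨hz, hb⟩)
  rwa [modelWithCornersSelf_coe, Set.range_id, contDiffWithinAt_univ] at this

theorem fderiv_transMap {a b : M} {z : E} (hz : z ∈ (extChartAt 𝓘(ℝ, E) a).target) :
    fderiv ℝ (transMap E a b) z =
      tangentCoordChange 𝓘(ℝ, E) a b ((extChartAt 𝓘(ℝ, E) a).symm z) := by
  rw [tcc_eq_fderiv, (extChartAt 𝓘(ℝ, E) a).right_inv hz]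

theorem isUnit_fderiv_transMap {a b : M} {z : E} (hz : z ∈ (extChartAt 𝓘(ℝ, E) a).target)
    (hb : (extChartAt 𝓘(ℝ, E) a).symm z ∈ (extChartAt 𝓘(ℝ, E) b).source) :
    IsUnit (fderiv ℝ (transMap E a b) z) := by
  rw [fderiv_transMap hz]
  exact tcc_isUnit ((extChartAt 𝓘(ℝ, E) a).map_target hz) hb

/-- The cocycle relation of the tangent coordinate changes y → a → b, combined with multiplicativity
of ρ on invertible maps. -/
theorem locRep_fieldT_transMap (ρ : TensorType E F) (φ : M → F) {a b : M} {z : E}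
    (hz : z ∈ (extChartAt 𝓘(ℝ, E) a).target)
    (hb : (extChartAt 𝓘(ℝ, E) a).symm z ∈ (extChartAt 𝓘(ℝ, E) b).source) :
    locRep E (fieldT M ρ) φ b (transMap E a b z) =
      ρ.rep (fderiv ℝ (transMap E a b) z) (locRep E (fieldT M ρ) φ a z) := by
  have ha := (extChartAt 𝓘(ℝ, E) a).map_target hz
  have hy := mem_extChartAt_source (I := 𝓘(ℝ, E)) ((extChartAt 𝓘(ℝ, E) a).symm z)
  rw [locRep, locRep, symm_transMap hb, fderiv_transMap hz, fieldT, fieldT, ← tcc_mul hy ha hb,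
    ρ.rep_mul _ _ (tcc_isUnit ha hb) (tcc_isUnit hy ha)]
  rfl

theorem locRep_vecT_transMap (X : M → E) {a b : M} {z : E}
    (hz : z ∈ (extChartAt 𝓘(ℝ, E) a).target)
    (hb : (extChartAt 𝓘(ℝ, E) a).symm z ∈ (extChartAt 𝓘(ℝ, E) b).source) :
    locRep E (vecT E M) X b (transMap E a b z) =
      fderiv ℝ (transMap E a b) z (locRep E (vecT E M) X a z) :=
  locRep_fieldT_transMap (idType E) X hz hb

theorem locRep_formT_transMap {k : ℕ} (η : RawForm E M k) {a b : M} {z : E}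
    (hz : z ∈ (extChartAt 𝓘(ℝ, E) a).target)
    (hb : (extChartAt 𝓘(ℝ, E) a).symm z ∈ (extChartAt 𝓘(ℝ, E) b).source) :
    locRep E (formT E M k) η a z =
      (locRep E (formT E M k) η b (transMap E a b z)).compContinuousLinearMap
        (fderiv ℝ (transMap E a b) z) := by
  have ha := (extChartAt 𝓘(ℝ, E) a).map_target hz
  have hy := mem_extChartAt_source (I := 𝓘(ℝ, E)) ((extChartAt 𝓘(ℝ, E) a).symm z)
  rw [locRep, locRep, symm_transMap hb, fderiv_transMap hz, formT, formT, ← tcc_mul ha hb hy]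
  rfl

theorem lieFld_eq_lieLoc (ρ : TensorType E F) (X : M → E) (φ : M → F) (x : M) :
    lieFld ρ X φ x = lieLoc ρ (locRep E (vecT E M) X x) (locRep E (fieldT M ρ) φ x)
      (extChartAt 𝓘(ℝ, E) x x) := by
  rw [lieLoc, locRep_self, locRep_self]; rfl

/-- The Lie derivative is defined at each point in the chart centred there; naturality lets a single
chart compute it on its whole domain. Smoothness and iterated Lie derivatives depend on this. -/
theorem locRep_lieFld (ρ : TensorType E F) {X : M → E} {φ : M → F}
    (hX : X ∈ Sec E (vecT E M)) (hφ : φ ∈ Sec E (fieldT M ρ)) {a : M} {z : E}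
    (hz : z ∈ (extChartAt 𝓘(ℝ, E) a).target) :
    locRep E (fieldT M ρ) (lieFld ρ X φ) a z =
      lieLoc ρ (locRep E (vecT E M) X a) (locRep E (fieldT M ρ) φ a) z := by
  set y := (extChartAt 𝓘(ℝ, E) a).symm z with hy
  have hya : y ∈ (extChartAt 𝓘(ℝ, E) a).source := (extChartAt 𝓘(ℝ, E) a).map_target hz
  have hyt := mem_extChartAt_target (I := 𝓘(ℝ, E)) y
  have hsy : (extChartAt 𝓘(ℝ, E) y).symm (extChartAt 𝓘(ℝ, E) y y) = y := extChartAt_to_inv y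
  have hb : (extChartAt 𝓘(ℝ, E) y).symm (extChartAt 𝓘(ℝ, E) y y) ∈
      (extChartAt 𝓘(ℝ, E) a).source := by rwa [hsy]
  have hτ : transMap E y a (extChartAt 𝓘(ℝ, E) y y) = z := by
    rw [transMap, Function.comp_apply, hsy, hy, (extChartAt 𝓘(ℝ, E) a).right_inv hz]
  have hd : ∀ {s : M → F}, s ∈ Sec E (fieldT M ρ) → ∀ {b : M} {w : E},
      w ∈ (extChartAt 𝓘(ℝ, E) b).target → DifferentiableAt ℝ (locRep E (fieldT M ρ) s b) w :=
    fun hs _ _ hw => (mem_Sec_iff.1 hs _ _ hw).differentiableAt (by simp)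
  have hd' : ∀ {b : M} {w : E},
      w ∈ (extChartAt 𝓘(ℝ, E) b).target → DifferentiableAt ℝ (locRep E (vecT E M) X b) w :=
    fun hw => (mem_Sec_iff.1 hX _ _ hw).differentiableAt (by simp)
  have := lieLoc_naturality ρ (τ := transMap E y a) (z := extChartAt 𝓘(ℝ, E) y y)
    (X := locRep E (vecT E M) X y) (X' := locRep E (vecT E M) X a)
    (φ := locRep E (fieldT M ρ) φ y) (φ' := locRep E (fieldT M ρ) φ a)
    (contDiffAt_transMap hyt hb) (isUnit_fderiv_transMap hyt hb) (hd' hyt)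
    (hd' (by rwa [hτ])) (hd hφ hyt) (hd hφ (by rwa [hτ]))
    ((eventually_overlap hyt hb).mono fun w hw => locRep_vecT_transMap X hw.1 hw.2)
    ((eventually_overlap hyt hb).mono fun w hw => locRep_fieldT_transMap ρ φ hw.1 hw.2)
  rw [hτ, fderiv_transMap hyt, hsy] at this
  rw [this, locRep, lieFld_eq_lieLoc]
  rfl

theorem SmoothFamAt.lieDeriv (ρ : TensorType E F) {X : P → M → E} {φ : P → M → F} {p : P}
    (hX : ∀ p, SmoothFamAt E (vecT E M) X p) (hφ : ∀ p, SmoothFamAt E (fieldT M ρ) φ p) :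
    SmoothFamAt E (fieldT M ρ) (fun p => lieFld ρ (X p) (φ p)) p := by
  intro a z hz
  have h1 := hX p a z hz
  have h2 := hφ p a z hz
  have h3 : ContDiffAt ℝ ∞ (fun q : P × E => fderiv ℝ (locRep E (vecT E M) (X q.1) a) q.2) (p, z) :=
    ContDiffAt.fderiv (f := fun q : P × E => locRep E (vecT E M) (X q.1) a) (g := Prod.snd)
      (n := ∞) (ContDiffAt.comp ((p, z), z) (f := fun r : (P × E) × E => (r.1.1, r.2)) h1
        (by fun_prop)) contDiffAt_snd (by simp)
  have h4 : ContDiffAt ℝ ∞ (fun q : P × E => fderiv ℝ (locRep E (fieldT M ρ) (φ q.1) a) q.2)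
      (p, z) :=
    ContDiffAt.fderiv (f := fun q : P × E => locRep E (fieldT M ρ) (φ q.1) a) (g := Prod.snd)
      (n := ∞) (ContDiffAt.comp ((p, z), z) (f := fun r : (P × E) × E => (r.1.1, r.2)) h2
        (by fun_prop)) contDiffAt_snd (by simp)
  have h5 : ContDiffAt ℝ ∞ (fun q : P × E =>
      lieLoc ρ (locRep E (vecT E M) (X q.1) a) (locRep E (fieldT M ρ) (φ q.1) a) q.2) (p, z) :=
    (h4.clm_apply h1).sub ((ρ.lie.contDiff.contDiffAt.comp (p, z) h3).clm_apply h2)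
  refine h5.congr_of_eventuallyEq ?_
  have : ∀ᶠ q : P × E in 𝓝 (p, z), q.2 ∈ (extChartAt 𝓘(ℝ, E) a).target :=
    continuous_snd.continuousAt.eventually ((isOpen_extChartAt_target a).mem_nhds hz)
  filter_upwards [this] with q hq
  exact locRep_lieFld ρ (hX q.1).mem_Sec (hφ q.1).mem_Sec hq

theorem locRep_eventuallyEq {T : Transition M F} {s t : M → F} {a x : M}
    (hx : x ∈ (extChartAt 𝓘(ℝ, E) a).source) (h : s =ᶠ[𝓝 x] t) :
    locRep E T s a =ᶠ[𝓝 (extChartAt 𝓘(ℝ, E) a x)] locRep E T t a := by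
  have := (continuousAt_extChartAt_symm' (I := 𝓘(ℝ, E)) hx)
  rw [ContinuousAt, (extChartAt 𝓘(ℝ, E) a).left_inv hx] at this
  filter_upwards [this.eventually h] with w hw
  rw [locRep, locRep, hw]

theorem lieFld_congr (ρ : TensorType E F) {X X' : M → E} {φ φ' : M → F} {x : M}
    (hX : X =ᶠ[𝓝 x] X') (hφ : φ =ᶠ[𝓝 x] φ') : lieFld ρ X φ x = lieFld ρ X' φ' x := by
  have h1 := locRep_eventuallyEq (E := E) (T := vecT E M) (mem_extChartAt_source x) hX
  have h2 := locRep_eventuallyEq (E := E) (T := fieldT M ρ) (mem_extChartAt_source x) hφ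
  rw [lieFld, lieFld, h1.fderiv_eq, h2.fderiv_eq, hX.self_of_nhds, hφ.self_of_nhds]

theorem lieFld_zero_left (ρ : TensorType E F) (φ : M → F) (x : M) : lieFld ρ 0 φ x = 0 := by
  have : locRep E (vecT E M) 0 x = fun _ => 0 := by funext z; simp [locRep]
  simp [lieFld, this]

/-- The Jacobian of `X` enters, so `X` has to vanish near the point and not just at it. This is why
support families are stable under closure. -/
theorem lieFld_eq_zero_of_support (ρ : TensorType E F) {X : M → E} {K : Set M}
    (hK : ∀ x ∉ K, X x = 0) (φ : M → F) {x : M} (hx : x ∉ closure K) : lieFld ρ X φ x = 0 := by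
  rw [lieFld_congr ρ (X' := 0) (φ' := φ) _ EventuallyEq.rfl, lieFld_zero_left]
  filter_upwards [isClosed_closure.isOpen_compl.mem_nhds hx] with y hy
  exact hK y fun h => hy (subset_closure h)

/-- The Lie derivative of a smooth family of fields along a smooth family of vector fields. -/
theorem Plot.lieDeriv (ρ : TensorType E F) {X : P → M → E} {φ : P → M → F}
    (hX : Plot E 𝒦 (vecT E M) X) (hXK : ∀ p, X p ∈ SecK E 𝒦 (vecT E M))
    (hφ : Plot E (.univ M) (fieldT M ρ) φ) :
    Plot E 𝒦 (fieldT M ρ) (fun p => lieFld ρ (X p) (φ p)) := by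
  refine .of_support (fun p => .lieDeriv ρ hX.smooth hφ.smooth) fun p => ?_
  obtain ⟨K, hK, h⟩ := hX.exists_support hXK p
  refine ⟨closure K, 𝒦.closure_mem K hK, ?_⟩
  filter_upwards [h] with q hq x hx
  exact lieFld_eq_zero_of_support ρ hq (φ q) hx

theorem lieFld_mem (ρ : TensorType E F) {X : M → E} {φ : M → F}
    (hX : X ∈ SecK E 𝒦 (vecT E M)) (hφ : φ ∈ Sec E (fieldT M ρ)) :
    lieFld ρ X φ ∈ SecK E 𝒦 (fieldT M ρ) := by
  obtain ⟨hX1, K, hK, h⟩ := hX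
  refine ⟨?_, closure K, 𝒦.closure_mem K hK, fun x hx => lieFld_eq_zero_of_support ρ h φ hx⟩
  exact SmoothFamAt.mem_Sec (p := (0 : ℝ)) (SmoothFamAt.lieDeriv ρ (fun p => .const hX1 p)
    (fun p => .const hφ p))

theorem lieLoc_add_left {ρ : TensorType E F} {X X' : E → E} (φ : E → F) {z : E} (r : ℝ)
    (hX : DifferentiableAt ℝ X z) (hX' : DifferentiableAt ℝ X' z) :
    lieLoc ρ (fun z => r • X z + X' z) φ z = r • lieLoc ρ X φ z + lieLoc ρ X' φ z := by
  have h : HasFDerivAt (fun z => r • X z + X' z) (r • fderiv ℝ X z + fderiv ℝ X' z) z :=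
    (hX.hasFDerivAt.const_smul r).add hX'.hasFDerivAt
  simp only [lieLoc, h.fderiv, map_add, map_smul, add_apply, smul_sub, smul_apply]
  abel

theorem lieLoc_add_right {ρ : TensorType E F} (X : E → E) {φ φ' : E → F} {z : E} (r : ℝ)
    (hφ : DifferentiableAt ℝ φ z) (hφ' : DifferentiableAt ℝ φ' z) :
    lieLoc ρ X (fun z => r • φ z + φ' z) z = r • lieLoc ρ X φ z + lieLoc ρ X φ' z := by
  have h : HasFDerivAt (fun z => r • φ z + φ' z) (r • fderiv ℝ φ z + fderiv ℝ φ' z) z :=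
    (hφ.hasFDerivAt.const_smul r).add hφ'.hasFDerivAt
  simp only [lieLoc, h.fderiv, map_add, map_smul, add_apply, smul_sub, smul_apply]
  abel

theorem lieFld_add_left (ρ : TensorType E F) {X X' : M → E} (φ : M → F) (r : ℝ)
    (hX : X ∈ Sec E (vecT E M)) (hX' : X' ∈ Sec E (vecT E M)) :
    lieFld ρ (r • X + X') φ = r • lieFld ρ X φ + lieFld ρ X' φ := by
  funext x
  have h : ∀ {X}, X ∈ Sec E (vecT E M) → DifferentiableAt ℝ (locRep E (vecT E M) X x)
      (extChartAt 𝓘(ℝ, E) x x) := fun h =>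
    (mem_Sec_iff.1 h _ _ (mem_extChartAt_target x)).differentiableAt (by simp)
  simp only [Pi.add_apply, Pi.smul_apply, lieFld_eq_lieLoc, ← lieLoc_add_left _ r (h hX) (h hX')]
  congr 1
  funext z
  rw [locRep_add, locRep_smul]

theorem lieFld_add_right (ρ : TensorType E F) (X : M → E) {φ φ' : M → F} (r : ℝ)
    (hφ : φ ∈ Sec E (fieldT M ρ)) (hφ' : φ' ∈ Sec E (fieldT M ρ)) :
    lieFld ρ X (r • φ + φ') = r • lieFld ρ X φ + lieFld ρ X φ' := by
  funext x
  have h : ∀ {φ}, φ ∈ Sec E (fieldT M ρ) → DifferentiableAt ℝ (locRep E (fieldT M ρ) φ x)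
      (extChartAt 𝓘(ℝ, E) x x) := fun h =>
    (mem_Sec_iff.1 h _ _ (mem_extChartAt_target x)).differentiableAt (by simp)
  simp only [Pi.add_apply, Pi.smul_apply, lieFld_eq_lieLoc, ← lieLoc_add_right _ r (h hφ) (h hφ')]
  congr 1
  funext z
  rw [locRep_add, locRep_smul]

theorem locRep_lieFld_eventuallyEq (ρ : TensorType E F) {X : M → E} {φ : M → F}
    (hX : X ∈ Sec E (vecT E M)) (hφ : φ ∈ Sec E (fieldT M ρ)) (x : M) :
    locRep E (fieldT M ρ) (lieFld ρ X φ) x =ᶠ[𝓝 (extChartAt 𝓘(ℝ, E) x x)]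
      lieLoc ρ (locRep E (vecT E M) X x) (locRep E (fieldT M ρ) φ x) := by
  filter_upwards [(isOpen_extChartAt_target (I := 𝓘(ℝ, E)) x).mem_nhds
    (mem_extChartAt_target x)] with w hw using locRep_lieFld ρ hX hφ hw

/-- The Lie derivative is a representation of the Lie algebra of vector fields. -/
theorem lieFld_commutator (ρ : TensorType E F) {X Y : M → E} {φ : M → F}
    (hX : X ∈ Sec E (vecT E M)) (hY : Y ∈ Sec E (vecT E M)) (hφ : φ ∈ Sec E (fieldT M ρ)) :
    lieFld ρ X (lieFld ρ Y φ) - lieFld ρ Y (lieFld ρ X φ) =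
      lieFld ρ (lieFld (idType E) X Y) φ := by
  funext x
  have hx := mem_extChartAt_target (I := 𝓘(ℝ, E)) x
  have hcong : ∀ {X X' : E → E} {ψ ψ' : E → F} {z : E}, X =ᶠ[𝓝 z] X' → ψ =ᶠ[𝓝 z] ψ' →
      lieLoc ρ X ψ z = lieLoc ρ X' ψ' z := by
    intro X X' ψ ψ' z h h'
    rw [lieLoc, lieLoc, h.fderiv_eq, h'.fderiv_eq, h.self_of_nhds, h'.self_of_nhds]
  have h3 : locRep E (vecT E M) (lieFld (idType E) X Y) x =ᶠ[𝓝 (extChartAt 𝓘(ℝ, E) x x)] _ :=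
    locRep_lieFld_eventuallyEq (idType E) hX hY x
  simp only [Pi.sub_apply, lieFld_eq_lieLoc ρ]
  rw [hcong EventuallyEq.rfl (locRep_lieFld_eventuallyEq ρ hY hφ x),
    hcong EventuallyEq.rfl (locRep_lieFld_eventuallyEq ρ hX hφ x),
    hcong h3 EventuallyEq.rfl]
  exact lieLoc_commutator ρ (mem_Sec_iff.1 hX _ _ hx) (mem_Sec_iff.1 hY _ _ hx)
    (mem_Sec_iff.1 hφ _ _ hx)

end Charts

/-! ### Vector fields and differential forms in charts; Cartan calculus. -/

section Forms

variable {E : Type*} [NormedAddCommGroup E] [NormedSpace ℝ E] [FiniteDimensional ℝ E]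
  {M : Type*} [TopologicalSpace M] [ChartedSpace E M] [IsManifold 𝓘(ℝ, E) ∞ M]
  {P : Type*} [NormedAddCommGroup P] [NormedSpace ℝ P]
  {𝒦 : SupportFamily M} {k : ℕ}

theorem mfderiv_extChartAt_eq_tcc {a y : M} (hy : y ∈ (extChartAt 𝓘(ℝ, E) a).source) :
    (mfderiv 𝓘(ℝ, E) 𝓘(ℝ, E) (extChartAt 𝓘(ℝ, E) a) y : E →L[ℝ] E) =
      tangentCoordChange 𝓘(ℝ, E) y a y := by
  have hy' : y ∈ (chartAt E a).source := by rwa [extChartAt_source] at hy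
  rw [← mfderiv_chartAt_eq_tangentCoordChange hy']
  exact (hasMFDerivAt_extChartAt hy').mfderiv

/-- Pulling back by the inverse chart applies the inverse of its derivative, which is the derivative
of the chart, that is, the transition `vecT`. -/
theorem mpullbackWithin_extChartAt_symm (X : M → E) {a : M} {z : E}
    (hz : z ∈ (extChartAt 𝓘(ℝ, E) a).target) :
    (VectorField.mpullbackWithin 𝓘(ℝ, E) 𝓘(ℝ, E) (extChartAt 𝓘(ℝ, E) a).symm X
      (Set.range 𝓘(ℝ, E)) z : E) = locRep E (vecT E M) X a z := by
  have h : (mfderivWithin 𝓘(ℝ, E) 𝓘(ℝ, E) (extChartAt 𝓘(ℝ, E) a).symm (Set.range 𝓘(ℝ, E)) z :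
      E →L[ℝ] E).inverse = vecT E M a ((extChartAt 𝓘(ℝ, E) a).symm z) := by
    rw [vecT, ← mfderiv_extChartAt_eq_tcc ((extChartAt 𝓘(ℝ, E) a).map_target hz)]
    exact ContinuousLinearMap.inverse_eq
      (mfderivWithin_extChartAt_symm_comp_mfderiv_extChartAt hz)
      (mfderiv_extChartAt_comp_mfderivWithin_extChartAt_symm hz)
  exact DFunLike.congr_fun h (X ((extChartAt 𝓘(ℝ, E) a).symm z))

/-- Both sides are computed in the chart at `x`, whose derivative at `x` is the identity in the
preferred trivialization. Vector fields thereby become tensorial fields of type `idType`. -/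
theorem mlieBracket_eq_lieFld (X Y : M → E) (x : M) :
    (VectorField.mlieBracket 𝓘(ℝ, E) (M := M) X Y x : E) = lieFld (idType E) X Y x := by
  have hx := mem_extChartAt_source (I := 𝓘(ℝ, E)) x
  have hev : ∀ Z : M → E, (VectorField.mpullbackWithin 𝓘(ℝ, E) 𝓘(ℝ, E)
      (extChartAt 𝓘(ℝ, E) x).symm Z (Set.range 𝓘(ℝ, E)) : E → E)
        =ᶠ[𝓝 (extChartAt 𝓘(ℝ, E) x x)] locRep E (vecT E M) Z x := fun Z => by
    filter_upwards [(isOpen_extChartAt_target (I := 𝓘(ℝ, E)) x).mem_nhds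
      (mem_extChartAt_target x)] with w hw using mpullbackWithin_extChartAt_symm Z hw
  have h1 : (mfderiv 𝓘(ℝ, E) 𝓘(ℝ, E) (extChartAt 𝓘(ℝ, E) x) x : E →L[ℝ] E) =
      ContinuousLinearMap.id ℝ E := by
    rw [mfderiv_extChartAt_eq_tcc hx, tcc_self hx]; rfl
  have h2 : VectorField.lieBracketWithin ℝ
      (VectorField.mpullbackWithin 𝓘(ℝ, E) 𝓘(ℝ, E) (extChartAt 𝓘(ℝ, E) x).symm X
        (Set.range 𝓘(ℝ, E)) : E → E)
      (VectorField.mpullbackWithin 𝓘(ℝ, E) 𝓘(ℝ, E) (extChartAt 𝓘(ℝ, E) x).symm Y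
        (Set.range 𝓘(ℝ, E)) : E → E)
      ((extChartAt 𝓘(ℝ, E) x).symm ⁻¹' Set.univ ∩ Set.range 𝓘(ℝ, E)) (extChartAt 𝓘(ℝ, E) x x)
      = lieFld (idType E) X Y x := by
    have h3 : (extChartAt 𝓘(ℝ, E) x).symm ⁻¹' Set.univ ∩ Set.range 𝓘(ℝ, E) = Set.univ := by simp
    rw [h3, lieFld_eq_lieLoc, lieLoc, idType_lie]
    refine (congrFun VectorField.lieBracketWithin_univ _).trans ?_
    exact Filter.EventuallyEq.lieBracket_vectorField_eq (hev X) (hev Y)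
  have h4 := congrArg₂ (fun (A : E →L[ℝ] E) (v : E) => A.inverse v) h1 h2
  simp only [ContinuousLinearMap.inverse_id, ContinuousLinearMap.id_apply] at h4
  exact h4

theorem eventually_mem_target {a : M} {z : E} (hz : z ∈ (extChartAt 𝓘(ℝ, E) a).target) (p : P) :
    ∀ᶠ q : P × E in 𝓝 (p, z), q.2 ∈ (extChartAt 𝓘(ℝ, E) a).target :=
  continuous_snd.continuousAt.eventually ((isOpen_extChartAt_target a).mem_nhds hz)

/-- Naturality of d under pullback by the transition map to the chart in which `extD` is defined at
the given point. -/
theorem locRep_extD {η : RawForm E M k} (hη : η ∈ Sec E (formT E M k)) {a : M} {z : E}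
    (hz : z ∈ (extChartAt 𝓘(ℝ, E) a).target) :
    locRep E (formT E M (k + 1)) (extD η) a z = extDeriv (locRep E (formT E M k) η a) z := by
  set y := (extChartAt 𝓘(ℝ, E) a).symm z with hy
  have hyy := mem_extChartAt_source (I := 𝓘(ℝ, E)) y
  have h1 : locRep E (formT E M k) η a =ᶠ[𝓝 z] fun w =>
      (locRep E (formT E M k) η y (transMap E a y w)).compContinuousLinearMap
        (fderiv ℝ (transMap E a y) w) := by
    filter_upwards [eventually_overlap hz hyy] with w hw
    exact locRep_formT_transMap η hw.1 hw.2
  have hd := (mem_Sec_iff.1 hη _ _ (transMap_mem (a := a) (z := z) hyy)).differentiableAt (by simp)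
  rw [h1.extDeriv_eq, extDeriv_pullback hd (contDiffAt_transMap hz hyy) minSmoothness_two_le,
    fderiv_transMap hz]
  rfl

theorem contDiffAt_extDeriv_param {G : P × E → E [⋀^Fin k]→L[ℝ] ℝ} {p : P} {z : E}
    (hG : ContDiffAt ℝ ∞ G (p, z)) :
    ContDiffAt ℝ ∞ (fun q : P × E => extDeriv (fun w => G (q.1, w)) q.2) (p, z) := by
  have h3 : ContDiffAt ℝ ∞ (fun q : P × E => fderiv ℝ (fun w => G (q.1, w)) q.2) (p, z) :=
    ContDiffAt.fderiv (f := fun q : P × E => fun w => G (q.1, w)) (g := Prod.snd)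
      (n := ∞) (ContDiffAt.comp ((p, z), z) (f := fun r : (P × E) × E => (r.1.1, r.2)) hG
        (by fun_prop)) contDiffAt_snd (by simp)
  exact (ContinuousAlternatingMap.alternatizeUncurryFinCLM ℝ E ℝ (n := k)).contDiff.contDiffAt.comp
    (p, z) h3

theorem SmoothFamAt.extD_family {η : P → RawForm E M k} {p : P}
    (hη : ∀ p, SmoothFamAt E (formT E M k) η p) :
    SmoothFamAt E (formT E M (k + 1)) (fun p => extD (η p)) p := by
  intro a z hz
  refine (contDiffAt_extDeriv_param (hη p a z hz)).congr_of_eventuallyEq ?_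
  filter_upwards [eventually_mem_target hz p] with q hq
  exact locRep_extD (hη q.1).mem_Sec hq

theorem Plot.extD_family {η : P → RawForm E M k} (hη : Plot E (.univ M) (formT E M k) η) :
    Plot E (.univ M) (formT E M (k + 1)) (fun p => extD (η p)) :=
  plot_univ_iff.2 fun _ => .extD_family hη.smooth

theorem extD_mem {η : RawForm E M k} (hη : η ∈ Sec E (formT E M k)) :
    extD η ∈ Sec E (formT E M (k + 1)) :=
  SmoothFamAt.mem_Sec (p := (0 : ℝ)) (SmoothFamAt.extD_family fun p => .const hη p)

theorem extD_extD {η : RawForm E M k} (hη : η ∈ Sec E (formT E M k)) : extD (extD η) = 0 := by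
  funext x
  have h : locRep E (formT E M (k + 1)) (extD η) x =ᶠ[𝓝 (extChartAt 𝓘(ℝ, E) x x)]
      extDeriv (locRep E (formT E M k) η x) := by
    filter_upwards [(isOpen_extChartAt_target (I := 𝓘(ℝ, E)) x).mem_nhds
      (mem_extChartAt_target x)] with w hw using locRep_extD hη hw
  rw [extD, h.extDeriv_eq]
  exact extDeriv_extDeriv_apply (mem_Sec_iff.1 hη _ _ (mem_extChartAt_target x))
    minSmoothness_two_le

theorem extD_add {η ζ : RawForm E M k} (hη : η ∈ Sec E (formT E M k))
    (hζ : ζ ∈ Sec E (formT E M k)) : extD (η + ζ) = extD η + extD ζ := by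
  funext x
  have h : ∀ {η}, η ∈ Sec E (formT E M k) → DifferentiableAt ℝ (locRep E (formT E M k) η x)
      (extChartAt 𝓘(ℝ, E) x x) := fun h =>
    (mem_Sec_iff.1 h _ _ (mem_extChartAt_target x)).differentiableAt (by simp)
  simp only [extD, Pi.add_apply, ← extDeriv_add (h hη) (h hζ)]
  congr 1

theorem extD_smul (r : ℝ) (η : RawForm E M k) : extD (r • η) = r • extD η := by
  funext x
  simp only [extD, Pi.smul_apply, ← extDeriv_smul]
  congr 1

theorem form_neg_eq (η : RawForm E M k) : -η = (-1 : ℝ) • η := by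
  funext x; ext v; simp

theorem form_sub_eq (η ζ : RawForm E M k) : η - ζ = η + (-1 : ℝ) • ζ := by
  funext x; ext v; simp [sub_eq_add_neg]

theorem extD_neg (η : RawForm E M k) : extD (-η) = -extD η := by
  rw [form_neg_eq, extD_smul, form_neg_eq]

theorem extD_sub {η ζ : RawForm E M k} (hη : η ∈ Sec E (formT E M k))
    (hζ : ζ ∈ Sec E (formT E M k)) : extD (η - ζ) = extD η - extD ζ := by
  rw [form_sub_eq, extD_add hη (Submodule.smul_mem (Sec E (formT E M k)) (-1) hζ), extD_smul,
    form_sub_eq]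

/-- Forms of degree greater than the dimension vanish. -/
theorem form_eq_zero_of_finrank_lt (h : Module.finrank ℝ E < k) (η : RawForm E M k) : η = 0 := by
  funext x
  ext v
  refine (η x).toAlternatingMap.map_linearDependent v fun hv => ?_
  have := hv.fintype_card_le_finrank
  simp at this
  omega

/-- The transition of forms and that of vectors are mutually inverse, so the contraction does not
depend on the chart. -/
theorem locRep_iota (X : M → E) (η : RawForm E M (k + 1)) {a : M} {z : E}
    (hz : z ∈ (extChartAt 𝓘(ℝ, E) a).target) :
    locRep E (formT E M k) (iota X η) a z =
      (locRep E (formT E M (k + 1)) η a z).curryLeft (locRep E (vecT E M) X a z) := by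
  set y := (extChartAt 𝓘(ℝ, E) a).symm z with hy
  have h := tcc_mul_inv (mem_extChartAt_source (I := 𝓘(ℝ, E)) y)
    ((extChartAt 𝓘(ℝ, E) a).map_target hz)
  have h' := DFunLike.congr_fun h (X y)
  ext v
  simp only [locRep, formT, vecT, iota,
    ContinuousAlternatingMap.compContinuousLinearMapCLM_apply,
    ContinuousAlternatingMap.compContinuousLinearMap_apply,
    ContinuousAlternatingMap.curryLeft_apply_apply, ← hy]
  congr 1
  funext i
  refine Fin.cases ?_ (fun j => ?_) i
  · exact h'.symm
  · simp

theorem SmoothFamAt.iota_family {X : P → M → E} {η : P → RawForm E M (k + 1)} {p : P}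
    (hX : SmoothFamAt E (vecT E M) X p) (hη : SmoothFamAt E (formT E M (k + 1)) η p) :
    SmoothFamAt E (formT E M k) (fun p => iota (X p) (η p)) p := by
  intro a z hz
  have h1 := ((ContinuousAlternatingMap.curryLeftLI (𝕜 := ℝ) (E := E) (F := ℝ)
    (n := k)).contDiff.contDiffAt.comp (p, z) (hη a z hz)).clm_apply (hX a z hz)
  refine h1.congr_of_eventuallyEq ?_
  filter_upwards [eventually_mem_target hz p] with q hq
  exact locRep_iota (X q.1) (η q.1) hq

theorem Plot.iota_family {X : P → M → E} {η : P → RawForm E M (k + 1)}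
    (hX : Plot E (.univ M) (vecT E M) X) (hη : Plot E (.univ M) (formT E M (k + 1)) η) :
    Plot E (.univ M) (formT E M k) (fun p => iota (X p) (η p)) :=
  plot_univ_iff.2 fun p => .iota_family (hX.smooth p) (hη.smooth p)

theorem iota_mem {X : M → E} {η : RawForm E M (k + 1)} (hX : X ∈ Sec E (vecT E M))
    (hη : η ∈ Sec E (formT E M (k + 1))) : iota X η ∈ Sec E (formT E M k) :=
  SmoothFamAt.mem_Sec (p := (0 : ℝ)) (SmoothFamAt.iota_family (.const hX _) (.const hη _))

theorem iota_add_right (X : M → E) (η ζ : RawForm E M (k + 1)) :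
    iota X (η + ζ) = iota X η + iota X ζ := by
  funext x; simp [iota]

theorem iota_smul_right (X : M → E) (r : ℝ) (η : RawForm E M (k + 1)) :
    iota X (r • η) = r • iota X η := by
  funext x; simp [iota]

theorem iota_add_left (X Y : M → E) (η : RawForm E M (k + 1)) :
    iota (X + Y) η = iota X η + iota Y η := by
  funext x; simp [iota]

theorem iota_smul_left (r : ℝ) (X : M → E) (η : RawForm E M (k + 1)) :
    iota (r • X) η = r • iota X η := by
  funext x; simp [iota]

theorem iota_zero_right (X : M → E) : iota X (0 : RawForm E M (k + 1)) = 0 := by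
  funext x; simp [iota]

theorem Plot.lieForm_family {X : P → M → E} {η : P → RawForm E M (k + 1)}
    (hX : Plot E (.univ M) (vecT E M) X) (hη : Plot E (.univ M) (formT E M (k + 1)) η) :
    Plot E (.univ M) (formT E M (k + 1)) (fun p => lieForm (X p) (η p)) :=
  (hX.iota_family hη).extD_family.add (hX.iota_family hη.extD_family)

theorem lieForm_mem {X : M → E} {η : RawForm E M (k + 1)} (hX : X ∈ Sec E (vecT E M))
    (hη : η ∈ Sec E (formT E M (k + 1))) : lieForm X η ∈ Sec E (formT E M (k + 1)) :=
  (Sec E _).add_mem (extD_mem (iota_mem hX hη)) (iota_mem hX (extD_mem hη))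

theorem lieForm_add_right {X : M → E} {η ζ : RawForm E M (k + 1)} (hX : X ∈ Sec E (vecT E M))
    (hη : η ∈ Sec E (formT E M (k + 1))) (hζ : ζ ∈ Sec E (formT E M (k + 1))) :
    lieForm X (η + ζ) = lieForm X η + lieForm X ζ := by
  rw [lieForm, lieForm, lieForm, iota_add_right, extD_add hη hζ, iota_add_right,
    extD_add (iota_mem hX hη) (iota_mem hX hζ)]
  abel

theorem lieForm_smul_right (X : M → E) (r : ℝ) (η : RawForm E M (k + 1)) :
    lieForm X (r • η) = r • lieForm X η := by
  rw [lieForm, lieForm, iota_smul_right, extD_smul, extD_smul, iota_smul_right, smul_add]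

theorem lieForm_sub_right {X : M → E} {η ζ : RawForm E M (k + 1)} (hX : X ∈ Sec E (vecT E M))
    (hη : η ∈ Sec E (formT E M (k + 1))) (hζ : ζ ∈ Sec E (formT E M (k + 1))) :
    lieForm X (η - ζ) = lieForm X η - lieForm X ζ := by
  rw [form_sub_eq, lieForm_add_right hX hη (Submodule.smul_mem (Sec E (formT E M (k + 1))) (-1) hζ),
    lieForm_smul_right, form_sub_eq]

theorem lieForm_zero_right (X : M → E) : lieForm X (0 : RawForm E M (k + 1)) = 0 := by
  simpa using lieForm_smul_right X 0 (0 : RawForm E M (k + 1))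

theorem extD_lieForm {X : M → E} {η : RawForm E M (k + 1)} (hX : X ∈ Sec E (vecT E M))
    (hη : η ∈ Sec E (formT E M (k + 1))) : extD (lieForm X η) = lieForm X (extD η) := by
  rw [lieForm, lieForm, extD_extD hη, iota_zero_right, add_zero,
    extD_add (extD_mem (iota_mem hX hη)) (iota_mem hX (extD_mem hη)),
    extD_extD (iota_mem hX hη), zero_add]

end Forms

/-! ### Pullback to cubes, Stokes' theorem, integrals depending on parameters. -/

section Integration

variable {E : Type*} [NormedAddCommGroup E] [NormedSpace ℝ E] [FiniteDimensional ℝ E]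
  {M : Type*} [TopologicalSpace M] [ChartedSpace E M] [IsManifold 𝓘(ℝ, E) ∞ M]
  {P : Type*} [NormedAddCommGroup P] [NormedSpace ℝ P]
  {k j : ℕ}

/-- Induction on the degree: currying reduces evaluation to repeated application of a linear map to
one vector. -/
theorem contDiffAt_alternating_apply {V : Type*} [NormedAddCommGroup V] [NormedSpace ℝ V] {k : ℕ}
    {f : P → V [⋀^Fin k]→L[ℝ] ℝ} {v : P → Fin k → V} {p : P}
    (hf : ContDiffAt ℝ ∞ f p) (hv : ∀ i, ContDiffAt ℝ ∞ (fun p => v p i) p) :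
    ContDiffAt ℝ ∞ (fun p => f p (v p)) p := by
  induction k with
  | zero =>
    have h := ((ContinuousMultilinearMap.apply ℝ (fun _ : Fin 0 => V) ℝ 0).contDiff.contDiffAt.comp
      p ((ContinuousAlternatingMap.toContinuousMultilinearMapCLM ℝ).contDiff.contDiffAt.comp p hf))
    refine h.congr_of_eventuallyEq (Eventually.of_forall fun q => ?_)
    simp [Subsingleton.elim (v q) 0]
  | succ k ih =>
    have h1 := ((ContinuousAlternatingMap.curryLeftLI (𝕜 := ℝ) (E := V) (F := ℝ)
      (n := k)).contDiff.contDiffAt.comp p hf).clm_apply (hv 0)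
    have h2 := ih (v := fun p i => v p i.succ) h1 (fun i => hv i.succ)
    refine h2.congr_of_eventuallyEq (Eventually.of_forall fun q => ?_)
    simp only [Function.comp_apply, ContinuousAlternatingMap.curryLeftLI_apply,
      ContinuousAlternatingMap.curryLeft_apply_apply]
    congr 1
    exact (Fin.cons_self_tail (v q)).symm

/-- The pullback of a form by a cube. -/
def pullCube (σ : Cube E M k) (η : RawForm E M j) (u : Fin k → ℝ) :
    (Fin k → ℝ) [⋀^Fin j]→L[ℝ] ℝ :=
  (η (σ u)).compContinuousLinearMap
    (mfderiv 𝓘(ℝ, Fin k → ℝ) 𝓘(ℝ, E) σ u : (Fin k → ℝ) →L[ℝ] E)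

theorem cubeIntegral_eq (σ : Cube E M k) (η : RawForm E M k) :
    cubeIntegral σ η = ∫ u in Icc (0 : Fin k → ℝ) 1, pullCube σ η u fun i => Pi.single i 1 := rfl

variable (σ : Cube E M k)

/-- The representative of a cube in the preferred chart at `a`. -/
def cubeChart (a : M) (u : Fin k → ℝ) : E := extChartAt 𝓘(ℝ, E) a (σ u)

theorem mdifferentiableAt_cube (u : Fin k → ℝ) :
    MDifferentiableAt 𝓘(ℝ, Fin k → ℝ) 𝓘(ℝ, E) σ u :=
  σ.contMDiff.mdifferentiableAt (by simp)

theorem contDiffAt_cubeChart {a : M} {u : Fin k → ℝ}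
    (h : σ u ∈ (extChartAt 𝓘(ℝ, E) a).source) : ContDiffAt ℝ ∞ (cubeChart σ a) u := by
  rw [← contMDiffAt_iff_contDiffAt]
  rw [extChartAt_source] at h
  exact (contMDiffAt_extChartAt' h).comp u σ.contMDiff.contMDiffAt

theorem fderiv_cubeChart {a : M} {u : Fin k → ℝ} (h : σ u ∈ (extChartAt 𝓘(ℝ, E) a).source) :
    fderiv ℝ (cubeChart σ a) u = (tangentCoordChange 𝓘(ℝ, E) (σ u) a (σ u)).comp
      (mfderiv 𝓘(ℝ, Fin k → ℝ) 𝓘(ℝ, E) σ u : (Fin k → ℝ) →L[ℝ] E) := by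
  have h' : σ u ∈ (chartAt E a).source := by rwa [extChartAt_source] at h
  rw [← mfderiv_eq_fderiv, ← mfderiv_extChartAt_eq_tcc h]
  exact mfderiv_comp u (mdifferentiableAt_extChartAt h') (mdifferentiableAt_cube σ u)

/-- The transitions of the form and of the derivative of the cube cancel. In a fixed chart the
pullback is an ordinary one, whose regularity in the point is visible. -/
theorem pullCube_eq (η : RawForm E M j) {a : M} {u : Fin k → ℝ}
    (h : σ u ∈ (extChartAt 𝓘(ℝ, E) a).source) :
    pullCube σ η u = (locRep E (formT E M j) η a (cubeChart σ a u)).compContinuousLinearMap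
      (fderiv ℝ (cubeChart σ a) u) := by
  have h1 := tcc_mul_inv (mem_extChartAt_source (I := 𝓘(ℝ, E)) (σ u)) h
  rw [fderiv_cubeChart σ h, locRep, cubeChart, (extChartAt 𝓘(ℝ, E) a).left_inv h, formT,
    pullCube]
  refine ContinuousAlternatingMap.ext fun v => congrArg (η (σ u)) (funext fun i => ?_)
  exact (DFunLike.congr_fun h1
    ((mfderiv 𝓘(ℝ, Fin k → ℝ) 𝓘(ℝ, E) σ u : (Fin k → ℝ) →L[ℝ] E) (v i))).symm

theorem eventually_cube_mem (u : Fin k → ℝ) :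
    ∀ᶠ w in 𝓝 u, σ w ∈ (extChartAt 𝓘(ℝ, E) (σ u)).source :=
  σ.contMDiff.continuous.continuousAt.eventually (extChartAt_source_mem_nhds (σ u))

theorem pullCube_eventuallyEq (η : RawForm E M j) (u : Fin k → ℝ) :
    pullCube σ η =ᶠ[𝓝 u] fun w =>
      (locRep E (formT E M j) η (σ u) (cubeChart σ (σ u) w)).compContinuousLinearMap
        (fderiv ℝ (cubeChart σ (σ u)) w) := by
  filter_upwards [eventually_cube_mem σ u] with w hw using pullCube_eq σ η hw

theorem cubeChart_mem (u : Fin k → ℝ) :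
    cubeChart σ (σ u) u ∈ (extChartAt 𝓘(ℝ, E) (σ u)).target := mem_extChartAt_target (σ u)

theorem differentiableAt_pullCube {η : RawForm E M j} (hη : η ∈ Sec E (formT E M j))
    (u : Fin k → ℝ) : DifferentiableAt ℝ (pullCube σ η) u := by
  have hc := contDiffAt_cubeChart σ (mem_extChartAt_source (I := 𝓘(ℝ, E)) (σ u))
  have h1 := ((mem_Sec_iff.1 hη _ _ (cubeChart_mem σ u)).differentiableAt (by simp)).comp u
    (hc.differentiableAt (by simp))
  have h2 := (hc.fderiv_right (m := ∞) (by simp)).differentiableAt (by simp)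
  exact (h1.continuousAlternatingMapCompContinuousLinearMap h2).congr_of_eventuallyEq
    (pullCube_eventuallyEq σ η u)

theorem extDeriv_pullCube {η : RawForm E M j} (hη : η ∈ Sec E (formT E M j)) (u : Fin k → ℝ) :
    extDeriv (pullCube σ η) u = pullCube σ (extD η) u := by
  have hs := mem_extChartAt_source (I := 𝓘(ℝ, E)) (σ u)
  have hc := contDiffAt_cubeChart σ hs
  rw [(pullCube_eventuallyEq σ η u).extDeriv_eq,
    extDeriv_pullback ((mem_Sec_iff.1 hη _ _ (cubeChart_mem σ u)).differentiableAt (by simp)) hc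
      minSmoothness_two_le, ← locRep_extD hη (cubeChart_mem σ u), ← pullCube_eq σ (extD η) hs]

theorem contDiffAt_pullCube_apply {η : P → RawForm E M j} {p : P}
    (hη : SmoothFamAt E (formT E M j) η p) (u : Fin k → ℝ) (v : Fin j → Fin k → ℝ) :
    ContDiffAt ℝ ∞ (fun q : P × (Fin k → ℝ) => pullCube σ (η q.1) q.2 v) (p, u) := by
  have hs := mem_extChartAt_source (I := 𝓘(ℝ, E)) (σ u)
  have hc := contDiffAt_cubeChart σ hs
  have hc' : ContDiffAt ℝ ∞ (fun q : P × (Fin k → ℝ) => cubeChart σ (σ u) q.2) (p, u) :=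
    ContDiffAt.comp (p, u) (f := Prod.snd) hc contDiffAt_snd
  have h1 : ContDiffAt ℝ ∞ (fun q : P × (Fin k → ℝ) =>
      locRep E (formT E M j) (η q.1) (σ u) (cubeChart σ (σ u) q.2)) (p, u) :=
    ContDiffAt.comp (p, u) (f := fun q : P × (Fin k → ℝ) => (q.1, cubeChart σ (σ u) q.2))
      (hη _ _ (cubeChart_mem σ u)) (contDiffAt_fst.prodMk hc')
  have h2 : ∀ i, ContDiffAt ℝ ∞ (fun q : P × (Fin k → ℝ) =>
      fderiv ℝ (cubeChart σ (σ u)) q.2 (v i)) (p, u) := fun i =>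
    (ContDiffAt.comp (p, u) (f := Prod.snd) (hc.fderiv_right (m := ∞) (by simp))
      contDiffAt_snd).clm_apply contDiffAt_const
  have h3 := contDiffAt_alternating_apply
    (v := fun (q : P × (Fin k → ℝ)) i => fderiv ℝ (cubeChart σ (σ u)) q.2 (v i)) h1 h2
  refine h3.congr_of_eventuallyEq ?_
  filter_upwards [continuous_snd.continuousAt.eventually (eventually_cube_mem σ u)] with q hq
  rw [pullCube_eq σ _ hq]
  rfl

theorem continuous_pullCube_apply {η : RawForm E M j} (hη : η ∈ Sec E (formT E M j))
    (v : Fin j → Fin k → ℝ) : Continuous fun u => pullCube σ η u v :=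
  continuous_iff_continuousAt.2 fun u =>
    (contDiffAt_pullCube_apply σ (SmoothFamAt.const hη (0 : ℝ)) u v).continuousAt.comp
      (f := fun u => ((0 : ℝ), u)) (by fun_prop)

/-- The integral of a smooth family of forms over a cube is smooth. -/
theorem contDiff_cubeIntegral {η : P → RawForm E M k} (hη : Plot E (.univ M) (formT E M k) η) :
    ContDiff ℝ ∞ fun p => cubeIntegral σ (η p) := by
  rw [contDiff_iff_contDiffAt]
  intro p
  simp only [cubeIntegral_eq]
  exact contDiffAt_setIntegral
    (G := fun q : P × (Fin k → ℝ) => pullCube σ (η q.1) q.2 fun i => Pi.single i 1) isCompact_Icc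
    fun u _ => contDiffAt_pullCube_apply σ (hη.smooth p) u _

theorem cubeIntegral_add {η ζ : RawForm E M k} (hη : η ∈ Sec E (formT E M k))
    (hζ : ζ ∈ Sec E (formT E M k)) :
    cubeIntegral σ (η + ζ) = cubeIntegral σ η + cubeIntegral σ ζ := by
  simp only [cubeIntegral_eq]
  rw [← integral_add ((continuous_pullCube_apply σ hη _).integrableOn_Icc)
    ((continuous_pullCube_apply σ hζ _).integrableOn_Icc)]
  rfl

theorem cubeIntegral_smul (r : ℝ) (η : RawForm E M k) :
    cubeIntegral σ (r • η) = r * cubeIntegral σ η := by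
  simp only [cubeIntegral_eq]
  rw [← integral_const_mul]
  rfl

theorem fderiv_faceMap_single (i : Fin (k + 1)) (t : ℝ) (u : Fin k → ℝ) (l : Fin k) :
    fderiv ℝ (faceMap i t) u (Pi.single l 1) = Pi.single (i.succAbove l) 1 := by
  have hd : DifferentiableAt ℝ (faceMap i t) u :=
    (contDiff_faceMap i t).contDiffAt.differentiableAt (by simp)
  funext m
  have h1 := (hasFDerivAt_pi'.1 hd.hasFDerivAt m)
  refine Fin.succAboveCases i ?_ (fun m => ?_) m
  · have h2 := hasFDerivAt_pi'.1 hd.hasFDerivAt i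
    have h3 : HasFDerivAt (fun w => faceMap i t w i) (0 : (Fin k → ℝ) →L[ℝ] ℝ) u := by
      simpa [faceMap] using hasFDerivAt_const t u
    have h4 := DFunLike.congr_fun (h2.unique h3) (Pi.single l 1)
    simpa [Fin.succAbove_ne i l] using h4
  · have h2 := hasFDerivAt_pi'.1 hd.hasFDerivAt (i.succAbove m)
    have h3 : HasFDerivAt (fun w => faceMap i t w (i.succAbove m))
        (ContinuousLinearMap.proj m : (Fin k → ℝ) →L[ℝ] ℝ) u := by
      have h5 : (fun w => faceMap i t w (i.succAbove m)) = fun w => w m := by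
        funext w; simp [faceMap]
      rw [h5]
      exact (ContinuousLinearMap.proj m : (Fin k → ℝ) →L[ℝ] ℝ).hasFDerivAt
    have h4 := DFunLike.congr_fun (h2.unique h3) (Pi.single l 1)
    simp only [ContinuousLinearMap.comp_apply, ContinuousLinearMap.proj_apply] at h4
    rw [h4]
    simp [Pi.single_apply]

theorem cubeIntegral_cubeFace (σ : Cube E M (k + 1)) (η : RawForm E M k) (i : Fin (k + 1)) (t : ℝ) :
    cubeIntegral (cubeFace σ i t) η = ∫ u in Icc (0 : Fin k → ℝ) 1,
      pullCube σ η (i.insertNth t u) (Fin.removeNth (α := fun _ => Fin (k + 1) → ℝ) i fun l => Pi.single l 1) := by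
  rw [cubeIntegral_eq]
  refine integral_congr_ae (Eventually.of_forall fun u => ?_)
  refine congrArg (η (σ (faceMap i t u))) (funext fun l => ?_)
  have h1 : fderiv ℝ (faceMap i t) u (Pi.single l 1) = Pi.single (i.succAbove l) 1 :=
    fderiv_faceMap_single i t u l
  rw [← mfderiv_eq_fderiv] at h1
  have h2 : mfderiv 𝓘(ℝ, Fin k → ℝ) 𝓘(ℝ, E) (cubeFace σ i t) u =
      (mfderiv 𝓘(ℝ, Fin (k + 1) → ℝ) 𝓘(ℝ, E) σ (faceMap i t u)).comp
        (mfderiv 𝓘(ℝ, Fin k → ℝ) 𝓘(ℝ, Fin (k + 1) → ℝ) (faceMap i t) u) :=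
    mfderiv_comp u (mdifferentiableAt_cube σ _)
      ((contDiff_faceMap i t).contMDiff.mdifferentiableAt (by simp))
  exact (DFunLike.congr_fun h2 _).trans (congrArg
    (mfderiv 𝓘(ℝ, Fin (k + 1) → ℝ) 𝓘(ℝ, E) σ (faceMap i t u)) h1)

/-- Stokes' theorem for a cube. -/
theorem cubeIntegral_extD (σ : Cube E M (k + 1)) {η : RawForm E M k}
    (hη : η ∈ Sec E (formT E M k)) :
    cubeIntegral σ (extD η) = ∑ i : Fin (k + 1), (-1 : ℝ) ^ (i : ℕ) *
      (cubeIntegral (cubeFace σ i 1) η - cubeIntegral (cubeFace σ i 0) η) := by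
  let e : Fin (k + 1) → Fin (k + 1) → ℝ := fun i => Pi.single i 1
  -- The i-th component is, up to the sign (-1)^i, the form evaluated on the basis with the i-th
  -- vector omitted. The divergence of this vector field is the coefficient of dη, and its fluxes
  -- are the integrals over the faces.
  let f : Fin (k + 1) → (Fin (k + 1) → ℝ) → ℝ := fun i u =>
    (-1 : ℝ) ^ (i : ℕ) * pullCube σ η u (Fin.removeNth (α := fun _ => Fin (k + 1) → ℝ) i e)
  let f' : Fin (k + 1) → (Fin (k + 1) → ℝ) → (Fin (k + 1) → ℝ) →L[ℝ] ℝ := fun i u =>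
    (-1 : ℝ) ^ (i : ℕ) • fderiv ℝ (fun w => pullCube σ η w (Fin.removeNth (α := fun _ => Fin (k + 1) → ℝ) i e)) u
  have hd : ∀ (u : Fin (k + 1) → ℝ) (i : Fin (k + 1)), DifferentiableAt ℝ (fun w => pullCube σ η w (Fin.removeNth (α := fun _ => Fin (k + 1) → ℝ) i e)) u := fun u i => by
    have := (contDiffAt_pullCube_apply σ (SmoothFamAt.const hη (0 : ℝ)) u (Fin.removeNth (α := fun _ => Fin (k + 1) → ℝ) i e))
    exact (this.differentiableAt (by simp)).comp u (f := fun u => ((0 : ℝ), u)) (by fun_prop)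
  have hdiv : ∀ u, ∑ i, f' i u (e i) = pullCube σ (extD η) u e := by
    intro u
    rw [← extDeriv_pullCube σ hη, extDeriv_apply (differentiableAt_pullCube σ hη u)]
    simp [f']
  have key := integral_divergence_of_hasFDerivAt_off_countable' (E := ℝ) (0 : Fin (k + 1) → ℝ) 1
    zero_le_one f f' ∅ countable_empty
    (fun i => (continuous_const.mul (continuous_pullCube_apply σ hη _)).continuousOn)
    (fun u _ i => (hd u i).hasFDerivAt.const_mul _)
    (by
      have : (fun u => ∑ i, f' i u (Pi.single i 1)) = fun u => pullCube σ (extD η) u e :=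
        funext hdiv
      rw [this]
      exact (continuous_pullCube_apply σ (extD_mem hη) e).integrableOn_Icc)
  rw [cubeIntegral_eq]
  have h1 : (fun u => pullCube σ (extD η) u fun i => Pi.single i 1) =
      fun u => ∑ i, f' i u (Pi.single i 1) := (funext hdiv).symm
  rw [h1, key]
  refine Finset.sum_congr rfl fun i _ => ?_
  rw [cubeIntegral_cubeFace, cubeIntegral_cubeFace, mul_sub, ← integral_const_mul,
    ← integral_const_mul]
  rfl

theorem chainIntegral_add (c : Chain E M k) {η ζ : RawForm E M k} (hη : η ∈ Sec E (formT E M k))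
    (hζ : ζ ∈ Sec E (formT E M k)) :
    chainIntegral c (η + ζ) = chainIntegral c η + chainIntegral c ζ := by
  simp only [chainIntegral, cubeIntegral_add _ hη hζ, mul_add]
  exact Finsupp.sum_add

theorem chainIntegral_smul (c : Chain E M k) (r : ℝ) (η : RawForm E M k) :
    chainIntegral c (r • η) = r * chainIntegral c η := by
  simp only [chainIntegral, cubeIntegral_smul, Finsupp.sum, Finset.mul_sum]
  exact Finset.sum_congr rfl fun _ _ => by ring

theorem chainIntegral_neg (c : Chain E M k) (η : RawForm E M k) :
    chainIntegral c (-η) = -chainIntegral c η := by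
  rw [form_neg_eq, chainIntegral_smul, neg_one_mul]

theorem chainIntegral_zero (c : Chain E M k) : chainIntegral c (0 : RawForm E M k) = 0 := by
  simpa using chainIntegral_smul c 0 (0 : RawForm E M k)

theorem chainIntegral_sub (c : Chain E M k) {η ζ : RawForm E M k} (hη : η ∈ Sec E (formT E M k))
    (hζ : ζ ∈ Sec E (formT E M k)) :
    chainIntegral c (η - ζ) = chainIntegral c η - chainIntegral c ζ := by
  rw [form_sub_eq, chainIntegral_add c hη (Submodule.smul_mem (Sec E (formT E M k)) (-1) hζ),
    chainIntegral_smul]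
  ring

theorem contDiff_chainIntegral (c : Chain E M k) {η : P → RawForm E M k}
    (hη : Plot E (.univ M) (formT E M k) η) : ContDiff ℝ ∞ fun p => chainIntegral c (η p) := by
  simp only [chainIntegral, Finsupp.sum]
  exact ContDiff.sum fun σ _ => contDiff_const.mul (contDiff_cubeIntegral σ hη)

/-- Additivity in the chain, packaged as a homomorphism so that it can be pushed through the sums
defining the boundary. -/
theorem chainIntegral_eq_linear (η : RawForm E M k) (c : Chain E M k) :
    chainIntegral c η = Finsupp.liftAddHom
      (fun σ => (AddMonoidHom.mulRight (cubeIntegral σ η)).comp (Int.castAddHom ℝ)) c := rfl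

/-- Stokes' theorem. -/
theorem chainIntegral_chainBdry (c : Chain E M (k + 1)) {η : RawForm E M k}
    (hη : η ∈ Sec E (formT E M k)) :
    chainIntegral (chainBdry c) η = chainIntegral c (extD η) := by
  rw [chainIntegral_eq_linear, chainBdry, map_finsuppSum, chainIntegral, Finsupp.sum, Finsupp.sum]
  refine Finset.sum_congr rfl fun σ _ => ?_
  rw [cubeIntegral_extD σ hη, map_zsmul, map_sum, zsmul_eq_mul]
  congr 1
  refine Finset.sum_congr rfl fun i _ => ?_
  rw [map_zsmul, map_sub, zsmul_eq_mul]
  simp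

end Integration

/-! ### Differential calculus on field space through smooth families. -/

section FieldCalculus

variable {E : Type*} [NormedAddCommGroup E] [NormedSpace ℝ E] [FiniteDimensional ℝ E]
  {M : Type*} [TopologicalSpace M] [ChartedSpace E M] [IsManifold 𝓘(ℝ, E) ∞ M]
  {F : Type*} [NormedAddCommGroup F] [NormedSpace ℝ F] [FiniteDimensional ℝ F]
  {F' : Type*} [NormedAddCommGroup F'] [NormedSpace ℝ F']
  {W : Type*} [NormedAddCommGroup W] [NormedSpace ℝ W]
  {W' : Type*} [NormedAddCommGroup W'] [NormedSpace ℝ W']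
  {𝒦 𝒦' : SupportFamily M} {ρ : TensorType E F} {Φ : Set (Fld M ρ)}
  {T₁ : Transition M F'} {T : Transition M W} {T' : Transition M W'}

section Param

variable {P : Type*} [NormedAddCommGroup P] [NormedSpace ℝ P]

variable (𝒦) in
/-- A smooth family of elements of a set of fields. -/
abbrev ConfPlot (c : P → Φ) : Prop := Plot E 𝒦 (fieldT M ρ) fun p => (c p).1.1

theorem isOpen_preimage_of_plot [FiniteDimensional ℝ P] (hΦ : IsOpenFld 𝒦 Φ) {c : P → Fld M ρ}
    (hc : Plot E 𝒦 (fieldT M ρ) fun p => (c p).1) : IsOpen (c ⁻¹' Φ) := by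
  let e : (Fin (Module.finrank ℝ P) → ℝ) ≃L[ℝ] P := ContinuousLinearEquiv.ofFinrankEq (by simp)
  have h := hΦ _ (fun p => c (e p)) (isPlot_iff.2 (hc.comp e.contDiff))
  have h2 := h.preimage e.symm.continuous
  simpa [Set.preimage_preimage, Function.comp_def, preimage] using h2

/-- A smooth family of fields through a point of an open set agrees locally with a smooth family
that stays in the open set. -/
theorem exists_confPlot [FiniteDimensional ℝ P] (hΦ : IsOpenFld 𝒦 Φ) {c : P → Fld M ρ}
    (hc : Plot E 𝒦 (fieldT M ρ) fun p => (c p).1) {p₀ : P} (h0 : c p₀ ∈ Φ) :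
    ∃ c' : P → Φ, ConfPlot 𝒦 c' ∧ ∀ᶠ p in 𝓝 p₀, (c' p).1 = c p := by
  obtain ⟨r, hr, hrU, hrid⟩ := exists_smooth_retraction
    ((isOpen_preimage_of_plot hΦ hc).mem_nhds h0)
  refine ⟨fun p => ⟨c (r p), hrU p⟩, hc.comp hr, ?_⟩
  filter_upwards [hrid] with p hp
  simp [hp]

/-- The base fields may have any support, but `u` has locally a common admissible one; hence t u
varies only inside an admissible set. -/
theorem plot_shift {c : P → Fld M ρ} {u : P → Var 𝒦 ρ}
    (hc : Plot E 𝒦 (fieldT M ρ) fun p => (c p).1) (hu : Plot E 𝒦 (fieldT M ρ) fun p => (u p).1) :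
    Plot E 𝒦 (fieldT M ρ) fun q : P × ℝ => (shift (c q.1) (u q.1) q.2).1 :=
  (hc.comp contDiff_fst).add
    ((hu.comp contDiff_fst).smul contDiff_snd fun q => (u q.1).2)

theorem shift_zero (φ : Fld M ρ) (v : Var 𝒦 ρ) : shift φ v 0 = φ := by simp [shift]

/-- The basic device for derivatives on field space: near t = 0 the shifted family is realized
inside `Φ`, so a derivative along `u p` at `c p` is a partial derivative in t, jointly smooth with
the parameter p. -/
theorem exists_confPlot_shift [FiniteDimensional ℝ P] (hΦ : IsOpenFld 𝒦 Φ) {c : P → Φ}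
    {u : P → Var 𝒦 ρ} (hc : ConfPlot 𝒦 c) (hu : Plot E 𝒦 (fieldT M ρ) fun p => (u p).1) (p₀ : P) :
    ∃ c' : P × ℝ → Φ, ConfPlot 𝒦 c' ∧
      ∀ᶠ q in 𝓝 (p₀, 0), (c' q).1 = shift (c q.1).1 (u q.1) q.2 :=
  exists_confPlot hΦ (plot_shift (c := fun p => (c p).1) hc hu)
    (by simp only [shift_zero]; exact (c p₀).2)

theorem exists_curve (hΦ : IsOpenFld 𝒦 Φ) (φ : Φ) (v : Var 𝒦 ρ) :
    ∃ c : ℝ → Φ, ConfPlot 𝒦 c ∧ (∀ᶠ t in 𝓝 0, (c t).1 = shift φ.1 v t) ∧ c 0 = φ := by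
  obtain ⟨c, hc, h⟩ := exists_confPlot_shift (P := ℝ) hΦ (c := fun _ => φ) (u := fun _ => v)
    (.const φ.1.2) (.const v.2.1) 0
  have h' : ∀ᶠ t in 𝓝 (0 : ℝ), (c (0, t)).1 = shift φ.1 v t :=
    (Continuous.continuousAt (f := fun t : ℝ => ((0 : ℝ), t)) (by fun_prop)).eventually h
  refine ⟨fun t => c (0, t), Plot.comp (r := fun t : ℝ => ((0 : ℝ), t)) hc (by fun_prop), h',
    Subtype.ext ?_⟩
  rw [h'.self_of_nhds, shift_zero]

theorem extendZero_coe (f : Φ → W) (φ : Φ) : extendZero f φ.1 = f φ := by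
  simp [extendZero, φ.2]

theorem ddir_eq_deriv {f : Φ → W} {φ : Φ} {v : Var 𝒦 ρ} {c : ℝ → Φ}
    (hc : ∀ᶠ t in 𝓝 0, (c t).1 = shift φ.1 v t) : ddir f φ v = deriv (fun t => f (c t)) 0 := by
  refine EventuallyEq.deriv_eq ?_
  filter_upwards [hc] with t ht
  rw [← ht, extendZero_coe]

theorem ddirSec_eq_deriv {f : Φ → M → W} {φ : Φ} {v : Var 𝒦 ρ} {c : ℝ → Φ}
    (hc : ∀ᶠ t in 𝓝 0, (c t).1 = shift φ.1 v t) :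
    ddirSec f φ v = fun x => deriv (fun t => f (c t) x) 0 :=
  funext fun _ => ddir_eq_deriv hc

/-- The derivatives of the functions `f p` at `c p` along `u p` as a partial derivative. -/
theorem eventually_ddir_eq {c : P → Φ} {u : P → Var 𝒦 ρ} {p₀ : P}
    {c' : P × ℝ → Φ} (hc' : ∀ᶠ q in 𝓝 (p₀, 0), (c' q).1 = shift (c q.1).1 (u q.1) q.2) :
    ∀ᶠ p in 𝓝 p₀, ∀ f : P → Φ → W, (DifferentiableAt ℝ (fun q : P × ℝ => f q.1 (c' q)) (p, 0) →
      ddir (f p) (c p) (u p) = fderiv ℝ (fun q : P × ℝ => f q.1 (c' q)) (p, 0) (0, 1)) := by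
  filter_upwards [hc'.curry_nhds] with p hp f hf
  rw [ddir_eq_deriv (c := fun t => c' (p, t)) hp]
  have := hf.hasFDerivAt.comp_hasDerivAt (0 : ℝ) (f := fun t : ℝ => (p, t))
    ((hasDerivAt_const (0 : ℝ) p).prodMk (hasDerivAt_id (0 : ℝ)))
  exact this.deriv

end Param

variable (𝒦 𝒦' T) in
/-- A map from a set of fields to sections of a bundle that takes smooth families to
smooth families. -/
def IsSmoothMap (R : Φ → M → W) : Prop :=
  ∀ (P : Type) [NormedAddCommGroup P] [NormedSpace ℝ P] [FiniteDimensional ℝ P] (c : P → Φ),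
    ConfPlot 𝒦 c → Plot E 𝒦' T fun p => R (c p)

variable (𝒦 T₁ T) in
/-- A smooth map from a set of fields to sections of a bundle that depends linearly on a section
with admissible support. -/
structure IsSmoothLin (R : Φ → SecK E 𝒦 T₁ → M → W) : Prop where
  lin : ∀ ψ (r : ℝ) v w, R ψ (r • v + w) = r • R ψ v + R ψ w
  smooth : ∀ (P : Type) [NormedAddCommGroup P] [NormedSpace ℝ P] [FiniteDimensional ℝ P]
    (c : P → Φ) (w : P → SecK E 𝒦 T₁), ConfPlot 𝒦 c → Plot E 𝒦 T₁ (fun p => (w p).1) →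
    Plot E (.univ M) T fun p => R (c p) (w p)

theorem IsSmoothMap.mem {R : Φ → M → W} (h : IsSmoothMap 𝒦 𝒦' T R) (φ : Φ) : R φ ∈ Sec E T :=
  ((h ℝ (fun _ => φ) (.const φ.1.2)).smooth 0).mem_Sec

theorem IsSmoothMap.add {R S : Φ → M → W} (h : IsSmoothMap 𝒦 𝒦' T R) (h' : IsSmoothMap 𝒦 𝒦' T S) :
    IsSmoothMap 𝒦 𝒦' T (fun φ => R φ + S φ) := fun P _ _ _ c hc => (h P c hc).add (h' P c hc)

theorem isSmoothMap_const {s : M → W} (hs : s ∈ Sec E T) :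
    IsSmoothMap 𝒦 𝒦' T (fun _ : Φ => s) := fun _ _ _ _ _ _ => .const hs

theorem IsSmoothLin.apply {R : Φ → SecK E 𝒦 T₁ → M → W} (h : IsSmoothLin 𝒦 T₁ T R)
    {w : Φ → SecK E 𝒦 T₁} (hw : IsSmoothMap 𝒦 𝒦 T₁ fun ψ => (w ψ).1) :
    IsSmoothMap 𝒦 (.univ M) T fun ψ => R ψ (w ψ) :=
  fun P _ _ _ c hc => h.smooth P c _ hc (hw P c hc)

theorem IsSmoothLin.apply_const {R : Φ → SecK E 𝒦 T₁ → M → W} (h : IsSmoothLin 𝒦 T₁ T R)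
    (w : SecK E 𝒦 T₁) : IsSmoothMap 𝒦 (.univ M) T fun ψ => R ψ w :=
  h.apply (isSmoothMap_const w.2.1)

theorem IsSmoothLin.mem {R : Φ → SecK E 𝒦 T₁ → M → W} (h : IsSmoothLin 𝒦 T₁ T R)
    (φ : Φ) (w : SecK E 𝒦 T₁) : R φ w ∈ Sec E T := (h.apply_const w).mem φ

theorem IsSmoothLin.map_add {R : Φ → SecK E 𝒦 T₁ → M → W} (h : IsSmoothLin 𝒦 T₁ T R)
    (φ : Φ) (v w : SecK E 𝒦 T₁) : R φ (v + w) = R φ v + R φ w := by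
  simpa using h.lin φ 1 v w

theorem IsSmoothLin.map_zero {R : Φ → SecK E 𝒦 T₁ → M → W} (h : IsSmoothLin 𝒦 T₁ T R)
    (φ : Φ) : R φ 0 = 0 := by
  simpa using h.map_add φ 0 0

theorem IsSmoothLin.map_neg {R : Φ → SecK E 𝒦 T₁ → M → W} (h : IsSmoothLin 𝒦 T₁ T R)
    (φ : Φ) (v : SecK E 𝒦 T₁) : R φ (-v) = -R φ v := by
  have h1 := h.map_add φ v (-v)
  rw [add_neg_cancel, h.map_zero] at h1
  exact (neg_eq_of_add_eq_zero_right h1.symm).symm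

theorem IsSmoothLin.map_sub {R : Φ → SecK E 𝒦 T₁ → M → W} (h : IsSmoothLin 𝒦 T₁ T R)
    (φ : Φ) (v w : SecK E 𝒦 T₁) : R φ (v - w) = R φ v - R φ w := by
  rw [sub_eq_add_neg, h.map_add, h.map_neg, sub_eq_add_neg]

section Deriv

variable [NormalizedTransition T] [NormalizedTransition T'] [NormalizedTransition T₁]

/-- Locally in the parameter, the derivative is the t-derivative of one smooth family over `P × ℝ`.
Letting `R` depend on the parameter allows an argument of the map, such as a variation, to be frozen
while the field is differentiated. -/
theorem plot_ddirSec {P : Type} [NormedAddCommGroup P] [NormedSpace ℝ P] [FiniteDimensional ℝ P]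
    (hΦ : IsOpenFld 𝒦 Φ) {R : P → Φ → M → W}
    (hR : ∀ c : P × ℝ → Φ, ConfPlot 𝒦 c → Plot E 𝒦' T fun q => R q.1 (c q))
    {c : P → Φ} {u : P → Var 𝒦 ρ} (hc : ConfPlot 𝒦 c)
    (hu : Plot E 𝒦 (fieldT M ρ) fun p => (u p).1) :
    Plot E 𝒦' T (fun p => ddirSec (R p) (c p) (u p)) ∧
      ∀ p, ddirSec (R p) (c p) (u p) ∈ SecK E 𝒦' T := by
  have key : ∀ p₀, ∃ s : P × ℝ → M → W, Plot E 𝒦' T s ∧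
      (fun p => ddirSec (R p) (c p) (u p)) =ᶠ[𝓝 p₀]
        fun p x => fderiv ℝ (fun q => s q x) (p, 0) (0, 1) := by
    intro p₀
    obtain ⟨c', hc', h⟩ := exists_confPlot_shift hΦ hc hu p₀
    refine ⟨_, hR c' hc', ?_⟩
    filter_upwards [eventually_ddir_eq (W := W) h] with p hp
    funext x
    exact hp (fun p φ => R p φ x) ((((hR c' hc').smooth (p, 0)).eval x).differentiableAt (by simp))
  constructor
  · refine Plot.of_locally fun p₀ => ?_
    obtain ⟨s, hs, h⟩ := key p₀
    exact ⟨_, (hs.fderiv_param (0, 1)).comp (r := fun p => (p, 0)) (by fun_prop), h⟩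
  · intro p
    obtain ⟨s, hs, h⟩ := key p
    have h1 : ddirSec (R p) (c p) (u p) = fun x => fderiv ℝ (fun q => s q x) (p, 0) (0, 1) :=
      h.self_of_nhds
    exact h1 ▸ hs.fderiv_mem (0, 1) (p, 0)

theorem IsSmoothMap.ddirSec_mem (hΦ : IsOpenFld 𝒦 Φ) {R : Φ → M → W}
    (hR : IsSmoothMap 𝒦 𝒦' T R) (φ : Φ) (v : Var 𝒦 ρ) : ddirSec R φ v ∈ SecK E 𝒦' T :=
  (plot_ddirSec (P := ℝ) (c := fun _ => φ) (u := fun _ => v) hΦ (R := fun _ => R)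
    (fun c hc => hR _ c hc) (.const φ.1.2) (.const v.2.1)).2 0

/-- Near the origin, φ + s v + t w is a smooth two-parameter family in `Φ`. The derivative along a v
+ b w is the total derivative of f on that family applied to (a, b), which is linear. -/
theorem ddir_lin (hΦ : IsOpenFld 𝒦 Φ) {f : Φ → W}
    (hf : ∀ c : ℝ × ℝ → Φ, ConfPlot 𝒦 c → ContDiff ℝ ∞ fun q => f (c q)) (φ : Φ) (r : ℝ)
    (v w : Var 𝒦 ρ) : ddir f φ (r • v + w) = r • ddir f φ v + ddir f φ w := by
  obtain ⟨c, hc, hcv, hc0⟩ := exists_curve hΦ φ v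
  obtain ⟨c', hc', h⟩ := exists_confPlot_shift hΦ hc (u := fun _ => w) (.const w.2.1) 0
  have hd : DifferentiableAt ℝ (fun q => f (c' q)) (0, 0) := (hf c' hc').differentiable (by simp) _
  have hq : ∀ᶠ q : ℝ × ℝ in 𝓝 (0, 0), (c' q).1 = shift (shift φ.1 v q.1) w q.2 := by
    filter_upwards [h, continuous_fst.continuousAt.eventually hcv] with q hq hq'
    rw [hq, hq']
  have main : ∀ (a b : ℝ) (u : Var 𝒦 ρ), a • v + b • w = u →
      ddir f φ u = fderiv ℝ (fun q => f (c' q)) (0, 0) (a, b) := by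
    intro a b u hu
    have hlim : Tendsto (fun t : ℝ => (a * t, b * t)) (𝓝 0) (𝓝 (0, 0)) := by
      have : Continuous (fun t : ℝ => (a * t, b * t)) := by fun_prop
      simpa using this.tendsto 0
    have h1 : ∀ᶠ t in 𝓝 (0 : ℝ), (c' (a * t, b * t)).1 = shift φ.1 u t := by
      filter_upwards [hlim.eventually hq] with t ht
      rw [ht, ← hu]
      simp only [shift, map_add, map_smul]
      module
    rw [ddir_eq_deriv (c := fun t => c' (a * t, b * t)) h1]
    have h2 : HasDerivAt (fun t : ℝ => (a * t, b * t)) (a, b) 0 := by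
      simpa using ((hasDerivAt_id (0 : ℝ)).const_mul a).prodMk ((hasDerivAt_id (0 : ℝ)).const_mul b)
    have h3 : HasFDerivAt (fun q => f (c' q)) (fderiv ℝ (fun q => f (c' q)) (0, 0))
        ((fun t : ℝ => (a * t, b * t)) 0) := by simpa using hd.hasFDerivAt
    exact (h3.comp_hasDerivAt (0 : ℝ) h2).deriv
  rw [main r 1 _ (by simp), main 1 0 v (by simp), main 0 1 w (by simp), ← map_smul, ← map_add]
  simp

theorem IsSmoothMap.contDiff_eval {P : Type} [NormedAddCommGroup P] [NormedSpace ℝ P]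
    [FiniteDimensional ℝ P] {R : Φ → M → W} (hR : IsSmoothMap 𝒦 𝒦' T R) {c : P → Φ}
    (hc : ConfPlot 𝒦 c) (x : M) : ContDiff ℝ ∞ fun p => R (c p) x :=
  contDiff_iff_contDiffAt.2 fun p => ((hR P c hc).smooth p).eval x

/-- The derivative of a smooth map is smooth, and linear in the direction. -/
theorem IsSmoothMap.ddirSec (hΦ : IsOpenFld 𝒦 Φ) {R : Φ → M → W}
    (hR : IsSmoothMap 𝒦 𝒦' T R) : IsSmoothLin 𝒦 (fieldT M ρ) T (ddirSec (𝒦 := 𝒦) R) where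
  lin φ r v w := funext fun x => ddir_lin hΦ (fun _ hc => hR.contDiff_eval hc x) φ r v w
  smooth _ _ _ _ _ _ hc hw :=
    (plot_ddirSec hΦ (R := fun _ => R) (fun c' hc' => hR _ c' hc') hc hw).1.toUniv

theorem hasDerivAt_fderiv_line {V : Type*} [NormedAddCommGroup V] [NormedSpace ℝ V] {G : V → W}
    (h : Differentiable ℝ (fderiv ℝ G)) (b a : V) :
    HasDerivAt (fun t : ℝ => fderiv ℝ G ((0 : V) + t • b) a) (fderiv ℝ (fderiv ℝ G) 0 b a) 0 := by
  have h1 : HasDerivAt (fun t : ℝ => (0 : V) + t • b) b 0 := by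
    simpa using ((hasDerivAt_id (0 : ℝ)).smul_const b).const_add 0
  have h3 : HasFDerivAt (fderiv ℝ G) (fderiv ℝ (fderiv ℝ G) 0)
      ((fun τ : ℝ => (0 : V) + τ • b) 0) := by simpa using (h 0).hasFDerivAt
  have h4 := h3.comp_hasDerivAt (0 : ℝ) h1
  have h5 := (ContinuousLinearMap.apply ℝ W a).hasFDerivAt.comp_hasDerivAt (0 : ℝ) h4
  exact h5

/-- On the same two-parameter family, iterated derivatives along v and w are mixed second partial
derivatives. -/
theorem ddir_symm (hΦ : IsOpenFld 𝒦 Φ) {f : Φ → W}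
    (hf : ∀ c : ℝ × ℝ → Φ, ConfPlot 𝒦 c → ContDiff ℝ ∞ fun q => f (c q)) (φ : Φ)
    (v w : Var 𝒦 ρ) :
    ddir (fun ψ => ddir f ψ w) φ v = ddir (fun ψ => ddir f ψ v) φ w := by
  obtain ⟨c, hc, hcv, hc0⟩ := exists_curve hΦ φ v
  obtain ⟨c', hc', h⟩ := exists_confPlot_shift hΦ hc (u := fun _ => w) (.const w.2.1) 0
  have hq : ∀ᶠ q : ℝ × ℝ in 𝓝 (0, 0), (c' q).1 = shift (shift φ.1 v q.1) w q.2 := by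
    filter_upwards [h, continuous_fst.continuousAt.eventually hcv] with q hq hq'
    rw [hq, hq']
  set G : ℝ × ℝ → W := fun q => f (c' q) with hG
  have hGs : ContDiff ℝ ∞ G := hf c' hc'
  have hGd : Differentiable ℝ G := hGs.differentiable (by simp)
  have hG2 : Differentiable ℝ (fderiv ℝ G) :=
    (hGs.fderiv_right (m := ∞) (by simp)).differentiable (by simp)
  have main : ∀ (a b : ℝ × ℝ) (u u' : Var 𝒦 ρ), a.1 • v + a.2 • w = u → b.1 • v + b.2 • w = u' →
      ddir (fun ψ => ddir f ψ u) φ u' = fderiv ℝ (fderiv ℝ G) 0 b a := by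
    intro a b u u' hu hu'
    -- Moving from q in the direction a stays in the family and shifts the field at q by t u. The
    -- inner derivative is therefore computed at every base point near the origin, not only at φ.
    have hstep : ∀ q : ℝ × ℝ, (∀ᶠ q' in 𝓝 q, (c' q').1 = shift (shift φ.1 v q'.1) w q'.2) →
        ∀ (a : ℝ × ℝ) (u : Var 𝒦 ρ), a.1 • v + a.2 • w = u →
        ∀ᶠ t in 𝓝 (0 : ℝ), (c' (q + t • a)).1 = shift (c' q).1 u t := by
      intro q hq a u hu
      have hlim : Tendsto (fun t : ℝ => q + t • a) (𝓝 0) (𝓝 q) := by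
        have : Continuous (fun t : ℝ => q + t • a) := by fun_prop
        simpa using this.tendsto 0
      filter_upwards [hlim.eventually hq] with t ht
      rw [ht, hq.self_of_nhds, ← hu]
      simp only [shift, map_add, map_smul, Prod.fst_add, Prod.snd_add, Prod.smul_fst,
        Prod.smul_snd, smul_eq_mul]
      module
    have hline : ∀ q a : ℝ × ℝ, HasDerivAt (fun t : ℝ => q + t • a) a 0 := fun q a => by
      simpa using ((hasDerivAt_id (0 : ℝ)).smul_const a).const_add q
    have hc00 : c' (0, 0) = φ := Subtype.ext (by
      rw [hq.self_of_nhds]; simp [shift_zero])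
    have h1 := hstep 0 hq b u' hu'
    have hlim : Tendsto (fun t : ℝ => (0 : ℝ × ℝ) + t • b) (𝓝 0) (𝓝 0) := by
      have : Continuous (fun t : ℝ => (0 : ℝ × ℝ) + t • b) := by fun_prop
      simpa using this.tendsto 0
    have h2 : ∀ᶠ t in 𝓝 (0 : ℝ), ddir f (c' ((0 : ℝ × ℝ) + t • b)) u =
        fderiv ℝ G ((0 : ℝ × ℝ) + t • b) a := by
      filter_upwards [hlim.eventually hq.eventually_nhds] with t ht
      rw [ddir_eq_deriv (hstep _ ht a u hu)]
      have h3 : HasFDerivAt G (fderiv ℝ G ((0 : ℝ × ℝ) + t • b))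
          ((fun τ : ℝ => ((0 : ℝ × ℝ) + t • b) + τ • a) 0) := by simpa using (hGd _).hasFDerivAt
      exact (h3.comp_hasDerivAt (0 : ℝ) (hline _ a)).deriv
    have h1' : ∀ᶠ t in 𝓝 (0 : ℝ), (c' ((0 : ℝ × ℝ) + t • b)).1 = shift φ.1 u' t := by
      rw [← hc00]; exact h1
    rw [ddir_eq_deriv h1', EventuallyEq.deriv_eq h2]
    exact (hasDerivAt_fderiv_line hG2 b a).deriv
  rw [main (0, 1) (1, 0) w v (by simp) (by simp), main (1, 0) (0, 1) v w (by simp) (by simp)]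
  exact (hGs.contDiffAt.isSymmSndFDerivAt minSmoothness_two_le).eq _ _

theorem ddirSec_symm (hΦ : IsOpenFld 𝒦 Φ) {R : Φ → M → W} (hR : IsSmoothMap 𝒦 𝒦' T R) (φ : Φ)
    (v w : Var 𝒦 ρ) :
    ddirSec (fun ψ => ddirSec R ψ w) φ v = ddirSec (fun ψ => ddirSec R ψ v) φ w :=
  funext fun x => ddir_symm hΦ (fun _ hc => hR.contDiff_eval hc x) φ v w

/-- The slope at 0 of t f₁(t) is f₁(t), so continuity of f₁ suffices. -/
theorem hasDerivAt_of_hadamard {f f₀ f₁ : ℝ → W} {a : W} (h : ∀ᶠ t in 𝓝 0, f t = f₀ t + t • f₁ t)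
    (h0 : HasDerivAt f₀ a 0) (h1 : ContinuousAt f₁ 0) : HasDerivAt f (a + f₁ 0) 0 := by
  refine (h0.add ?_).congr_of_eventuallyEq h
  rw [hasDerivAt_iff_tendsto_slope]
  refine (h1.tendsto.mono_left nhdsWithin_le_nhds).congr' ?_
  filter_upwards [self_mem_nhdsWithin] with t ht
  simp [slope_def_module, smul_smul, inv_mul_cancel₀ ht]

theorem ddirSec_add (hΦ : IsOpenFld 𝒦 Φ) {R S : Φ → M → W} (hR : IsSmoothMap 𝒦 𝒦' T R)
    (hS : IsSmoothMap 𝒦 𝒦' T S) (φ : Φ) (v : Var 𝒦 ρ) :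
    ddirSec (fun ψ => R ψ + S ψ) φ v = ddirSec R φ v + ddirSec S φ v := by
  obtain ⟨c, hc, hcv, -⟩ := exists_curve hΦ φ v
  simp only [ddirSec_eq_deriv hcv]
  funext x
  exact deriv_add ((hR.contDiff_eval hc x).differentiable (by simp) _)
    ((hS.contDiff_eval hc x).differentiable (by simp) _)

theorem ddirSec_smul (hΦ : IsOpenFld 𝒦 Φ) {R : Φ → M → W} (hR : IsSmoothMap 𝒦 𝒦' T R) (r : ℝ)
    (φ : Φ) (v : Var 𝒦 ρ) : ddirSec (fun ψ => r • R ψ) φ v = r • ddirSec R φ v := by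
  obtain ⟨c, hc, hcv, -⟩ := exists_curve hΦ φ v
  simp only [ddirSec_eq_deriv hcv]
  funext x
  exact deriv_const_smul r ((hR.contDiff_eval hc x).differentiable (by simp) _)

theorem ddirSec_const (s : M → W) (φ : Φ) (v : Var 𝒦 ρ) (hΦ : IsOpenFld 𝒦 Φ) :
    ddirSec (fun _ : Φ => s) φ v = 0 := by
  obtain ⟨c, hc, hcv, -⟩ := exists_curve hΦ φ v
  rw [ddirSec_eq_deriv hcv]
  simp; rfl

/-- The Leibniz rule for a smooth map that depends linearly on a field-dependent section. -/
theorem IsSmoothLin.ddirSec_apply [FiniteDimensional ℝ F'] (hΦ : IsOpenFld 𝒦 Φ)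
    {R : Φ → SecK E 𝒦 T₁ → M → W} (hR : IsSmoothLin 𝒦 T₁ T R)
    {w : Φ → SecK E 𝒦 T₁} (hw : IsSmoothMap 𝒦 𝒦 T₁ fun ψ => (w ψ).1) (φ : Φ) (v : Var 𝒦 ρ) :
    ddirSec (fun ψ => R ψ (w ψ)) φ v = ddirSec (fun ψ => R ψ (w φ)) φ v +
      R φ (toSecK E 𝒦 T₁ (ddirSec (fun ψ => (w ψ).1) φ v)) := by
  obtain ⟨c, hc, hcv, hc0⟩ := exists_curve hΦ φ v
  have := FiniteDimensional.complete ℝ F'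
  obtain ⟨s, hs, hsK, hsw, hs0⟩ := (hw ℝ c hc).exists_hadamard
  have h0 : (⟨s 0, hsK 0⟩ : SecK E 𝒦 T₁) = toSecK E 𝒦 T₁ (ddirSec (fun ψ => (w ψ).1) φ v) := by
    have : s 0 = ddirSec (fun ψ => (w ψ).1) φ v := by rw [ddirSec_eq_deriv hcv, hs0]
    rw [toSecK, dif_pos (this ▸ hsK 0)]
    exact Subtype.ext this
  rw [ddirSec_eq_deriv hcv, ddirSec_eq_deriv hcv]
  funext x
  -- Linearity of `R` in the section turns the Hadamard decomposition of `w (c t)` into one of the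
  -- whole expression. The increment may be inserted into `R` because it is a smooth family with
  -- admissible supports.
  have h1 : ∀ᶠ t in 𝓝 (0 : ℝ), R (c t) (w (c t)) x =
      R (c t) (w φ) x + t • R (c t) ⟨s t, hsK t⟩ x := by
    filter_upwards [hsw] with t ht
    have : w (c t) = t • ⟨s t, hsK t⟩ + w φ := Subtype.ext (by
      rw [ht, hc0, add_comm]; rfl)
    rw [this, hR.lin, add_comm]
    rfl
  have h2 := hasDerivAt_of_hadamard h1
    (((hR.apply_const (w φ)).contDiff_eval hc x).differentiable (by simp) 0).hasDerivAt
    (((hR.smooth ℝ c _ hc hs).smooth 0).eval x).continuousAt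
  rw [h2.deriv, hc0, h0]
  rfl

/-- The derivative commutes with linear operations on sections. -/
theorem ddirSec_map [CompleteSpace W] (hΦ : IsOpenFld 𝒦 Φ) {R : Φ → M → W}
    (hR : IsSmoothMap 𝒦 𝒦' T R) {A : (M → W) → M → W'}
    (hA : ∀ s ∈ Sec E T, ∀ t ∈ Sec E T, ∀ r : ℝ, A (s + r • t) = A s + r • A t)
    (hA' : ∀ s : ℝ → M → W, Plot E (.univ M) T s → Plot E (.univ M) T' fun t => A (s t))
    (φ : Φ) (v : Var 𝒦 ρ) : ddirSec (fun ψ => A (R ψ)) φ v = A (ddirSec R φ v) := by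
  obtain ⟨c, hc, hcv, hc0⟩ := exists_curve hΦ φ v
  obtain ⟨s, hs, hsK, hsw, hs0⟩ := (hR ℝ c hc).toUniv.exists_hadamard
  have h0 : ddirSec R φ v = s 0 := by rw [ddirSec_eq_deriv hcv, hs0]
  rw [h0, ddirSec_eq_deriv hcv]
  funext x
  have h1 : ∀ᶠ t in 𝓝 (0 : ℝ), A (R (c t)) x = A (R φ) x + t • A (s t) x := by
    filter_upwards [hsw] with t ht
    rw [ht, hc0, hA _ (hR.mem φ) _ (hsK t).1]
    rfl
  have h2 := hasDerivAt_of_hadamard h1 (hasDerivAt_const (0 : ℝ) _)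
    (((hA' s hs).smooth 0).eval x).continuousAt
  rw [h2.deriv, zero_add]

end Deriv

end FieldCalculus

/-! ### Field-dependent sections with admissible support. -/

section SectionValued

variable {E : Type*} [NormedAddCommGroup E] [NormedSpace ℝ E] [FiniteDimensional ℝ E]
  {M : Type*} [TopologicalSpace M] [ChartedSpace E M] [IsManifold 𝓘(ℝ, E) ∞ M]
  {F : Type*} [NormedAddCommGroup F] [NormedSpace ℝ F] [FiniteDimensional ℝ F]
  {F' : Type*} [NormedAddCommGroup F'] [NormedSpace ℝ F'] [FiniteDimensional ℝ F']
  {W : Type*} [NormedAddCommGroup W] [NormedSpace ℝ W]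
  {𝒦 𝒦' : SupportFamily M} {ρ : TensorType E F} {Φ : Set (Fld M ρ)}
  {T₁ : Transition M F'} {T : Transition M W}

theorem toSecK_coe {s : M → W} (hs : s ∈ SecK E 𝒦 T) : (toSecK E 𝒦 T s).1 = s := by
  rw [toSecK, dif_pos hs]

theorem secK_neg_eq (v : SecK E 𝒦 T) : (-1 : ℝ) • v = -v :=
  Subtype.ext <| funext fun x => neg_one_smul ℝ (v.1 x)

theorem Plot.const_smul {P : Type*} [NormedAddCommGroup P] [NormedSpace ℝ P] {s : P → M → W}
    (h : Plot E 𝒦 T s) (r : ℝ) : Plot E 𝒦 T fun p => r • s p := by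
  refine ⟨fun p => (h.smooth p).smul contDiffAt_const, fun p => ?_⟩
  obtain ⟨K, hK, h⟩ := h.supp p
  refine ⟨K, hK, ?_⟩
  filter_upwards [h] with q hq x hx
  simp [hq x hx]

theorem Plot.lin {P : Type*} [NormedAddCommGroup P] [NormedSpace ℝ P] {s t : P → M → W}
    (h : Plot E 𝒦 T s) (r : ℝ) (h' : Plot E 𝒦 T t) : Plot E 𝒦 T fun p => s p + r • t p :=
  h.add (h'.const_smul r)

theorem isSmoothMap_of_fin {R : Φ → M → W} (h : ∀ (k : ℕ) (c : (Fin k → ℝ) → Φ),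
    FieldPlot 𝒦 (fun p => (c p).1) → Plot E 𝒦' T fun p => R (c p)) : IsSmoothMap 𝒦 𝒦' T R :=
  fun _ _ _ _ _ hc => Plot.ofFin fun k e => h k _ (isPlot_iff.2 (hc.comp e.contDiff))

theorem mem_fieldDepParam_iff {X : Φ → VF E 𝒦} :
    X ∈ FieldDepParam 𝒦 Φ ↔ IsSmoothMap 𝒦 𝒦 (vecT E M) fun ψ => (X ψ).1 :=
  ⟨fun h => isSmoothMap_of_fin fun k c hc => isPlot_iff.1 (h k c hc),
    fun h _ _ hc => isPlot_iff.2 (h _ _ (isPlot_iff.1 hc))⟩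

theorem isSmoothMap_id : IsSmoothMap 𝒦 𝒦 (fieldT M ρ) fun ψ : Φ => ψ.1.1 := fun _ _ _ _ _ hc => hc

theorem IsSmoothMap.const_smul {R : Φ → M → W} (h : IsSmoothMap 𝒦 𝒦' T R) (r : ℝ) :
    IsSmoothMap 𝒦 𝒦' T fun φ => r • R φ := fun P _ _ _ c hc => (h P c hc).const_smul r

/-- The derivative of a field-dependent section with admissible support. -/
def dSec (w : Φ → SecK E 𝒦 T) (φ : Φ) (v : Var 𝒦 ρ) : SecK E 𝒦 T :=
  toSecK E 𝒦 T (ddirSec (fun ψ => (w ψ).1) φ v)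

theorem dParam_eq_dSec (X : Φ → VF E 𝒦) : dParam X = dSec X := rfl

section

variable [NormalizedTransition T] [NormalizedTransition T₁] (hΦ : IsOpenFld 𝒦 Φ)
include hΦ

theorem dSec_coe {w : Φ → SecK E 𝒦 T} (hw : IsSmoothMap 𝒦 𝒦 T fun ψ => (w ψ).1) (φ : Φ)
    (v : Var 𝒦 ρ) : (dSec w φ v).1 = ddirSec (fun ψ => (w ψ).1) φ v :=
  toSecK_coe (hw.ddirSec_mem hΦ φ v)

theorem dSec_lin {w : Φ → SecK E 𝒦 T} (hw : IsSmoothMap 𝒦 𝒦 T fun ψ => (w ψ).1) (φ : Φ) (r : ℝ)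
    (v v' : Var 𝒦 ρ) : dSec w φ (r • v + v') = r • dSec w φ v + dSec w φ v' := by
  refine Subtype.ext ?_
  rw [dSec_coe hΦ hw, (hw.ddirSec hΦ).lin]
  change _ = r • (dSec w φ v).1 + (dSec w φ v').1
  rw [dSec_coe hΦ hw, dSec_coe hΦ hw]

theorem dSec_sub_right {w : Φ → SecK E 𝒦 T} (hw : IsSmoothMap 𝒦 𝒦 T fun ψ => (w ψ).1) (φ : Φ)
    (v v' : Var 𝒦 ρ) : dSec w φ (v - v') = dSec w φ v - dSec w φ v' := by
  have := dSec_lin hΦ hw φ (-1) v' v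
  rw [secK_neg_eq, secK_neg_eq] at this
  rw [sub_eq_neg_add, this, sub_eq_neg_add]

theorem dSec_add_smul {w w' : Φ → SecK E 𝒦 T} (hw : IsSmoothMap 𝒦 𝒦 T fun ψ => (w ψ).1)
    (hw' : IsSmoothMap 𝒦 𝒦 T fun ψ => (w' ψ).1) (r : ℝ) (φ : Φ) (v : Var 𝒦 ρ) :
    dSec (fun ψ => w ψ + r • w' ψ) φ v = dSec w φ v + r • dSec w' φ v := by
  refine Subtype.ext ?_
  rw [dSec_coe hΦ (hw.add (hw'.const_smul r))]
  change _ = (dSec w φ v).1 + r • (dSec w' φ v).1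
  rw [dSec_coe hΦ hw, dSec_coe hΦ hw', ← ddirSec_smul hΦ hw',
    ← ddirSec_add hΦ hw (hw'.const_smul r)]
  rfl

theorem isSmoothMap_dSec {w : Φ → SecK E 𝒦 T} {u : Φ → Var 𝒦 ρ}
    (hw : IsSmoothMap 𝒦 𝒦 T fun ψ => (w ψ).1)
    (hu : IsSmoothMap 𝒦 𝒦 (fieldT M ρ) fun ψ => (u ψ).1) :
    IsSmoothMap 𝒦 𝒦 T fun ψ => (dSec w ψ (u ψ)).1 := by
  simp only [dSec_coe hΦ hw]
  exact fun P _ _ _ c hc => (plot_ddirSec hΦ (R := fun _ ψ => (w ψ).1)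
    (fun c' hc' => hw _ c' hc') hc (hu P c hc)).1

theorem dSec_symm {w : Φ → SecK E 𝒦 T} (hw : IsSmoothMap 𝒦 𝒦 T fun ψ => (w ψ).1) (φ : Φ)
    (v v' : Var 𝒦 ρ) :
    dSec (fun ψ => dSec w ψ v) φ v' = dSec (fun ψ => dSec w ψ v') φ v := by
  refine Subtype.ext ?_
  rw [dSec_coe hΦ (isSmoothMap_dSec hΦ hw (isSmoothMap_const v.2.1)),
    dSec_coe hΦ (isSmoothMap_dSec hΦ hw (isSmoothMap_const v'.2.1))]
  simp only [dSec_coe hΦ hw]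
  exact ddirSec_symm hΦ hw φ v' v

/-- The Leibniz rule for a map into sections with admissible support. -/
theorem dSec_apply {R : Φ → SecK E 𝒦 T₁ → SecK E 𝒦 T}
    (hR : IsSmoothLin 𝒦 T₁ T fun ψ w => (R ψ w).1)
    (hR' : ∀ w : Φ → SecK E 𝒦 T₁, IsSmoothMap 𝒦 𝒦 T₁ (fun ψ => (w ψ).1) →
      IsSmoothMap 𝒦 𝒦 T fun ψ => (R ψ (w ψ)).1)
    {w : Φ → SecK E 𝒦 T₁} (hw : IsSmoothMap 𝒦 𝒦 T₁ fun ψ => (w ψ).1) (φ : Φ) (v : Var 𝒦 ρ) :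
    dSec (fun ψ => R ψ (w ψ)) φ v = dSec (fun ψ => R ψ (w φ)) φ v + R φ (dSec w φ v) := by
  refine Subtype.ext ?_
  change _ = (dSec (fun ψ => R ψ (w φ)) φ v).1 + (R φ (dSec w φ v)).1
  rw [dSec_coe hΦ (hR' w hw), dSec_coe hΦ (hR' _ (isSmoothMap_const (w φ).2.1)),
    hR.ddirSec_apply hΦ hw]
  rfl

theorem dSec_const (s : SecK E 𝒦 T) (φ : Φ) (v : Var 𝒦 ρ) : dSec (fun _ : Φ => s) φ v = 0 := by
  refine Subtype.ext ?_
  rw [dSec_coe hΦ (isSmoothMap_const s.2.1), ddirSec_const _ _ _ hΦ]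
  rfl

theorem dSec_ddirSec {w : Φ → SecK E 𝒦 T} (hw : IsSmoothMap 𝒦 𝒦 T fun ψ => (w ψ).1)
    {u : Φ → Var 𝒦 ρ} (hu : IsSmoothMap 𝒦 𝒦 (fieldT M ρ) fun ψ => (u ψ).1) (φ : Φ)
    (v : Var 𝒦 ρ) : dSec (fun ψ => dSec w ψ (u ψ)) φ v =
      dSec (fun ψ => dSec w ψ (u φ)) φ v + dSec w φ (dSec u φ v) := by
  refine dSec_apply hΦ (R := fun ψ v => dSec w ψ v) ?_ (fun u hu => isSmoothMap_dSec hΦ hw hu) hu φ v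
  simp only [dSec_coe hΦ hw]
  exact hw.ddirSec hΦ

end

/-! ### Lie derivatives of fields and brackets of vector fields -/

/-- The default value in `toSecK` is never taken, since Lie derivatives along admissible vector
fields are smooth with admissible support. -/
theorem vertAt_coe (X : VF E 𝒦) (φ : Fld M ρ) : (vertAt X φ).1 = lieFld ρ X.1 φ.1 :=
  toSecK_coe (lieFld_mem ρ X.2 φ.2)

/-- The Lie derivative of a variation. -/
def lieVar (X : VF E 𝒦) (v : Var 𝒦 ρ) : Var 𝒦 ρ := toSecK E 𝒦 (fieldT M ρ) (lieFld ρ X.1 v.1)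

theorem lieVar_coe (X : VF E 𝒦) (v : Var 𝒦 ρ) : (lieVar X v).1 = lieFld ρ X.1 v.1 :=
  toSecK_coe (lieFld_mem ρ X.2 v.2.1)

/-- Here too the default in `toSecK` is excluded. Up to the sign of the convention, the bracket is a
Lie derivative of type `idType`, so facts about tensorial fields apply to it. -/
theorem diffBracket_coe (X Y : VF E 𝒦) :
    (diffBracket X Y).1 = (-1 : ℝ) • lieFld (idType E) X.1 Y.1 := by
  have h : (fun x => -(VectorField.mlieBracket 𝓘(ℝ, E) (M := M) X.1 Y.1 x : E)) =
      (-1 : ℝ) • lieFld (idType E) X.1 Y.1 := by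
    funext x
    rw [mlieBracket_eq_lieFld]
    exact (neg_one_smul ℝ _).symm
  rw [diffBracket, h]
  exact toSecK_coe (Submodule.smul_mem _ _ (lieFld_mem (idType E) X.2 Y.2.1))

theorem vertAt_add_smul (X Y : VF E 𝒦) (r : ℝ) (φ : Fld M ρ) :
    vertAt (r • X + Y) φ = r • vertAt X φ + vertAt Y φ := by
  refine Subtype.ext ?_
  change _ = r • (vertAt X φ).1 + (vertAt Y φ).1
  rw [vertAt_coe, vertAt_coe, vertAt_coe]
  exact lieFld_add_left ρ φ.1 r X.2.1 Y.2.1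

theorem diffBracket_add_smul_right (X Y Z : VF E 𝒦) (r : ℝ) :
    diffBracket X (r • Y + Z) = r • diffBracket X Y + diffBracket X Z := by
  refine Subtype.ext ?_
  change _ = r • (diffBracket X Y).1 + (diffBracket X Z).1
  rw [diffBracket_coe, diffBracket_coe, diffBracket_coe]
  have := lieFld_add_right (idType E) X.1 r Y.2.1 Z.2.1
  rw [show (r • Y + Z).1 = r • Y.1 + Z.1 from rfl, this]
  module

theorem diffBracket_swap (X Y : VF E 𝒦) : diffBracket X Y = -diffBracket Y X := by
  refine Subtype.ext ?_
  change _ = -(diffBracket Y X).1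
  rw [diffBracket_coe, diffBracket_coe]
  funext x
  have h := VectorField.mlieBracket_swap_apply (I := 𝓘(ℝ, E)) (M := M) (V := X.1) (W := Y.1) (x := x)
  have h' : lieFld (idType E) X.1 Y.1 x = -lieFld (idType E) Y.1 X.1 x := by
    rw [← mlieBracket_eq_lieFld, ← mlieBracket_eq_lieFld]
    exact h
  simp [h']

theorem lieFld_idType_coe (X Y : VF E 𝒦) : lieFld (idType E) X.1 Y.1 = (diffBracket Y X).1 := by
  rw [diffBracket_swap]
  change _ = -(diffBracket X Y).1
  rw [diffBracket_coe]
  simp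

/-- The commutator of Lie derivatives. -/
theorem lieVar_vertAt (X Y : VF E 𝒦) (φ : Fld M ρ) :
    lieVar X (vertAt Y φ) - lieVar Y (vertAt X φ) = vertAt (diffBracket Y X) φ := by
  refine Subtype.ext ?_
  change (lieVar X (vertAt Y φ)).1 - (lieVar Y (vertAt X φ)).1 = _
  rw [lieVar_coe, lieVar_coe, vertAt_coe, vertAt_coe, vertAt_coe, ← lieFld_idType_coe,
    lieFld_commutator ρ X.2.1 Y.2.1 φ.2]

/-- The commutator formula for Lie derivatives, applied to vector fields as tensorial fields of type
`idType`. -/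
theorem diffBracket_jacobi (X Y Z : VF E 𝒦) :
    diffBracket X (diffBracket Y Z) + diffBracket Y (diffBracket Z X)
      + diffBracket Z (diffBracket X Y) = 0 := by
  have h1 := lieFld_commutator (idType E) X.2.1 Y.2.1 Z.2.1
  simp only [lieFld_idType_coe] at h1
  have h2 : diffBracket (diffBracket Z Y) X - diffBracket (diffBracket Z X) Y =
      diffBracket Z (diffBracket Y X) := Subtype.ext h1
  rw [diffBracket_swap X, diffBracket_swap Y (diffBracket Z X), diffBracket_swap X Y]
  have h3 : ∀ A B : VF E 𝒦, diffBracket A (-B) = -diffBracket A B := fun A B => by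
    have := diffBracket_add_smul_right A B 0 (-1)
    have h0 := diffBracket_add_smul_right A 0 0 (1)
    simp only [smul_zero, add_zero, one_smul, left_eq_add] at h0
    rwa [secK_neg_eq, secK_neg_eq, h0, add_zero, add_zero] at this
  rw [h3, ← h2, diffBracket_swap Z Y, diffBracket_swap (-_) X, h3, diffBracket_swap X]
  abel

end SectionValued

/-! ### The extended bracket and its Lie algebra structure. -/

section ExtendedBracket

variable {E : Type*} [NormedAddCommGroup E] [NormedSpace ℝ E] [FiniteDimensional ℝ E]
  {M : Type*} [TopologicalSpace M] [ChartedSpace E M] [IsManifold 𝓘(ℝ, E) ∞ M]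
  {F : Type*} [NormedAddCommGroup F] [NormedSpace ℝ F] [FiniteDimensional ℝ F]
  {𝒦 : SupportFamily M} {ρ : TensorType E F} {Φ : Set (Fld M ρ)}

theorem IsSmoothMap.vert {X : Φ → VF E 𝒦} (hX : IsSmoothMap 𝒦 𝒦 (vecT E M) fun ψ => (X ψ).1) :
    IsSmoothMap 𝒦 𝒦 (fieldT M ρ) fun ψ => (vert X ψ).1 := by
  simp only [CovPhaseSpace.vert, vertAt_coe]
  exact fun P _ _ _ c hc => (hX P c hc).lieDeriv ρ (fun p => (X (c p)).2) hc.toUniv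

theorem plot_diffBracket {P : Type*} [NormedAddCommGroup P] [NormedSpace ℝ P] {X Y : P → VF E 𝒦}
    (hX : Plot E 𝒦 (vecT E M) fun p => (X p).1) (hY : Plot E 𝒦 (vecT E M) fun p => (Y p).1) :
    Plot E 𝒦 (vecT E M) fun p => (diffBracket (X p) (Y p)).1 := by
  simp only [diffBracket_coe]
  exact (Plot.lieDeriv (idType E) hX (fun p => (X p).2) hY.toUniv).const_smul (-1)

theorem IsSmoothMap.diffBracket {X Y : Φ → VF E 𝒦}
    (hX : IsSmoothMap 𝒦 𝒦 (vecT E M) fun ψ => (X ψ).1)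
    (hY : IsSmoothMap 𝒦 𝒦 (vecT E M) fun ψ => (Y ψ).1) :
    IsSmoothMap 𝒦 𝒦 (vecT E M) fun ψ => (diffBracket (X ψ) (Y ψ)).1 :=
  fun P _ _ _ c hc => plot_diffBracket (hX P c hc) (hY P c hc)

theorem isSmoothLin_lieFld : IsSmoothLin (Φ := Φ) 𝒦 (vecT E M) (fieldT M ρ)
    fun ψ X => (vertAt X ψ.1).1 where
  lin ψ r X Y := congrArg Subtype.val (vertAt_add_smul X Y r ψ.1)
  smooth P _ _ _ c X hc hX := by
    simp only [vertAt_coe]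
    exact (hX.lieDeriv ρ (fun p => (X p).2) hc.toUniv).toUniv

theorem isSmoothLin_diffBracket {X : Φ → VF E 𝒦}
    (hX : IsSmoothMap 𝒦 𝒦 (vecT E M) fun ψ => (X ψ).1) :
    IsSmoothLin 𝒦 (vecT E M) (vecT E M) fun ψ Y => (diffBracket (X ψ) Y).1 where
  lin ψ r Y Z := congrArg Subtype.val (diffBracket_add_smul_right (X ψ) Y Z r)
  smooth P _ _ _ c _ hc hY := (plot_diffBracket (hX P c hc) hY).toUniv

theorem extBracket_apply (X Y : Φ → VF E 𝒦) (φ : Φ) : extBracket X Y φ =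
    diffBracket (X φ) (Y φ) + (dSec Y φ (vert X φ) - dSec X φ (vert Y φ)) := rfl

theorem extBracket_swap (X Y : Φ → VF E 𝒦) : extBracket X Y = -extBracket Y X := by
  funext φ
  rw [Pi.neg_apply, extBracket_apply, extBracket_apply, diffBracket_swap]
  abel

theorem diffBracket_neg_right (X Y : VF E 𝒦) : diffBracket X (-Y) = -diffBracket X Y := by
  have h0 := diffBracket_add_smul_right X 0 0 1
  simp only [smul_zero, add_zero, one_smul, left_eq_add] at h0
  have := diffBracket_add_smul_right X Y 0 (-1)
  rwa [secK_neg_eq, secK_neg_eq, h0, add_zero, add_zero] at this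

theorem diffBracket_add_right (X Y Z : VF E 𝒦) :
    diffBracket X (Y + Z) = diffBracket X Y + diffBracket X Z := by
  simpa using diffBracket_add_smul_right X Y Z 1

theorem diffBracket_sub_right (X Y Z : VF E 𝒦) :
    diffBracket X (Y - Z) = diffBracket X Y - diffBracket X Z := by
  rw [sub_eq_add_neg, diffBracket_add_right, diffBracket_neg_right, sub_eq_add_neg]

theorem vertAt_add (X Y : VF E 𝒦) (φ : Fld M ρ) : vertAt (X + Y) φ = vertAt X φ + vertAt Y φ := by
  simpa using vertAt_add_smul X Y 1 φ

theorem vertAt_sub (X Y : VF E 𝒦) (φ : Fld M ρ) : vertAt (X - Y) φ = vertAt X φ - vertAt Y φ := by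
  rw [eq_sub_iff_add_eq, ← vertAt_add, sub_add_cancel]

variable (hΦ : IsOpenFld 𝒦 Φ)
include hΦ

/-- The Lie derivative along a fixed `X` is linear in the field, and the derivative of the identity
of field space along v is v. -/
theorem dSec_vertAt (X : VF E 𝒦) (φ : Φ) (v : Var 𝒦 ρ) :
    dSec (fun ψ : Φ => vertAt X ψ.1) φ v = lieVar X v := by
  have := FiniteDimensional.complete ℝ F
  have hX : IsSmoothMap (Φ := Φ) 𝒦 𝒦 (fieldT M ρ) fun ψ => (vertAt X ψ.1).1 :=
    IsSmoothMap.vert (X := fun _ : Φ => X) (isSmoothMap_const X.2.1)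
  refine Subtype.ext ?_
  rw [dSec_coe hΦ hX, lieVar_coe]
  simp only [vertAt_coe]
  rw [ddirSec_map (T := fieldT M ρ) (T' := fieldT M ρ) hΦ (isSmoothMap_id (𝒦 := 𝒦) (Φ := Φ))
    (A := lieFld ρ X.1)]
  · congr 1
    obtain ⟨c, hc, hcv, -⟩ := exists_curve hΦ φ v
    rw [ddirSec_eq_deriv hcv]
    funext x
    have : (fun t => (c t).1.1 x) =ᶠ[𝓝 0] fun t => φ.1.1 x + t • v.1 x := by
      filter_upwards [hcv] with t ht
      rw [ht]
      rfl
    rw [this.deriv_eq]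
    have h := ((hasDerivAt_id (0 : ℝ)).smul_const (v.1 x)).const_add (φ.1.1 x)
    simpa using h.deriv
  · intro s hs t ht r
    rw [add_comm, lieFld_add_right ρ X.1 r ht hs, add_comm]
  · exact fun s hs => (Plot.lieDeriv ρ (.const X.2.1) (fun _ => X.2) hs).toUniv

/-- The derivative of a vertical vector field. -/
theorem dSec_vert {X : Φ → VF E 𝒦} (hX : IsSmoothMap 𝒦 𝒦 (vecT E M) fun ψ => (X ψ).1) (φ : Φ)
    (v : Var 𝒦 ρ) : dSec (vert X) φ v = vertAt (dSec X φ v) φ.1 + lieVar (X φ) v := by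
  have := dSec_apply hΦ (R := fun ψ X => vertAt X ψ.1) isSmoothLin_lieFld
    (fun w hw => IsSmoothMap.vert hw) hX φ v
  rw [dSec_vertAt hΦ, add_comm] at this
  exact this

/-- Two applications of the Leibniz rule. It is available for the right slot, so the left one is
treated after a swap with `Y` frozen at φ. -/
theorem dSec_diffBracket {X Y : Φ → VF E 𝒦} (hX : IsSmoothMap 𝒦 𝒦 (vecT E M) fun ψ => (X ψ).1)
    (hY : IsSmoothMap 𝒦 𝒦 (vecT E M) fun ψ => (Y ψ).1) (φ : Φ) (v : Var 𝒦 ρ) :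
    dSec (fun ψ => diffBracket (X ψ) (Y ψ)) φ v =
      diffBracket (dSec X φ v) (Y φ) + diffBracket (X φ) (dSec Y φ v) := by
  have h1 := dSec_apply hΦ (R := fun ψ Y => diffBracket (X ψ) Y) (isSmoothLin_diffBracket hX)
    (fun w hw => hX.diffBracket hw) hY φ v
  have hc : IsSmoothMap (Φ := Φ) 𝒦 𝒦 (vecT E M) fun _ => (Y φ).1 := isSmoothMap_const (Y φ).2.1
  have h2 := dSec_apply hΦ (R := fun _ X => diffBracket (Y φ) X) (isSmoothLin_diffBracket hc)
    (fun w hw => hc.diffBracket hw) hX φ v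
  have h3 : (fun ψ => diffBracket (X ψ) (Y φ)) =
      fun ψ => 0 + (-1 : ℝ) • diffBracket (Y φ) (X ψ) := by
    funext ψ
    rw [diffBracket_swap, secK_neg_eq, zero_add]
  have h4 := dSec_add_smul hΦ (isSmoothMap_const (0 : VF E 𝒦).2.1) (hc.diffBracket hX) (-1) φ v
  rw [h1, h3, h4, h2, dSec_const hΦ, dSec_const hΦ, zero_add, zero_add, secK_neg_eq,
    diffBracket_swap (dSec X φ v)]

theorem IsSmoothMap.extBracket {X Y : Φ → VF E 𝒦}
    (hX : IsSmoothMap 𝒦 𝒦 (vecT E M) fun ψ => (X ψ).1)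
    (hY : IsSmoothMap 𝒦 𝒦 (vecT E M) fun ψ => (Y ψ).1) :
    IsSmoothMap 𝒦 𝒦 (vecT E M) fun ψ => (extBracket X Y ψ).1 := by
  have h := (hX.diffBracket hY).add ((isSmoothMap_dSec hΦ hY hX.vert).add
    ((isSmoothMap_dSec hΦ hX hY.vert).const_smul (-1)))
  convert h using 2 with ψ
  rw [extBracket_apply, sub_eq_add_neg, ← secK_neg_eq]
  rfl

/-- Second derivatives of X and Y in frozen directions are kept apart from the terms containing
derivatives of the vertical fields: the former cancel by `dSec_symm` in the Jacobi identity, the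
latter against what `vert_extBracket` contributes. -/
theorem dSec_antiDeriv {X Y : Φ → VF E 𝒦}
    (hX : IsSmoothMap 𝒦 𝒦 (vecT E M) fun ψ => (X ψ).1)
    (hY : IsSmoothMap 𝒦 𝒦 (vecT E M) fun ψ => (Y ψ).1) (φ : Φ) (v : Var 𝒦 ρ) :
    dSec (extBracket X Y) φ v =
      diffBracket (dSec X φ v) (Y φ) + diffBracket (X φ) (dSec Y φ v)
      + (dSec (fun ψ => dSec Y ψ (vert X φ)) φ v + dSec Y φ (dSec (vert X) φ v))
      - (dSec (fun ψ => dSec X ψ (vert Y φ)) φ v + dSec X φ (dSec (vert Y) φ v)) := by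
  have e : extBracket X Y = fun ψ => (diffBracket (X ψ) (Y ψ) + (1 : ℝ) • dSec Y ψ (vert X ψ)) +
      (-1 : ℝ) • dSec X ψ (vert Y ψ) := by
    funext ψ
    rw [extBracket_apply, secK_neg_eq, one_smul]
    abel
  have hXv := isSmoothMap_dSec hΦ hY hX.vert
  have hYv := isSmoothMap_dSec hΦ hX hY.vert
  have hB := hX.diffBracket hY
  rw [e, dSec_add_smul hΦ (hB.add (hXv.const_smul 1)) hYv, dSec_add_smul hΦ hB hXv,
    dSec_diffBracket hΦ hX hY, dSec_ddirSec hΦ hY hX.vert, dSec_ddirSec hΦ hX hY.vert,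
    secK_neg_eq, one_smul, sub_eq_add_neg]

/-- The map to vertical vector fields preserves brackets. -/
theorem vert_extBracket {X Y : Φ → VF E 𝒦} (hX : IsSmoothMap 𝒦 𝒦 (vecT E M) fun ψ => (X ψ).1)
    (hY : IsSmoothMap 𝒦 𝒦 (vecT E M) fun ψ => (Y ψ).1) (φ : Φ) :
    vert (extBracket X Y) φ = dSec (vert Y) φ (vert X φ) - dSec (vert X) φ (vert Y φ) := by
  have h := lieVar_vertAt (Y φ) (X φ) φ.1
  rw [dSec_vert hΦ hX, dSec_vert hΦ hY, vert, extBracket_apply, vertAt_add, vertAt_sub, ← h]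
  simp only [vert]
  abel

theorem extBracket_add_smul {X X' Y : Φ → VF E 𝒦}
    (hX : IsSmoothMap 𝒦 𝒦 (vecT E M) fun ψ => (X ψ).1)
    (hX' : IsSmoothMap 𝒦 𝒦 (vecT E M) fun ψ => (X' ψ).1)
    (hY : IsSmoothMap 𝒦 𝒦 (vecT E M) fun ψ => (Y ψ).1) (r : ℝ) :
    extBracket (r • X + X') Y = r • extBracket X Y + extBracket X' Y := by
  funext φ
  have h1 : dSec (r • X + X') φ (vert Y φ) = r • dSec X φ (vert Y φ) + dSec X' φ (vert Y φ) := by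
    rw [add_comm, add_comm (r • _)]
    exact dSec_add_smul hΦ hX' hX r φ _
  have h2 : vert (r • X + X') φ = r • vert X φ + vert X' φ := vertAt_add_smul _ _ _ _
  have h3 : diffBracket ((r • X + X') φ) (Y φ) =
      r • diffBracket (X φ) (Y φ) + diffBracket (X' φ) (Y φ) := by
    rw [diffBracket_swap, diffBracket_swap (X φ), diffBracket_swap (X' φ)]
    change -diffBracket (Y φ) (r • X φ + X' φ) = _
    rw [diffBracket_add_smul_right]
    module
  change _ = r • extBracket X Y φ + extBracket X' Y φ
  simp only [extBracket_apply, h1, h2, h3, dSec_lin hΦ hY]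
  module

/-- The Jacobi identity for the extended bracket. -/
theorem extBracket_jacobi {X Y Z : Φ → VF E 𝒦}
    (hX : IsSmoothMap 𝒦 𝒦 (vecT E M) fun ψ => (X ψ).1)
    (hY : IsSmoothMap 𝒦 𝒦 (vecT E M) fun ψ => (Y ψ).1)
    (hZ : IsSmoothMap 𝒦 𝒦 (vecT E M) fun ψ => (Z ψ).1) :
    extBracket X (extBracket Y Z) + extBracket Y (extBracket Z X)
      + extBracket Z (extBracket X Y) = 0 := by
  -- Complete expansion of one summand of the Jacobi identity; the last line uses {Y, Z}^v = [Y^v,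
  -- Z^v] for the derivative of X along {Y, Z}^v.
  have key : ∀ {X Y Z : Φ → VF E 𝒦}, IsSmoothMap 𝒦 𝒦 (vecT E M) (fun ψ => (X ψ).1) →
      IsSmoothMap 𝒦 𝒦 (vecT E M) (fun ψ => (Y ψ).1) →
      IsSmoothMap 𝒦 𝒦 (vecT E M) (fun ψ => (Z ψ).1) → ∀ φ, extBracket X (extBracket Y Z) φ =
      diffBracket (X φ) (diffBracket (Y φ) (Z φ))
      + (diffBracket (X φ) (dSec Z φ (vert Y φ)) - diffBracket (X φ) (dSec Y φ (vert Z φ)))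
      - diffBracket (Z φ) (dSec Y φ (vert X φ)) + diffBracket (Y φ) (dSec Z φ (vert X φ))
      + (dSec (fun ψ => dSec Z ψ (vert Y φ)) φ (vert X φ) + dSec Z φ (dSec (vert Y) φ (vert X φ)))
      - (dSec (fun ψ => dSec Y ψ (vert Z φ)) φ (vert X φ) + dSec Y φ (dSec (vert Z) φ (vert X φ)))
      - (dSec X φ (dSec (vert Z) φ (vert Y φ)) - dSec X φ (dSec (vert Y) φ (vert Z φ))) := by
    intro X Y Z hX hY hZ φ
    rw [extBracket_apply X, dSec_antiDeriv hΦ hY hZ, vert_extBracket hΦ hY hZ, dSec_sub_right hΦ hX,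
      extBracket_apply Y, diffBracket_add_right, diffBracket_sub_right,
      diffBracket_swap (dSec Y φ (vert X φ))]
    abel
  funext φ
  have h := diffBracket_jacobi (X φ) (Y φ) (Z φ)
  -- Once three second derivatives are swapped by symmetry, all terms with derivatives of parameters
  -- cancel, leaving the Jacobi identity of `diffBracket`.
  rw [Pi.add_apply, Pi.add_apply, key hX hY hZ, key hY hZ hX, key hZ hX hY,
    dSec_symm hΦ hZ φ (vert X φ) (vert Y φ), dSec_symm hΦ hX φ (vert Y φ) (vert Z φ),
    dSec_symm hΦ hY φ (vert Z φ) (vert X φ), Pi.zero_apply, ← h]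
  abel

end ExtendedBracket

/-! ### Form-valued maps on field space and the interchange of derivatives. -/

section SmoothMaps

variable {E : Type*} [NormedAddCommGroup E] [NormedSpace ℝ E] [FiniteDimensional ℝ E]
  {M : Type*} [TopologicalSpace M] [ChartedSpace E M] [IsManifold 𝓘(ℝ, E) ∞ M]
  {F : Type*} [NormedAddCommGroup F] [NormedSpace ℝ F] [FiniteDimensional ℝ F]
  {F' : Type*} [NormedAddCommGroup F'] [NormedSpace ℝ F'] [FiniteDimensional ℝ F']
  {W : Type*} [NormedAddCommGroup W] [NormedSpace ℝ W]
  {𝒦 𝒦' : SupportFamily M} {ρ : TensorType E F} {Φ : Set (Fld M ρ)}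
  {T₁ : Transition M F'} {T : Transition M W} {k : ℕ}

theorem raw_sub_eq (s t : M → W) : s - t = s + (-1 : ℝ) • t := by
  funext x
  exact (sub_eq_add_neg _ _).trans (congrArg _ (neg_one_smul ℝ (t x)).symm)

theorem Plot.sub {P : Type*} [NormedAddCommGroup P] [NormedSpace ℝ P] {s t : P → M → W}
    (h : Plot E 𝒦 T s) (h' : Plot E 𝒦 T t) : Plot E 𝒦 T fun p => s p - t p := by
  simp only [raw_sub_eq]
  exact h.lin (-1) h'

theorem IsSmoothMap.sub {R S : Φ → M → W} (h : IsSmoothMap 𝒦 𝒦' T R) (h' : IsSmoothMap 𝒦 𝒦' T S) :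
    IsSmoothMap 𝒦 𝒦' T (fun φ => R φ - S φ) := fun P _ _ _ c hc => (h P c hc).sub (h' P c hc)

theorem ddirSec_sub [NormalizedTransition T] (hΦ : IsOpenFld 𝒦 Φ) {R S : Φ → M → W}
    (hR : IsSmoothMap 𝒦 𝒦' T R) (hS : IsSmoothMap 𝒦 𝒦' T S) (φ : Φ) (v : Var 𝒦 ρ) :
    ddirSec (fun ψ => R ψ - S ψ) φ v = ddirSec R φ v - ddirSec S φ v := by
  simp only [raw_sub_eq]
  rw [ddirSec_add hΦ hR (hS.const_smul (-1)), ddirSec_smul hΦ hS]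

theorem IsSmoothLin.add {R S : Φ → SecK E 𝒦 T₁ → M → W} (hR : IsSmoothLin 𝒦 T₁ T R)
    (hS : IsSmoothLin 𝒦 T₁ T S) : IsSmoothLin 𝒦 T₁ T fun ψ v => R ψ v + S ψ v where
  lin ψ r v w := by rw [hR.lin, hS.lin]; module
  smooth P _ _ _ c w hc hw := (hR.smooth P c w hc hw).add (hS.smooth P c w hc hw)

theorem IsSmoothLin.sub {R S : Φ → SecK E 𝒦 T₁ → M → W} (hR : IsSmoothLin 𝒦 T₁ T R)
    (hS : IsSmoothLin 𝒦 T₁ T S) : IsSmoothLin 𝒦 T₁ T fun ψ v => R ψ v - S ψ v where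
  lin ψ r v w := by rw [hR.lin, hS.lin]; module
  smooth P _ _ _ c w hc hw := (hR.smooth P c w hc hw).sub (hS.smooth P c w hc hw)

theorem IsSmoothLin.vertAt {R : Φ → Var 𝒦 ρ → M → W} (hR : IsSmoothLin 𝒦 (fieldT M ρ) T R) :
    IsSmoothLin 𝒦 (vecT E M) T fun ψ X => R ψ (vertAt X ψ.1) where
  lin ψ r v w := by rw [vertAt_add_smul, hR.lin]
  smooth P _ _ _ c X hc hX := hR.smooth P c _ hc (by
    simp only [vertAt_coe]
    exact hX.lieDeriv ρ (fun p => (X p).2) hc.toUniv)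

theorem IsSmoothLin.extD {R : Φ → SecK E 𝒦 T₁ → RawForm E M k}
    (hR : IsSmoothLin 𝒦 T₁ (formT E M k) R) :
    IsSmoothLin 𝒦 T₁ (formT E M (k + 1)) fun ψ v => extD (R ψ v) where
  lin ψ r v w := by
    rw [hR.lin, extD_add (Submodule.smul_mem _ _ (hR.mem ψ v)) (hR.mem ψ w), extD_smul]
  smooth P _ _ _ c w hc hw := (hR.smooth P c w hc hw).extD_family

theorem IsSmoothLin.iota {R : Φ → SecK E 𝒦 T₁ → RawForm E M (k + 1)}
    (hR : IsSmoothLin 𝒦 T₁ (formT E M (k + 1)) R) {X : Φ → VF E 𝒦}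
    (hX : IsSmoothMap 𝒦 𝒦 (vecT E M) fun ψ => (X ψ).1) :
    IsSmoothLin 𝒦 T₁ (formT E M k) fun ψ v => iota (X ψ).1 (R ψ v) where
  lin ψ r v w := by rw [hR.lin, iota_add_right, iota_smul_right]
  smooth P _ _ _ c w hc hw := (hX P c hc).toUniv.iota_family (hR.smooth P c w hc hw)

theorem isSmoothLin_iota {η : Φ → RawForm E M (k + 1)}
    (hη : IsSmoothMap 𝒦 (.univ M) (formT E M (k + 1)) η) :
    IsSmoothLin 𝒦 (vecT E M) (formT E M k) fun ψ X => iota X.1 (η ψ) where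
  lin ψ r v w := by
    change CovPhaseSpace.iota (r • v.1 + w.1) _ = _
    rw [iota_add_left, iota_smul_left]
  smooth P _ _ _ c _ hc hX := hX.toUniv.iota_family (hη P c hc)

theorem IsSmoothMap.extD {η : Φ → RawForm E M k} (hη : IsSmoothMap 𝒦 (.univ M) (formT E M k) η) :
    IsSmoothMap 𝒦 (.univ M) (formT E M (k + 1)) fun ψ => extD (η ψ) :=
  fun P _ _ _ c hc => (hη P c hc).extD_family

theorem IsSmoothMap.iota {η : Φ → RawForm E M (k + 1)} {X : Φ → VF E 𝒦}
    (hX : IsSmoothMap 𝒦 𝒦 (vecT E M) fun ψ => (X ψ).1)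
    (hη : IsSmoothMap 𝒦 (.univ M) (formT E M (k + 1)) η) :
    IsSmoothMap 𝒦 (.univ M) (formT E M k) fun ψ => iota (X ψ).1 (η ψ) :=
  fun P _ _ _ c hc => (hX P c hc).toUniv.iota_family (hη P c hc)

variable (hΦ : IsOpenFld 𝒦 Φ)
include hΦ

theorem ddirSec_extD {η : Φ → RawForm E M k} (hη : IsSmoothMap 𝒦 (.univ M) (formT E M k) η)
    (φ : Φ) (v : Var 𝒦 ρ) : ddirSec (fun ψ => extD (η ψ)) φ v = extD (ddirSec η φ v) :=
  ddirSec_map (T := formT E M k) (T' := formT E M (k + 1)) hΦ hη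
    (fun s hs t ht r => by rw [extD_add hs (Submodule.smul_mem _ _ ht), extD_smul])
    (fun s hs => hs.extD_family) φ v

theorem ddirSec_iota {η : Φ → RawForm E M (k + 1)} {X : Φ → VF E 𝒦}
    (hX : IsSmoothMap 𝒦 𝒦 (vecT E M) fun ψ => (X ψ).1)
    (hη : IsSmoothMap 𝒦 (.univ M) (formT E M (k + 1)) η) (φ : Φ) (v : Var 𝒦 ρ) :
    ddirSec (fun ψ => iota (X ψ).1 (η ψ)) φ v =
      iota (X φ).1 (ddirSec η φ v) + iota (dSec X φ v).1 (η φ) := by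
  rw [(isSmoothLin_iota hη).ddirSec_apply hΦ hX,
    ddirSec_map (T := formT E M (k + 1)) (T' := formT E M k) hΦ hη
      (A := CovPhaseSpace.iota (X φ).1)
      (fun s _ t _ r => by rw [iota_add_right, iota_smul_right])
      (fun s hs => Plot.iota_family (.const (X φ).2.1) hs) φ v]
  rfl

theorem ddirSec_lieForm {η : Φ → RawForm E M (k + 1)} (X : VF E 𝒦)
    (hη : IsSmoothMap 𝒦 (.univ M) (formT E M (k + 1)) η) (φ : Φ) (v : Var 𝒦 ρ) :
    ddirSec (fun ψ => lieForm X.1 (η ψ)) φ v = lieForm X.1 (ddirSec η φ v) :=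
  ddirSec_map (T := formT E M (k + 1)) (T' := formT E M (k + 1)) hΦ hη
    (fun s hs t ht r => by
      rw [lieForm_add_right X.2.1 hs (Submodule.smul_mem _ _ ht), lieForm_smul_right])
    (fun s hs => Plot.lieForm_family (.const X.2.1) hs) φ v

/-- Hadamard's lemma for families of forms replaces differentiation under the integral: the integral
of the remainder is smooth, hence continuous, in t. -/
theorem ddir_chainIntegral (S : Chain E M k) {η : Φ → RawForm E M k}
    (hη : IsSmoothMap 𝒦 (.univ M) (formT E M k) η) (φ : Φ) (v : Var 𝒦 ρ) :
    ddir (fun ψ => chainIntegral S (η ψ)) φ v = chainIntegral S (ddirSec η φ v) := by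
  obtain ⟨c, hc, hcv, hc0⟩ := exists_curve hΦ φ v
  obtain ⟨s, hs, hsK, hsw, hs0⟩ := (hη ℝ c hc).exists_hadamard
  have h0 : ddirSec η φ v = s 0 := by rw [ddirSec_eq_deriv hcv, hs0]
  rw [h0, ddir_eq_deriv hcv]
  have h1 : ∀ᶠ t in 𝓝 (0 : ℝ), chainIntegral S (η (c t)) =
      chainIntegral S (η φ) + t • chainIntegral S (s t) := by
    filter_upwards [hsw] with t ht
    rw [ht, hc0, chainIntegral_add S (hη.mem φ) (Submodule.smul_mem _ _ (hsK t).1),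
      chainIntegral_smul, smul_eq_mul]
  have h2 := hasDerivAt_of_hadamard h1 (hasDerivAt_const (0 : ℝ) _)
    (contDiff_chainIntegral S hs).continuous.continuousAt
  rw [h2.deriv, zero_add]

theorem contDiff_chainIntegral_of_isSmoothMap (S : Chain E M k) {η : Φ → RawForm E M k}
    (hη : IsSmoothMap 𝒦 (.univ M) (formT E M k) η) :
    SmoothOn 𝒦 fun ψ => chainIntegral S (η ψ) := fun _ _ hc =>
  contDiff_chainIntegral S (hη _ _ (isPlot_iff.1 hc))

/-- On an equivariant form the Lie derivatives satisfy the commutation relation of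
the vector fields. -/
theorem lieForm_commutator {η : Φ → RawForm E M (k + 1)}
    (hη : IsSmoothMap 𝒦 (.univ M) (formT E M (k + 1)) η)
    (h : ∀ (X : VF E 𝒦) (φ : Φ), ddirSec η φ (CovPhaseSpace.vertAt X φ.1) = lieForm X.1 (η φ))
    (X Y : VF E 𝒦) (φ : Φ) :
    lieForm X.1 (lieForm Y.1 (η φ)) - lieForm Y.1 (lieForm X.1 (η φ)) =
      lieForm (diffBracket Y X).1 (η φ) := by
  -- Equivariance, L_X η = Dη(X^v), is differentiated along Y^v. In the commutator the second
  -- derivatives of η cancel, and the remaining term is governed by the commutator on fields.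
  have key : ∀ X Y : VF E 𝒦, lieForm X.1 (lieForm Y.1 (η φ)) =
      ddirSec (fun ψ => ddirSec η ψ (CovPhaseSpace.vertAt X φ.1)) φ (CovPhaseSpace.vertAt Y φ.1) +
        ddirSec η φ (lieVar X (CovPhaseSpace.vertAt Y φ.1)) := by
    intro X Y
    have h1 := (hη.ddirSec hΦ).ddirSec_apply hΦ
      (IsSmoothMap.vert (X := fun _ : Φ => X) (isSmoothMap_const X.2.1)) φ
      (CovPhaseSpace.vertAt Y φ.1)
    have h2 := dSec_vertAt hΦ X φ (CovPhaseSpace.vertAt Y φ.1)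
    simp only [CovPhaseSpace.vert, h] at h1
    rw [ddirSec_lieForm hΦ X hη, h] at h1
    rw [h1, ← h2]
    rfl
  rw [key, key, ddirSec_symm hΦ hη φ (CovPhaseSpace.vertAt Y φ.1), add_sub_add_left_eq_sub,
    ← (hη.ddirSec hΦ).map_sub, lieVar_vertAt, h]

end SmoothMaps

/-! ### Noether current, presymplectic current and anomaly. -/

namespace LagrangianData

variable {E : Type*} [NormedAddCommGroup E] [NormedSpace ℝ E] [FiniteDimensional ℝ E]
  {M : Type*} [TopologicalSpace M] [ChartedSpace E M] [IsManifold 𝓘(ℝ, E) ∞ M]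
  {F : Type*} [NormedAddCommGroup F] [NormedSpace ℝ F] [FiniteDimensional ℝ F]
  {𝒦 : SupportFamily M} {ρ : TensorType E F} {m : ℕ}
  {𝒯 : LagrangianData 𝒦 ρ m}

/-- The derivative of `θ(w)` along `v`. -/
def dTheta (𝒯 : LagrangianData 𝒦 ρ m) (φ : 𝒯.Φ) (v w : Var 𝒦 ρ) : RawForm E M (m + 1) :=
  ddirSec (fun ψ => (𝒯.θ ψ w).1) φ v

theorem Theta_eq (φ : 𝒯.Φ) (v w : Var 𝒦 ρ) :
    𝒯.Theta φ v w = 𝒯.dTheta φ v w - 𝒯.dTheta φ w v := rfl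

theorem Theta_swap (φ : 𝒯.Φ) (v w : Var 𝒦 ρ) : 𝒯.Theta φ v w = -𝒯.Theta φ w v := by
  rw [Theta_eq, Theta_eq, neg_sub]

section

variable (h𝒯 : 𝒯.IsCovariant)
include h𝒯

theorem isSmoothMap_L : IsSmoothMap 𝒦 (.univ M) (formT E M (m + 2)) fun ψ => (𝒯.L ψ).1 :=
  isSmoothMap_of_fin fun k c hc => smoothFamily_iff_plot.1 (h𝒯.smooth_L k c hc)

theorem isSmoothMap_ℓ : IsSmoothMap 𝒦 (.univ M) (formT E M (m + 1)) fun ψ => (𝒯.ℓ ψ).1 :=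
  isSmoothMap_of_fin fun k c hc => smoothFamily_iff_plot.1 (h𝒯.smooth_ℓ k c hc)

theorem isSmoothLin_θ :
    IsSmoothLin 𝒦 (fieldT M ρ) (formT E M (m + 1)) fun ψ v => (𝒯.θ ψ v).1 where
  lin ψ r v w := by rw [map_add, map_smul]; rfl
  smooth _ _ _ _ _ _ hc hw := Plot.ofFin fun k e => smoothFamily_iff_plot.1
    (h𝒯.smooth_θ k _ _ (isPlot_iff.2 (hc.comp e.contDiff)) (isPlot_iff.2 (hw.comp e.contDiff)))

theorem isSmoothLin_γ : IsSmoothLin 𝒦 (vecT E M) (formT E M m) fun ψ X => (𝒯.γ ψ X).1 where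
  lin ψ r v w := by rw [map_add, map_smul]; rfl
  smooth _ _ _ _ _ _ hc hw := Plot.ofFin fun k e => smoothFamily_iff_plot.1
    (h𝒯.smooth_γ k _ _ (isPlot_iff.2 (hc.comp e.contDiff)) (isPlot_iff.2 (hw.comp e.contDiff)))

theorem isSmoothLin_eom :
    IsSmoothLin 𝒦 (fieldT M ρ) (formT E M (m + 2)) fun ψ v => 𝒯.eom ψ v :=
  ((isSmoothMap_L h𝒯).ddirSec h𝒯.isOpen).sub (isSmoothLin_θ h𝒯).extD

/-- In `dTheta` the second variation is held constant while θ is differentiated; so `w` is frozen at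
the base point, and the version of `plot_ddirSec` with a parameter is needed. -/
theorem isSmoothLin_dTheta_left {w : 𝒯.Φ → Var 𝒦 ρ}
    (hw : IsSmoothMap 𝒦 𝒦 (fieldT M ρ) fun ψ => (w ψ).1) :
    IsSmoothLin 𝒦 (fieldT M ρ) (formT E M (m + 1)) fun ψ v => 𝒯.dTheta ψ v (w ψ) where
  lin ψ r v v' := (((isSmoothLin_θ h𝒯).apply_const (w ψ)).ddirSec h𝒯.isOpen).lin ψ r v v'
  smooth P _ _ _ c _ hc hv := (plot_ddirSec h𝒯.isOpen (R := fun p ψ => (𝒯.θ ψ (w (c p))).1)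
    (fun _ hc' => (isSmoothLin_θ h𝒯).smooth _ _ _ hc'
      (Plot.comp (r := Prod.fst) (hw P c hc) contDiff_fst)) hc hv).1

theorem isSmoothLin_dTheta_right {v : 𝒯.Φ → Var 𝒦 ρ}
    (hv : IsSmoothMap 𝒦 𝒦 (fieldT M ρ) fun ψ => (v ψ).1) :
    IsSmoothLin 𝒦 (fieldT M ρ) (formT E M (m + 1)) fun ψ w => 𝒯.dTheta ψ (v ψ) w where
  lin ψ r w w' := by
    have hs := fun u => (isSmoothLin_θ h𝒯).apply_const u
    have : (fun ψ => (𝒯.θ ψ (r • w + w')).1) = fun ψ => r • (𝒯.θ ψ w).1 + (𝒯.θ ψ w').1 :=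
      funext fun ψ => (isSmoothLin_θ h𝒯).lin ψ r w w'
    rw [dTheta, this, ddirSec_add h𝒯.isOpen ((hs w).const_smul r) (hs w'),
      ddirSec_smul h𝒯.isOpen (hs w)]
    rfl
  smooth P _ _ _ c w hc hw := (plot_ddirSec h𝒯.isOpen (R := fun p ψ => (𝒯.θ ψ (w p)).1)
    (fun _ hc' => (isSmoothLin_θ h𝒯).smooth _ _ _ hc'
      (Plot.comp (r := Prod.fst) hw contDiff_fst)) hc (hv P c hc)).1

theorem isSmoothLin_Theta {w : 𝒯.Φ → Var 𝒦 ρ}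
    (hw : IsSmoothMap 𝒦 𝒦 (fieldT M ρ) fun ψ => (w ψ).1) :
    IsSmoothLin 𝒦 (fieldT M ρ) (formT E M (m + 1)) fun ψ v => 𝒯.Theta ψ v (w ψ) :=
  (isSmoothLin_dTheta_left h𝒯 hw).sub (isSmoothLin_dTheta_right h𝒯 hw)

theorem isSmoothLin_Theta_const (w : Var 𝒦 ρ) :
    IsSmoothLin 𝒦 (fieldT M ρ) (formT E M (m + 1)) fun ψ v => 𝒯.Theta ψ v w :=
  isSmoothLin_Theta h𝒯 (w := fun _ => w) (isSmoothMap_const w.2.1)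

theorem isSmoothLin_Theta_right {v : 𝒯.Φ → Var 𝒦 ρ}
    (hv : IsSmoothMap 𝒦 𝒦 (fieldT M ρ) fun ψ => (v ψ).1) :
    IsSmoothLin 𝒦 (fieldT M ρ) (formT E M (m + 1)) fun ψ w => 𝒯.Theta ψ (v ψ) w :=
  (isSmoothLin_dTheta_right h𝒯 hv).sub (isSmoothLin_dTheta_left h𝒯 hv)

theorem theta'_vertAt (X : VF E 𝒦) (φ : 𝒯.Φ) :
    𝒯.theta' φ (vertAt X φ.1) = (𝒯.θ φ (vertAt X φ.1)).1 + lieForm X.1 (𝒯.ℓ φ).1 := by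
  rw [theta', h𝒯.covariant_ℓ]

/-- The boundary Lagrangian drops out: by covariance dℓ(X^v) = L_X ℓ, which `beta` subtracts again.
-/
theorem current_eq (X : VF E 𝒦) (φ : 𝒯.Φ) : 𝒯.current X φ =
    (𝒯.θ φ (vertAt X φ.1)).1 - iota X.1 (𝒯.L φ).1 - extD (𝒯.γ φ X).1 := by
  rw [current, theta'_vertAt h𝒯, beta]
  abel

theorem isSmoothLin_current :
    IsSmoothLin 𝒦 (vecT E M) (formT E M (m + 1)) fun ψ X => 𝒯.current X ψ := by
  simp only [current_eq h𝒯]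
  exact ((isSmoothLin_θ h𝒯).vertAt.sub (isSmoothLin_iota (isSmoothMap_L h𝒯))).sub
    (isSmoothLin_γ h𝒯).extD

theorem covariant_dTheta (X : VF E 𝒦) (φ : 𝒯.Φ) (v : Var 𝒦 ρ) :
    𝒯.dTheta φ (vertAt X φ.1) v = lieForm X.1 (𝒯.θ φ v).1 - (𝒯.θ φ (lieVar X v)).1 :=
  eq_sub_of_add_eq (h𝒯.covariant_θ X φ v)

/-- The derivative of the Noether current. -/
theorem ddirSec_current {X : 𝒯.Φ → VF E 𝒦}
    (hX : IsSmoothMap 𝒦 𝒦 (vecT E M) fun ψ => (X ψ).1) (φ : 𝒯.Φ) (v : Var 𝒦 ρ) :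
    ddirSec (fun ψ => 𝒯.current (X ψ) ψ) φ v =
      -𝒯.Theta φ (vert X φ) v + 𝒯.current (dSec X φ v) φ
      + extD (iota (X φ).1 (𝒯.θ φ v).1 - ddirSec (fun ψ => (𝒯.γ ψ (X ψ)).1) φ v
        + (𝒯.γ φ (dSec X φ v)).1) - iota (X φ).1 (𝒯.eom φ v) := by
  have hθ := (isSmoothLin_θ h𝒯).apply hX.vert
  have hι := hX.iota (isSmoothMap_L h𝒯)
  have hγ := (isSmoothLin_γ h𝒯).apply hX
  have h1 := (isSmoothLin_θ h𝒯).ddirSec_apply h𝒯.isOpen hX.vert φ v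
  have h2 := ddirSec_iota h𝒯.isOpen hX (isSmoothMap_L h𝒯) φ v
  have h3 := ddirSec_extD h𝒯.isOpen hγ φ v
  have h4 : toSecK E 𝒦 (fieldT M ρ) (ddirSec (fun ψ => (vert X ψ).1) φ v) =
    vertAt (dSec X φ v) φ.1 + lieVar (X φ) v := dSec_vert h𝒯.isOpen hX φ v
  rw [h4, (isSmoothLin_θ h𝒯).map_add] at h1
  -- The derivative along v is traded for one along X^v, at the price of Θ; covariance of θ then
  -- evaluates the latter. The resulting -θ(L_X v) cancels against the derivative of the vertical
  -- field, and ι_X dθ(v) against the corresponding part of ι_X dL(v).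
  have h5 : ddirSec (fun ψ => (𝒯.θ ψ (vert X φ)).1) φ v =
      𝒯.dTheta φ (vert X φ) v - 𝒯.Theta φ (vert X φ) v := by
    rw [Theta_eq, sub_sub_cancel]; rfl
  have h6 : 𝒯.dTheta φ (vert X φ) v = _ := covariant_dTheta h𝒯 (X φ) φ v
  have h7 : ddirSec (fun ψ => (𝒯.L ψ).1) φ v = 𝒯.eom φ v + extD (𝒯.θ φ v).1 :=
    (sub_add_cancel _ _).symm
  have m1 := iota_mem (X φ).2.1 (𝒯.θ φ v).2
  have m2 := ((hγ.ddirSec h𝒯.isOpen).mem φ v)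
  have m3 := (𝒯.γ φ (dSec X φ v)).2
  simp only [current_eq h𝒯]
  refine (ddirSec_sub h𝒯.isOpen (hθ.sub hι) hγ.extD φ v).trans ?_
  rw [ddirSec_sub h𝒯.isOpen hθ hι]
  refine (congrArg₂ _ (congrArg₂ _ h1 h2) h3).trans ?_
  rw [h5, h6, h7, iota_add_right, extD_add (Submodule.sub_mem _ m1 m2) m3, extD_sub m1 m2, lieForm]
  abel

/-- Covariance of θ in both slots; the two terms θ(L_X Y^v) and θ(L_Y X^v) combine through the
commutator of Lie derivatives on fields. -/
theorem Theta_vertAt (X Y : VF E 𝒦) (φ : 𝒯.Φ) :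
    𝒯.Theta φ (vertAt X φ.1) (vertAt Y φ.1) =
      lieForm X.1 (𝒯.θ φ (vertAt Y φ.1)).1 - lieForm Y.1 (𝒯.θ φ (vertAt X φ.1)).1
      + (𝒯.θ φ (vertAt (diffBracket X Y) φ.1)).1 := by
  rw [Theta_eq, covariant_dTheta h𝒯, covariant_dTheta h𝒯, ← lieVar_vertAt Y X φ.1,
    (isSmoothLin_θ h𝒯).map_sub]
  abel

theorem lieForm_commutator_ℓ (X Y : VF E 𝒦) (φ : 𝒯.Φ) :
    lieForm X.1 (lieForm Y.1 (𝒯.ℓ φ).1) - lieForm Y.1 (lieForm X.1 (𝒯.ℓ φ).1) =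
      lieForm (diffBracket Y X).1 (𝒯.ℓ φ).1 :=
  lieForm_commutator h𝒯.isOpen (isSmoothMap_ℓ h𝒯) h𝒯.covariant_ℓ X Y φ

theorem lieForm_commutator_L (X Y : VF E 𝒦) (φ : 𝒯.Φ) :
    lieForm X.1 (lieForm Y.1 (𝒯.L φ).1) - lieForm Y.1 (lieForm X.1 (𝒯.L φ).1) =
      lieForm (diffBracket Y X).1 (𝒯.L φ).1 :=
  lieForm_commutator h𝒯.isOpen (isSmoothMap_L h𝒯) h𝒯.covariant_L X Y φ

/-- The anomaly in terms of the presymplectic current and the Noether current. -/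
theorem anomaly_eq (X Y : VF E 𝒦) (φ : 𝒯.Φ) : 𝒯.anomaly X Y φ =
    𝒯.Theta φ (vertAt X φ.1) (vertAt Y φ.1) - 𝒯.current (diffBracket X Y) φ
      - extD (𝒯.γ φ (diffBracket X Y)).1 - iota Y.1 (𝒯.eom φ (vertAt X φ.1))
      + iota X.1 (𝒯.eom φ (vertAt Y φ.1)) := by
  have hθ := fun Z : VF E 𝒦 => (𝒯.θ φ (vertAt Z φ.1)).2
  have hl := fun Z : VF E 𝒦 => lieForm_mem Z.2.1 (𝒯.ℓ φ).2
  -- With this commutator the contributions of ℓ to θ' and to β cancel.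
  have h := lieForm_commutator_ℓ h𝒯 Y X φ
  rw [anomaly, theta'_vertAt h𝒯, theta'_vertAt h𝒯, lieForm_add_right Y.2.1 (hθ X) (hl X),
    lieForm_add_right X.2.1 (hθ Y) (hl Y), Theta_vertAt h𝒯, current_eq h𝒯, beta, ← h]
  abel

theorem anomaly_mem (X Y : VF E 𝒦) (φ : 𝒯.Φ) : 𝒯.anomaly X Y φ ∈ Sec E (formT E M (m + 1)) := by
  rw [anomaly_eq h𝒯]
  have he := fun v => (isSmoothLin_eom h𝒯).mem φ v
  exact Submodule.add_mem _ (Submodule.sub_mem _ (Submodule.sub_mem _ (Submodule.sub_mem _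
    ((isSmoothLin_Theta_const h𝒯 _).mem φ _) ((isSmoothLin_current h𝒯).mem φ _))
    (extD_mem (𝒯.γ φ _).2)) (iota_mem Y.2.1 (he _))) (iota_mem X.2.1 (he _))

theorem anomaly_swap (X Y : VF E 𝒦) (φ : 𝒯.Φ) : 𝒯.anomaly X Y φ = -𝒯.anomaly Y X φ := by
  rw [anomaly_eq h𝒯, anomaly_eq h𝒯, Theta_swap, diffBracket_swap, (isSmoothLin_current h𝒯).map_neg,
    (isSmoothLin_γ h𝒯).extD.map_neg]
  abel

theorem anomaly_add_smul (X X' Y : VF E 𝒦) (r : ℝ) (φ : 𝒯.Φ) :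
    𝒯.anomaly (r • X + X') Y φ = r • 𝒯.anomaly X Y φ + 𝒯.anomaly X' Y φ := by
  have h1 : diffBracket (r • X + X') Y = r • diffBracket X Y + diffBracket X' Y := by
    rw [diffBracket_swap, diffBracket_add_smul_right, diffBracket_swap X, diffBracket_swap X']
    module
  have h2 : iota (r • X + X').1 (𝒯.eom φ (vertAt Y φ.1)) =
      r • iota X.1 (𝒯.eom φ (vertAt Y φ.1)) + iota X'.1 (𝒯.eom φ (vertAt Y φ.1)) :=
    (isSmoothLin_iota ((isSmoothLin_eom h𝒯).apply_const (vertAt Y φ.1))).lin φ r X X'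
  have h3 := (isSmoothLin_γ h𝒯).extD.lin φ r (diffBracket X Y) (diffBracket X' Y)
  simp only [anomaly_eq h𝒯, h1, h2, h3, vertAt_add_smul, (isSmoothLin_current h𝒯).lin,
    (isSmoothLin_Theta_const h𝒯 _).lin, (isSmoothLin_eom h𝒯).lin, iota_add_right, iota_smul_right]
  module

theorem extD_theta'_vertAt (X : VF E 𝒦) (φ : 𝒯.Φ) : extD (𝒯.theta' φ (vertAt X φ.1)) =
    lieForm X.1 (𝒯.L φ).1 - 𝒯.eom φ (vertAt X φ.1) + extD (lieForm X.1 (𝒯.ℓ φ).1) := by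
  rw [theta'_vertAt h𝒯, extD_add (𝒯.θ φ _).2 (lieForm_mem X.2.1 (𝒯.ℓ φ).2), eom, h𝒯.covariant_L]
  abel

theorem theta'_mem (φ : 𝒯.Φ) (v : Var 𝒦 ρ) : 𝒯.theta' φ v ∈ Sec E (formT E M (m + 1)) :=
  Submodule.add_mem _ (𝒯.θ φ v).2 (((isSmoothMap_ℓ h𝒯).ddirSec h𝒯.isOpen).mem φ v)

/-- Top forms are closed. -/
theorem extD_iota_top (hdim : Module.finrank ℝ E = m + 2) (X : VF E 𝒦) (η : RawForm E M (m + 2)) :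
    extD (iota X.1 η) = lieForm X.1 η := by
  have h : extD η = 0 := form_eq_zero_of_finrank_lt (by omega) _
  rw [lieForm, h, iota_zero_right, add_zero]

/-- On top forms d ι_X = L_X. The field equations in dθ' therefore cancel against those put into the
anomaly by hand, while the terms in L and ℓ cancel against dβ by their commutator relations. -/
theorem extD_anomaly (hdim : Module.finrank ℝ E = m + 2) (X Y : VF E 𝒦) (φ : 𝒯.Φ) :
    extD (𝒯.anomaly X Y φ) = 0 := by
  have hθ := fun Z => theta'_mem h𝒯 φ (vertAt Z φ.1)
  have he := fun Z => (isSmoothLin_eom h𝒯).mem φ (vertAt Z φ.1)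
  have hl := fun Z : VF E 𝒦 => lieForm_mem Z.2.1 (𝒯.ℓ φ).2
  have hL := fun Z : VF E 𝒦 => lieForm_mem Z.2.1 (𝒯.L φ).2
  have key : ∀ X Y : VF E 𝒦, extD (lieForm Y.1 (𝒯.theta' φ (vertAt X φ.1))) =
      lieForm Y.1 (lieForm X.1 (𝒯.L φ).1) - lieForm Y.1 (𝒯.eom φ (vertAt X φ.1)) +
        extD (lieForm Y.1 (lieForm X.1 (𝒯.ℓ φ).1)) := by
    intro X Y
    rw [extD_lieForm Y.2.1 (hθ X), extD_theta'_vertAt h𝒯,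
      lieForm_add_right Y.2.1 (Submodule.sub_mem _ (hL X) (he X)) (extD_mem (hl X)),
      lieForm_sub_right Y.2.1 (hL X) (he X), extD_lieForm Y.2.1 (hl X)]
  have hβ : extD (𝒯.beta (diffBracket X Y) φ) = lieForm (diffBracket X Y).1 (𝒯.L φ).1 +
      extD (lieForm (diffBracket X Y).1 (𝒯.ℓ φ).1) := by
    rw [beta, extD_add (iota_mem (diffBracket X Y).2.1 (𝒯.L φ).2) (hl _), extD_iota_top h𝒯 hdim]
  have m1 := lieForm_mem Y.2.1 (hθ X)
  have m2 := lieForm_mem X.2.1 (hθ Y)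
  have m3 : 𝒯.beta (diffBracket X Y) φ ∈ Sec E (formT E M (m + 1)) :=
    Submodule.add_mem _ (iota_mem (diffBracket X Y).2.1 (𝒯.L φ).2) (hl _)
  have m4 := iota_mem Y.2.1 (he X)
  have m5 := iota_mem X.2.1 (he Y)
  have m12 := Submodule.sub_mem _ m1 m2
  have m123 := Submodule.sub_mem _ m12 m3
  have m1234 := Submodule.add_mem _ m123 m4
  rw [anomaly, extD_neg, extD_sub m1234 m5, extD_add m123 m4, extD_sub m12 m3, extD_sub m1 m2,
    key, key, hβ, extD_iota_top h𝒯 hdim, extD_iota_top h𝒯 hdim,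
    ← lieForm_commutator_L h𝒯 Y X, ← lieForm_commutator_ℓ h𝒯 Y X,
    extD_sub (lieForm_mem Y.2.1 (hl X)) (lieForm_mem X.2.1 (hl Y))]
  abel

end

end LagrangianData

/-! ### Abstract central extension by a 2-cocycle. -/

section CentralExtension

universe u v

/-- The Lie ring with a given bilinear bracket. -/
abbrev lieRingOfBracket {L : Type*} [AddCommGroup L] [Module ℝ L] (br : L →ₗ[ℝ] L →ₗ[ℝ] L)
    (h0 : ∀ x, br x x = 0)
    (hJ : ∀ x y z, br x (br y z) + br y (br z x) + br z (br x y) = 0) : LieRing L where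
  bracket x y := br x y
  add_lie x y z := by simp
  lie_add x y z := by simp
  lie_self := h0
  leibniz_lie x y z := by
    have hs : ∀ x y, br x y = -br y x := fun x y => by
      have := h0 (x + y)
      simp only [map_add, LinearMap.add_apply, h0, zero_add, add_zero] at this
      exact eq_neg_of_add_eq_zero_right this
    have h := hJ x y z
    rw [hs z x, hs z (br x y), map_neg] at h
    rw [← sub_eq_zero, ← h]
    abel

/-- The Lie algebra with a given bilinear bracket. -/
abbrev lieAlgebraOfBracket {L : Type*} [AddCommGroup L] [Module ℝ L] (br : L →ₗ[ℝ] L →ₗ[ℝ] L)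
    (h0 : ∀ x, br x x = 0)
    (hJ : ∀ x y z, br x (br y z) + br y (br z x) + br z (br x y) = 0) :
    letI := lieRingOfBracket br h0 hJ
    LieAlgebra ℝ L :=
  letI := lieRingOfBracket br h0 hJ
  { lie_smul := fun r x y => (br x).map_smul r y }

/-- The central extension of a Lie algebra by an abelian one that is defined by a 2-cocycle `c`. -/
theorem exists_centralExtension {L : Type u} [AddCommGroup L] [Module ℝ L]
    (br : L →ₗ[ℝ] L →ₗ[ℝ] L) (h0 : ∀ x, br x x = 0)
    (hJ : ∀ x y z, br x (br y z) + br y (br z x) + br z (br x y) = 0)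
    {A : Type v} [LieRing A] [LieAlgebra ℝ A] (hA : ∀ f g : A, ⁅f, g⁆ = 0)
    (c : L →ₗ[ℝ] L →ₗ[ℝ] A) (c0 : ∀ x, c x x = 0)
    (cJ : ∀ x y z, c x (br y z) + c y (br z x) + c z (br x y) = 0) (Q : L →ₗ[ℝ] A) :
    ∃ (G : Type u) (_ : LieRing G) (_ : LieAlgebra ℝ G) (e : L ≃ₗ[ℝ] G)
      (P : Type (max u v)) (_ : LieRing P) (_ : LieAlgebra ℝ P)
      (i : A →ₗ⁅ℝ⁆ P) (p : P →ₗ⁅ℝ⁆ G) (q : G →ₗ[ℝ] P) (ev : P →ₗ[ℝ] A),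
      (∀ X Y, e.symm ⁅e X, e Y⁆ = br X Y) ∧ LieAlgebra.IsExtension i p ∧
      (∀ f (z : P), ⁅i f, z⁆ = 0) ∧ (∀ g, p (q g) = g) ∧ (∀ f, ev (i f) = f) ∧
      (∀ X, ev (q (e X)) = Q X) ∧
      (∀ X Y, ⁅q (e X), q (e Y)⁆ = q ⁅e X, e Y⁆ + i (c X Y)) := by
  -- The bracket ignores the components in A, so A becomes central; its Jacobi identity is that of
  -- `br` together with the cocycle condition.
  let br' : (L × A) →ₗ[ℝ] (L × A) →ₗ[ℝ] (L × A) :=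
    (br.compl₁₂ (.fst ℝ L A) (.fst ℝ L A)).compr₂ (.inl ℝ L A) +
      (c.compl₁₂ (.fst ℝ L A) (.fst ℝ L A)).compr₂ (.inr ℝ L A)
  have hbr' : ∀ x y, br' x y = (br x.1 y.1, c x.1 y.1) := fun x y => by simp [br']
  have h0' : ∀ x, br' x x = 0 := fun x => by rw [hbr', h0, c0]; rfl
  have hJ' : ∀ x y z, br' x (br' y z) + br' y (br' z x) + br' z (br' x y) = 0 := fun x y z => by
    simp only [hbr']
    exact Prod.ext (hJ _ _ _) (cJ _ _ _)
  let _ := lieRingOfBracket br h0 hJ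
  let _ := lieAlgebraOfBracket br h0 hJ
  let _ := lieRingOfBracket br' h0' hJ'
  let _ := lieAlgebraOfBracket br' h0' hJ'
  let i : A →ₗ⁅ℝ⁆ (L × A) :=
    { LinearMap.inr ℝ L A with
      map_lie' := fun {f g} => by
        change (LinearMap.inr ℝ L A ⁅f, g⁆) = br' (0, f) (0, g)
        rw [hA, hbr']; simp }
  let p : (L × A) →ₗ⁅ℝ⁆ L :=
    { LinearMap.fst ℝ L A with
      map_lie' := fun {x y} => by
        change (br' x y).1 = br x.1 y.1
        rw [hbr'] }
  -- G is L with the new bracket. The section is the inclusion of the first factor, and evaluation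
  -- is (X, f) ↦ Q(X) + f, which restricts to the identity on A and to Q on the section.
  refine ⟨L, inferInstance, inferInstance, LinearEquiv.refl ℝ L, L × A, inferInstance, inferInstance,
    i, p, LinearMap.inl ℝ L A, Q.comp (LinearMap.fst ℝ L A) + LinearMap.snd ℝ L A,
    fun _ _ => rfl, ⟨?_, ?_, ?_⟩, ?_, fun _ => rfl, ?_, ?_, ?_⟩
  · rw [LieHom.ker_eq_bot]
    exact fun f g h => congrArg Prod.snd h
  · rw [LieHom.range_eq_top]
    exact fun x => ⟨(x, 0), rfl⟩
  · exact (LieHom.range_eq_ker_iff i p).2 fun x =>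
      ⟨fun h => ⟨x.2, Prod.ext (Eq.symm h) rfl⟩, fun ⟨f, hf⟩ => hf ▸ rfl⟩
  · intro f z
    change br' (0, f) z = 0
    rw [hbr']; simp
  · intro f
    change Q 0 + f = f
    simp
  · intro X
    change Q X + 0 = Q X
    simp
  · intro X Y
    change br' (X, 0) (Y, 0) = (br X Y, 0) + (0, c X Y)
    rw [hbr']; simp

end CentralExtension

/-- A linear map has a linear section over its range. -/
theorem exists_linear_section {V W : Type*} [AddCommGroup V] [Module ℝ V] [AddCommGroup W]
    [Module ℝ W] (d : V →ₗ[ℝ] W) :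
    ∃ s : W →ₗ[ℝ] V, (∀ w, (∃ v, d v = w) → d (s w) = w) ∧ ∀ w, s (-w) = -s w := by
  obtain ⟨s, hs⟩ := d.rangeRestrict.exists_rightInverse_of_surjective (LinearMap.range_rangeRestrict d)
  obtain ⟨s', hs'⟩ := s.exists_extend
  refine ⟨s', fun w hw => ?_, map_neg s'⟩
  have h1 : s' w = s ⟨w, hw⟩ := DFunLike.congr_fun hs' ⟨w, hw⟩
  rw [h1]
  exact congrArg Subtype.val (DFunLike.congr_fun hs ⟨w, hw⟩)

/-! ### Flux, charge bracket, cocycle and the cyclic identity. -/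

namespace LagrangianData

variable {E : Type*} [NormedAddCommGroup E] [NormedSpace ℝ E] [FiniteDimensional ℝ E]
  {M : Type*} [TopologicalSpace M] [ChartedSpace E M] [IsManifold 𝓘(ℝ, E) ∞ M]
  {F : Type*} [NormedAddCommGroup F] [NormedSpace ℝ F] [FiniteDimensional ℝ F]
  {𝒦 : SupportFamily M} {ρ : TensorType E F} {m : ℕ}
  {𝒯 : LagrangianData 𝒦 ρ m}

/-- The integrand of the flux. -/
def fluxForm (X : 𝒯.Φ → VF E 𝒦) (φ : 𝒯.Φ) (v : Var 𝒦 ρ) : RawForm E M (m + 1) :=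
  𝒯.Theta φ (vert X φ) v + ddirSec (fun ψ => 𝒯.current (X ψ) ψ) φ v + iota (X φ).1 (𝒯.eom φ v)

/-- The integrand of the cocycle. -/
def cocycleForm (X Y : 𝒯.Φ → VF E 𝒦) (φ : 𝒯.Φ) : RawForm E M (m + 1) :=
  𝒯.Theta φ (vert X φ) (vert Y φ) - 𝒯.current (extBracket X Y φ) φ
    - iota (Y φ).1 (𝒯.eom φ (vert X φ)) + iota (X φ).1 (𝒯.eom φ (vert Y φ))

theorem cocycleForm_onShell (X Y : 𝒯.Φ → VF E 𝒦) {φ : 𝒯.Φ} (hφ : φ ∈ 𝒯.onShell) :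
    𝒯.cocycleForm X Y φ =
      𝒯.Theta φ (vert X φ) (vert Y φ) - 𝒯.current (extBracket X Y φ) φ := by
  rw [cocycleForm, hφ, hφ, iota_zero_right, iota_zero_right, sub_zero, add_zero]

variable (h𝒯 : 𝒯.IsCovariant) (S : Chain E M (m + 1))
include h𝒯

theorem isSmoothLin_fluxForm {X : 𝒯.Φ → VF E 𝒦}
    (hX : IsSmoothMap 𝒦 𝒦 (vecT E M) fun ψ => (X ψ).1) :
    IsSmoothLin 𝒦 (fieldT M ρ) (formT E M (m + 1)) fun ψ v => 𝒯.fluxForm X ψ v :=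
  ((isSmoothLin_Theta_right h𝒯 hX.vert).add (((isSmoothLin_current h𝒯).apply hX).ddirSec
    h𝒯.isOpen)).add ((isSmoothLin_eom h𝒯).iota hX)

/-- Stokes' theorem and `ddirSec_current`. The integrand is written as Θ(X^v, v) + dJ(X)(v) + ι_X
E(v), the form in which its derivative on field space is easy to take. -/
theorem flux_eq {X : 𝒯.Φ → VF E 𝒦} (hX : IsSmoothMap 𝒦 𝒦 (vecT E M) fun ψ => (X ψ).1)
    (φ : 𝒯.Φ) (v : Var 𝒦 ρ) : 𝒯.flux S X φ v = chainIntegral S (𝒯.fluxForm X φ v) := by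
  have m1 : iota (X φ).1 (𝒯.θ φ v).1 - ddirSec (fun ψ => (𝒯.γ ψ (X ψ)).1) φ v
      + (𝒯.γ φ (dParam X φ v)).1 ∈ Sec E (formT E M m) :=
    Submodule.add_mem _ (Submodule.sub_mem _ (iota_mem (X φ).2.1 (𝒯.θ φ v).2)
      ((((isSmoothLin_γ h𝒯).apply hX).ddirSec h𝒯.isOpen).mem φ v)) (𝒯.γ φ _).2
  rw [flux, chainIntegral_chainBdry S m1,
    ← chainIntegral_add S ((isSmoothLin_current h𝒯).mem φ _) (extD_mem m1), fluxForm,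
    ddirSec_current h𝒯 hX]
  congr 1
  rw [dParam_eq_dSec]
  abel

theorem ddir_charge {X : 𝒯.Φ → VF E 𝒦} (hX : IsSmoothMap 𝒦 𝒦 (vecT E M) fun ψ => (X ψ).1)
    (φ : 𝒯.Φ) (v : Var 𝒦 ρ) : ddir (𝒯.charge S X) φ v =
      chainIntegral S (ddirSec (fun ψ => 𝒯.current (X ψ) ψ) φ v) :=
  ddir_chainIntegral h𝒯.isOpen S ((isSmoothLin_current h𝒯).apply hX) φ v

/-- The contraction of the presymplectic form with a vertical vector field. -/
theorem presymplectic_vert {X : 𝒯.Φ → VF E 𝒦}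
    (hX : IsSmoothMap 𝒦 𝒦 (vecT E M) fun ψ => (X ψ).1) (φ : 𝒯.Φ) (v : Var 𝒦 ρ) :
    𝒯.presymplectic S φ (vert X φ) v = -ddir (𝒯.charge S X) φ v + 𝒯.flux S X φ v
      - chainIntegral S (iota (X φ).1 (𝒯.eom φ v)) := by
  have m1 := (isSmoothLin_Theta_const h𝒯 v).mem φ (vert X φ)
  have m2 := (((isSmoothLin_current h𝒯).apply hX).ddirSec h𝒯.isOpen).mem φ v
  have m3 := iota_mem (X φ).2.1 ((isSmoothLin_eom h𝒯).mem φ v)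
  rw [flux_eq h𝒯 S hX, fluxForm, chainIntegral_add S (Submodule.add_mem _ m1 m2) m3,
    chainIntegral_add S m1 m2, ddir_charge h𝒯 S hX, presymplectic]
  ring

/-- If closed forms are exact, the anomaly has a bilinear antisymmetric potential. -/
theorem exists_potential (hdim : Module.finrank ℝ E = m + 2)
    (hex : ∀ η : Form E M (m + 1), extD η.1 = 0 → ∃ α : Form E M m, extD α.1 = η.1) :
    ∃ A : VF E 𝒦 →ₗ[ℝ] VF E 𝒦 →ₗ[ℝ] (𝒯.Φ → Form E M m),
      (∀ X Y, A X Y = -A Y X) ∧ 𝒯.IsPotential (fun X Y φ => A X Y φ) := by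
  let d : Form E M m →ₗ[ℝ] Form E M (m + 1) :=
    { toFun := fun α => ⟨extD α.1, extD_mem α.2⟩
      map_add' := fun α β => Subtype.ext (extD_add α.2 β.2)
      map_smul' := fun r α => Subtype.ext (extD_smul r α.1) }
  -- A linear choice of primitives, applied at each field separately, transfers bilinearity and
  -- antisymmetry from the anomaly to the potential.
  obtain ⟨s, hs, hneg⟩ := exists_linear_section (V := Form E M m) (W := Form E M (m + 1)) d
  let K : VF E 𝒦 → VF E 𝒦 → 𝒯.Φ → Form E M (m + 1) := fun X Y φ => ⟨_, anomaly_mem h𝒯 X Y φ⟩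
  have hK : ∀ (X X' Y : VF E 𝒦) (r : ℝ), K (r • X + X') Y = r • K X Y + K X' Y := fun X X' Y r =>
    funext fun φ => Subtype.ext (anomaly_add_smul h𝒯 X X' Y r φ)
  have hK' : ∀ X Y, K X Y = -K Y X := fun X Y =>
    funext fun φ => Subtype.ext (anomaly_swap h𝒯 X Y φ)
  have hA : ∀ (X X' Y : VF E 𝒦) (r : ℝ) φ, s (K (r • X + X') Y φ) = r • s (K X Y φ) + s (K X' Y φ) := by
    intro X X' Y r φ
    rw [hK, Pi.add_apply, Pi.smul_apply, map_add, map_smul]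
  have hA' : ∀ X Y φ, s (K X Y φ) = -s (K Y X φ) := by
    intro X Y φ
    rw [hK', Pi.neg_apply]
    exact hneg _
  have hB : ∀ (X Y Y' : VF E 𝒦) (r : ℝ) φ, s (K X (r • Y + Y') φ) = r • s (K X Y φ) + s (K X Y' φ) := by
    intro X Y Y' r φ
    rw [hA', hA, hA' X Y, hA' X Y']
    module
  refine ⟨LinearMap.mk₂ ℝ (fun X Y φ => s (K X Y φ)) ?_ ?_ ?_ ?_, ?_, ?_⟩
  · exact fun X X' Y => funext fun φ => by simpa using hA X X' Y 1 φ
  · intro r X Y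
    funext φ
    have h0 := hA 0 0 Y 1 φ
    rw [smul_zero, add_zero, one_smul, left_eq_add] at h0
    have := hA X 0 Y r φ
    rwa [add_zero, h0, add_zero] at this
  · exact fun X Y Y' => funext fun φ => by simpa using hB X Y Y' 1 φ
  · intro r X Y
    funext φ
    have h0 := hB X 0 0 1 φ
    rw [smul_zero, add_zero, one_smul, left_eq_add] at h0
    have := hB X Y 0 r φ
    rwa [add_zero, h0, add_zero] at this
  · exact fun X Y => funext fun φ => hA' X Y φ
  · intro X Y φ
    obtain ⟨α, hα⟩ := hex (K X Y φ) (extD_anomaly h𝒯 hdim X Y φ)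
    exact congrArg Subtype.val (hs (K X Y φ) ⟨α, Subtype.ext hα⟩)

theorem cocycleForm_mem (X Y : 𝒯.Φ → VF E 𝒦) (φ : 𝒯.Φ) :
    𝒯.cocycleForm X Y φ ∈ Sec E (formT E M (m + 1)) := by
  have he := fun v => (isSmoothLin_eom h𝒯).mem φ v
  exact Submodule.add_mem _ (Submodule.sub_mem _ (Submodule.sub_mem _
    ((isSmoothLin_Theta_const h𝒯 _).mem φ _) ((isSmoothLin_current h𝒯).mem φ _))
    (iota_mem (Y φ).2.1 (he _))) (iota_mem (X φ).2.1 (he _))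

theorem isSmoothMap_cocycleForm {X Y : 𝒯.Φ → VF E 𝒦}
    (hX : IsSmoothMap 𝒦 𝒦 (vecT E M) fun ψ => (X ψ).1)
    (hY : IsSmoothMap 𝒦 𝒦 (vecT E M) fun ψ => (Y ψ).1) :
    IsSmoothMap 𝒦 (.univ M) (formT E M (m + 1)) (𝒯.cocycleForm X Y) :=
  ((((isSmoothLin_Theta h𝒯 hY.vert).apply hX.vert).sub
    ((isSmoothLin_current h𝒯).apply (hX.extBracket h𝒯.isOpen hY))).sub
    (hY.iota ((isSmoothLin_eom h𝒯).apply hX.vert))).add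
    (hX.iota ((isSmoothLin_eom h𝒯).apply hY.vert))

theorem cocycleForm_swap (X Y : 𝒯.Φ → VF E 𝒦) (φ : 𝒯.Φ) :
    𝒯.cocycleForm X Y φ = -𝒯.cocycleForm Y X φ := by
  rw [cocycleForm, cocycleForm, Theta_swap, extBracket_swap, Pi.neg_apply,
    (isSmoothLin_current h𝒯).map_neg]
  abel

theorem cocycleForm_add_smul {X X' Y : 𝒯.Φ → VF E 𝒦}
    (hX : IsSmoothMap 𝒦 𝒦 (vecT E M) fun ψ => (X ψ).1)
    (hX' : IsSmoothMap 𝒦 𝒦 (vecT E M) fun ψ => (X' ψ).1)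
    (hY : IsSmoothMap 𝒦 𝒦 (vecT E M) fun ψ => (Y ψ).1) (r : ℝ) (φ : 𝒯.Φ) :
    𝒯.cocycleForm (r • X + X') Y φ = r • 𝒯.cocycleForm X Y φ + 𝒯.cocycleForm X' Y φ := by
  have h1 : vert (r • X + X') φ = r • vert X φ + vert X' φ := vertAt_add_smul _ _ _ _
  have h2 : extBracket (r • X + X') Y φ = r • extBracket X Y φ + extBracket X' Y φ := by
    rw [extBracket_add_smul h𝒯.isOpen hX hX' hY]; rfl
  have h3 : iota ((r • X + X') φ).1 (𝒯.eom φ (vert Y φ)) =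
      r • iota (X φ).1 (𝒯.eom φ (vert Y φ)) + iota (X' φ).1 (𝒯.eom φ (vert Y φ)) :=
    (isSmoothLin_iota ((isSmoothLin_eom h𝒯).apply_const (vert Y φ))).lin φ r (X φ) (X' φ)
  simp only [cocycleForm, h1, h2, h3, (isSmoothLin_current h𝒯).lin,
    (isSmoothLin_Theta_const h𝒯 _).lin, (isSmoothLin_eom h𝒯).lin, iota_add_right, iota_smul_right]
  module

/-- By Stokes' theorem the potential enters only through its exterior derivative, which is the
anomaly; the γ terms cancel and the two currents combine into that of the extended bracket. -/
theorem cocycleBar_eq {A : VF E 𝒦 → VF E 𝒦 → 𝒯.Φ → Form E M m} (hA : 𝒯.IsPotential A)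
    (X Y : 𝒯.Φ → VF E 𝒦) (φ : 𝒯.Φ) :
    𝒯.cocycleBar A S X Y φ = chainIntegral S (𝒯.cocycleForm X Y φ) := by
  have m1 : (A (X φ) (Y φ) φ).1 + (𝒯.γ φ (diffBracket (X φ) (Y φ))).1 ∈ Sec E (formT E M m) :=
    Submodule.add_mem _ (A _ _ φ).2 (𝒯.γ φ _).2
  have m2 := (isSmoothLin_current h𝒯).mem φ (antiDeriv X Y φ)
  rw [cocycleBar, chainIntegral_chainBdry S m1, ← chainIntegral_sub S (extD_mem m1) m2,
    extD_add (A _ _ φ).2 (𝒯.γ φ _).2, hA, anomaly_eq h𝒯, cocycleForm]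
  have h : 𝒯.current (extBracket X Y φ) φ =
      𝒯.current (diffBracket (X φ) (Y φ)) φ + 𝒯.current (antiDeriv X Y φ) φ :=
    (isSmoothLin_current h𝒯).map_add φ _ _
  rw [h]
  congr 1
  simp only [vert]
  abel

theorem chargeBracket_eq {A : VF E 𝒦 → VF E 𝒦 → 𝒯.Φ → Form E M m} (hA : 𝒯.IsPotential A)
    (X Y : 𝒯.Φ → VF E 𝒦) (φ : 𝒯.Φ) :
    𝒯.chargeBracket S X Y φ = 𝒯.charge S (extBracket X Y) φ + 𝒯.cocycleBar A S X Y φ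
      + chainIntegral S (iota (Y φ).1 (𝒯.eom φ (vert X φ))
          - iota (X φ).1 (𝒯.eom φ (vert Y φ))) := by
  have m1 := (isSmoothLin_current h𝒯).mem φ (extBracket X Y φ)
  have m2 := cocycleForm_mem h𝒯 X Y φ
  have m3 : iota (Y φ).1 (𝒯.eom φ (vert X φ)) - iota (X φ).1 (𝒯.eom φ (vert Y φ)) ∈
      Sec E (formT E M (m + 1)) :=
    Submodule.sub_mem _ (iota_mem (Y φ).2.1 ((isSmoothLin_eom h𝒯).mem φ _))
      (iota_mem (X φ).2.1 ((isSmoothLin_eom h𝒯).mem φ _))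
  rw [cocycleBar_eq h𝒯 S hA, charge, ← chainIntegral_add S m1 m2,
    ← chainIntegral_add S (Submodule.add_mem _ m1 m2) m3, chargeBracket, presymplectic, cocycleForm]
  congr 1
  abel

/-- The presymplectic current is closed on field space. -/
theorem Theta_closed (φ : 𝒯.Φ) (x y z : Var 𝒦 ρ) :
    ddirSec (fun ψ => 𝒯.Theta ψ y z) φ x + ddirSec (fun ψ => 𝒯.Theta ψ z x) φ y
      + ddirSec (fun ψ => 𝒯.Theta ψ x y) φ z = 0 := by
  have hs : ∀ v w : Var 𝒦 ρ, IsSmoothMap 𝒦 (.univ M) (formT E M (m + 1)) fun ψ => 𝒯.dTheta ψ v w :=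
    fun v w => (isSmoothLin_dTheta_left h𝒯 (w := fun _ => w) (isSmoothMap_const w.2.1)).apply_const v
  have h1 : ∀ u v w : Var 𝒦 ρ, ddirSec (fun ψ => 𝒯.Theta ψ v w) φ u =
      ddirSec (fun ψ => 𝒯.dTheta ψ v w) φ u - ddirSec (fun ψ => 𝒯.dTheta ψ w v) φ u :=
    fun u v w => ddirSec_sub h𝒯.isOpen (hs v w) (hs w v) φ u
  -- With w held constant, this is symmetry of the second derivatives of θ(w); it is d² = 0 on field
  -- space.
  have h2 : ∀ u v w : Var 𝒦 ρ, ddirSec (fun ψ => 𝒯.dTheta ψ v w) φ u =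
      ddirSec (fun ψ => 𝒯.dTheta ψ u w) φ v :=
    fun u v w => ddirSec_symm h𝒯.isOpen ((isSmoothLin_θ h𝒯).apply_const w) φ u v
  rw [h1, h1, h1, h2 x y z, h2 y z x, h2 z x y]
  abel

theorem ddirSec_Theta_vert {X : 𝒯.Φ → VF E 𝒦}
    (hX : IsSmoothMap 𝒦 𝒦 (vecT E M) fun ψ => (X ψ).1) (φ : 𝒯.Φ) (v w : Var 𝒦 ρ) :
    ddirSec (fun ψ => 𝒯.Theta ψ (vert X ψ) w) φ v =
      ddirSec (fun ψ => 𝒯.Theta ψ (vert X φ) w) φ v + 𝒯.Theta φ (dSec (vert X) φ v) w :=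
  (isSmoothLin_Theta_const h𝒯 w).ddirSec_apply h𝒯.isOpen hX.vert φ v

theorem dForm1_presymplectic {X : 𝒯.Φ → VF E 𝒦}
    (hX : IsSmoothMap 𝒦 𝒦 (vecT E M) fun ψ => (X ψ).1) (φ : 𝒯.Φ) (v w : Var 𝒦 ρ) :
    dForm1 (fun ψ v => 𝒯.presymplectic S ψ (vert X ψ) v) φ v w =
      chainIntegral S (ddirSec (fun ψ => 𝒯.Theta ψ (vert X ψ) w) φ v -
        ddirSec (fun ψ => 𝒯.Theta ψ (vert X ψ) v) φ w) := by
  have hs := fun u => (isSmoothLin_Theta_const h𝒯 u).apply hX.vert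
  rw [chainIntegral_sub S (((hs w).ddirSec h𝒯.isOpen).mem φ v) (((hs v).ddirSec h𝒯.isOpen).mem φ w),
    ← ddir_chainIntegral h𝒯.isOpen S (hs w), ← ddir_chainIntegral h𝒯.isOpen S (hs v)]
  rfl

/-- The obstruction to the cocycle condition on shell. -/
theorem cocycle_obstruction {A : VF E 𝒦 → VF E 𝒦 → 𝒯.Φ → Form E M m} (hA : 𝒯.IsPotential A)
    {X Y Z : 𝒯.Φ → VF E 𝒦} (hX : IsSmoothMap 𝒦 𝒦 (vecT E M) fun ψ => (X ψ).1)
    (hY : IsSmoothMap 𝒦 𝒦 (vecT E M) fun ψ => (Y ψ).1)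
    (hZ : IsSmoothMap 𝒦 𝒦 (vecT E M) fun ψ => (Z ψ).1) {φ : 𝒯.Φ} (hφ : φ ∈ 𝒯.onShell) :
    𝒯.cocycleBar A S X (extBracket Y Z) φ + 𝒯.cocycleBar A S Y (extBracket Z X) φ
        + 𝒯.cocycleBar A S Z (extBracket X Y) φ
      = dForm1 (fun ψ v => 𝒯.presymplectic S ψ (vert X ψ) v) φ (vert Y φ) (vert Z φ)
        + dForm1 (fun ψ v => 𝒯.presymplectic S ψ (vert Y ψ) v) φ (vert Z φ) (vert X φ)
        + dForm1 (fun ψ v => 𝒯.presymplectic S ψ (vert Z ψ) v) φ (vert X φ) (vert Y φ) := by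
  -- The current is linear in its parameter at fixed φ, so the charges drop out of the cyclic sum by
  -- the Jacobi identity.
  have hJ : 𝒯.current (extBracket X (extBracket Y Z) φ) φ
      + 𝒯.current (extBracket Y (extBracket Z X) φ) φ
      + 𝒯.current (extBracket Z (extBracket X Y) φ) φ = 0 := by
    rw [← (isSmoothLin_current h𝒯).map_add, ← (isSmoothLin_current h𝒯).map_add]
    have := congrFun (extBracket_jacobi h𝒯.isOpen hX hY hZ) φ
    rw [Pi.add_apply, Pi.add_apply, Pi.zero_apply] at this
    rw [this, (isSmoothLin_current h𝒯).map_zero]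
  have mc := fun U V : 𝒯.Φ → VF E 𝒦 => cocycleForm_mem h𝒯 U V φ
  have md : ∀ {U : 𝒯.Φ → VF E 𝒦}, IsSmoothMap 𝒦 𝒦 (vecT E M) (fun ψ => (U ψ).1) → ∀ v w,
      ddirSec (fun ψ => 𝒯.Theta ψ (vert U ψ) w) φ v -
        ddirSec (fun ψ => 𝒯.Theta ψ (vert U ψ) v) φ w ∈ Sec E (formT E M (m + 1)) := by
    intro U hU v w
    have hs := fun u => (isSmoothLin_Theta_const h𝒯 u).apply hU.vert
    exact Submodule.sub_mem _ (((hs w).ddirSec h𝒯.isOpen).mem φ v)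
      (((hs v).ddirSec h𝒯.isOpen).mem φ w)
  rw [cocycleBar_eq h𝒯 S hA, cocycleBar_eq h𝒯 S hA, cocycleBar_eq h𝒯 S hA,
    dForm1_presymplectic h𝒯 S hX, dForm1_presymplectic h𝒯 S hY, dForm1_presymplectic h𝒯 S hZ,
    ← chainIntegral_add S (mc _ _) (mc _ _),
    ← chainIntegral_add S (Submodule.add_mem _ (mc _ _) (mc _ _)) (mc _ _),
    ← chainIntegral_add S (md hX _ _) (md hY _ _),
    ← chainIntegral_add S (Submodule.add_mem _ (md hX _ _) (md hY _ _)) (md hZ _ _)]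
  congr 1
  have hc := Theta_closed h𝒯 φ
  have hsw : ∀ v w u : Var 𝒦 ρ, ddirSec (fun ψ => 𝒯.Theta ψ w v) φ u =
      -ddirSec (fun ψ => 𝒯.Theta ψ v w) φ u := by
    intro v w u
    have hs := (isSmoothLin_Theta_const h𝒯 w).apply_const v
    have h1 := ddirSec_smul h𝒯.isOpen hs (-1) φ u
    simp only [← form_neg_eq] at h1
    rw [← h1]
    congr 1
    funext ψ
    exact Theta_swap ψ w v
  -- This form of Θ(w, {U, V}^v) matches the terms that arise when d(ι_{X^v} Θ) differentiates the
  -- vertical field.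
  have hv : ∀ {U V : 𝒯.Φ → VF E 𝒦}, IsSmoothMap 𝒦 𝒦 (vecT E M) (fun ψ => (U ψ).1) →
      IsSmoothMap 𝒦 𝒦 (vecT E M) (fun ψ => (V ψ).1) → ∀ w,
      𝒯.Theta φ w (vert (extBracket U V) φ) =
        𝒯.Theta φ (dSec (vert U) φ (vert V φ)) w - 𝒯.Theta φ (dSec (vert V) φ (vert U φ)) w := by
    intro U V hU hV w
    rw [Theta_swap, vert_extBracket h𝒯.isOpen hU hV, (isSmoothLin_Theta_const h𝒯 w).map_sub, neg_sub]
  have hc1 := hc (vert X φ) (vert Y φ) (vert Z φ)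
  rw [cocycleForm_onShell _ _ hφ, cocycleForm_onShell _ _ hφ, cocycleForm_onShell _ _ hφ,
    hv hY hZ, hv hZ hX, hv hX hY, ddirSec_Theta_vert h𝒯 hX, ddirSec_Theta_vert h𝒯 hX,
    ddirSec_Theta_vert h𝒯 hY, ddirSec_Theta_vert h𝒯 hY, ddirSec_Theta_vert h𝒯 hZ,
    ddirSec_Theta_vert h𝒯 hZ, hsw (vert X φ) (vert Y φ), hsw (vert Y φ) (vert Z φ),
    hsw (vert Z φ) (vert X φ)]
  -- Each of the three terms of dΘ = 0 occurs twice in the cyclic sum, hence the factor 2.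
  linear_combination (norm := module) -hJ + 2 • hc1

end LagrangianData

/-! ### Equivariance of the field equations and consequences on shell. -/

namespace LagrangianData

variable {E : Type*} [NormedAddCommGroup E] [NormedSpace ℝ E] [FiniteDimensional ℝ E]
  {M : Type*} [TopologicalSpace M] [ChartedSpace E M] [IsManifold 𝓘(ℝ, E) ∞ M]
  {F : Type*} [NormedAddCommGroup F] [NormedSpace ℝ F] [FiniteDimensional ℝ F]
  {𝒦 : SupportFamily M} {ρ : TensorType E F} {m : ℕ}
  {𝒯 : LagrangianData 𝒦 ρ m}
  (h𝒯 : 𝒯.IsCovariant) (S : Chain E M (m + 1))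
include h𝒯

/-- The field equations are equivariant. -/
theorem covariant_eom (X : VF E 𝒦) (φ : 𝒯.Φ) (v : Var 𝒦 ρ) :
    ddirSec (fun ψ => 𝒯.eom ψ v) φ (vertAt X φ.1) =
      lieForm X.1 (𝒯.eom φ v) - 𝒯.eom φ (lieVar X v) := by
  have hL := isSmoothMap_L h𝒯
  have hDL := hL.ddirSec h𝒯.isOpen
  have hθ := (isSmoothLin_θ h𝒯).apply_const v
  have h1 := ddirSec_sub h𝒯.isOpen (hDL.apply_const v) hθ.extD φ (vertAt X φ.1)
  -- Equivariance of L, differentiated along v; symmetry of second derivatives then turns this into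
  -- the derivative of dL(v) along X^v.
  have h2 := hDL.ddirSec_apply h𝒯.isOpen
    (IsSmoothMap.vert (X := fun _ : 𝒯.Φ => X) (isSmoothMap_const X.2.1)) φ v
  have h3 : toSecK E 𝒦 (fieldT M ρ) (ddirSec (fun ψ : 𝒯.Φ => (vertAt X ψ.1).1) φ v) = lieVar X v :=
    dSec_vertAt h𝒯.isOpen X φ v
  simp only [vert, h𝒯.covariant_L] at h2
  rw [ddirSec_lieForm h𝒯.isOpen X hL, h3] at h2
  have h4 : ddirSec (fun ψ => (𝒯.θ ψ v).1) φ (vertAt X φ.1) = _ := covariant_dTheta h𝒯 X φ v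
  have mθ := fun w => (𝒯.θ φ w).2
  refine h1.trans ?_
  rw [ddirSec_extD h𝒯.isOpen hθ, h4, ddirSec_symm h𝒯.isOpen hL, eq_sub_of_add_eq h2.symm, eom, eom,
    extD_sub (lieForm_mem X.2.1 (mθ v)) (mθ _), extD_lieForm X.2.1 (mθ v),
    lieForm_sub_right X.2.1 (hDL.mem φ v) (extD_mem (mθ v))]
  abel

/-- The derivative of `X` multiplies E = 0, and equivariance expresses the derivative of E along Y^v
through E at the same field, which vanishes on all of M and for all variations. -/
theorem ddirSec_iota_eom_onShell {X : 𝒯.Φ → VF E 𝒦}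
    (hX : IsSmoothMap 𝒦 𝒦 (vecT E M) fun ψ => (X ψ).1) {φ : 𝒯.Φ} (hφ : φ ∈ 𝒯.onShell)
    (Y : VF E 𝒦) (v : Var 𝒦 ρ) :
    ddirSec (fun ψ => iota (X ψ).1 (𝒯.eom ψ v)) φ (vertAt Y φ.1) = 0 := by
  rw [ddirSec_iota h𝒯.isOpen hX ((isSmoothLin_eom h𝒯).apply_const v), covariant_eom h𝒯, hφ, hφ,
    lieForm_zero_right, sub_zero, iota_zero_right, iota_zero_right, add_zero]

theorem ddir_flux {X : 𝒯.Φ → VF E 𝒦} (hX : IsSmoothMap 𝒦 𝒦 (vecT E M) fun ψ => (X ψ).1)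
    (φ : 𝒯.Φ) (v w : Var 𝒦 ρ) : ddir (fun ψ => 𝒯.flux S X ψ w) φ v =
      chainIntegral S (ddirSec (fun ψ => 𝒯.fluxForm X ψ w) φ v) := by
  simp only [flux_eq h𝒯 S hX]
  exact ddir_chainIntegral h𝒯.isOpen S ((isSmoothLin_fluxForm h𝒯 hX).apply_const w) φ v

/-- The two 1-forms differ by dQ, removed by symmetry of second derivatives, and by the integral of
ι_X E, which does not contribute on shell because both arguments are vertical. -/
theorem dForm1_flux {X Y Z : 𝒯.Φ → VF E 𝒦}
    (hX : IsSmoothMap 𝒦 𝒦 (vecT E M) fun ψ => (X ψ).1) {φ : 𝒯.Φ} (hφ : φ ∈ 𝒯.onShell) :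
    dForm1 (𝒯.flux S X) φ (vert Y φ) (vert Z φ) =
      dForm1 (fun ψ v => 𝒯.presymplectic S ψ (vert X ψ) v) φ (vert Y φ) (vert Z φ) := by
  have hJ := (isSmoothLin_current h𝒯).apply hX
  have key : ∀ (V : VF E 𝒦) (w : Var 𝒦 ρ), ddirSec (fun ψ => 𝒯.fluxForm X ψ w) φ (vertAt V φ.1) =
      ddirSec (fun ψ => 𝒯.Theta ψ (vert X ψ) w) φ (vertAt V φ.1) +
        ddirSec (fun ψ => ddirSec (fun ψ => 𝒯.current (X ψ) ψ) ψ w) φ (vertAt V φ.1) := by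
    intro V w
    have h1 := (isSmoothLin_Theta_const h𝒯 w).apply hX.vert
    have h2 := (hJ.ddirSec h𝒯.isOpen).apply_const w
    have h3 := hX.iota ((isSmoothLin_eom h𝒯).apply_const w)
    refine (ddirSec_add h𝒯.isOpen (h1.add h2) h3 φ _).trans ?_
    rw [ddirSec_add h𝒯.isOpen h1 h2, ddirSec_iota_eom_onShell h𝒯 hX hφ, add_zero]
  have m := fun v w => (((isSmoothLin_fluxForm h𝒯 hX).apply_const w).ddirSec h𝒯.isOpen).mem φ v
  rw [dForm1_presymplectic h𝒯 S hX, dForm1, ddir_flux h𝒯 S hX, ddir_flux h𝒯 S hX,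
    ← chainIntegral_sub S (m _ _) (m _ _)]
  simp only [vert] at key ⊢
  rw [key, key, ddirSec_symm h𝒯.isOpen hJ φ (vertAt (Y φ) φ.1)]
  congr 1
  abel

theorem smoothOn_flux_vert {X Z : 𝒯.Φ → VF E 𝒦}
    (hX : IsSmoothMap 𝒦 𝒦 (vecT E M) fun ψ => (X ψ).1)
    (hZ : IsSmoothMap 𝒦 𝒦 (vecT E M) fun ψ => (Z ψ).1) :
    SmoothOn 𝒦 fun ψ => 𝒯.flux S X ψ (vert Z ψ) := by
  simp only [flux_eq h𝒯 S hX]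
  exact contDiff_chainIntegral_of_isSmoothMap h𝒯.isOpen S
    ((isSmoothLin_fluxForm h𝒯 hX).apply hZ.vert)

/-- Separates the derivative of the 1-form, which enters `dForm1`, from that of the vertical field
inserted in it. -/
theorem ddir_flux_vert {X Z : 𝒯.Φ → VF E 𝒦}
    (hX : IsSmoothMap 𝒦 𝒦 (vecT E M) fun ψ => (X ψ).1)
    (hZ : IsSmoothMap 𝒦 𝒦 (vecT E M) fun ψ => (Z ψ).1) (φ : 𝒯.Φ) (v : Var 𝒦 ρ) :
    ddir (fun ψ => 𝒯.flux S X ψ (vert Z ψ)) φ v =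
      ddir (fun ψ => 𝒯.flux S X ψ (vert Z φ)) φ v + 𝒯.flux S X φ (dSec (vert Z) φ v) := by
  have hN := isSmoothLin_fluxForm h𝒯 hX
  have h1 := hN.ddirSec_apply h𝒯.isOpen hZ.vert φ v
  rw [ddir_flux h𝒯 S hX]
  simp only [flux_eq h𝒯 S hX]
  rw [ddir_chainIntegral h𝒯.isOpen S (hN.apply hZ.vert), h1,
    chainIntegral_add S (((hN.apply_const _).ddirSec h𝒯.isOpen).mem φ v) (hN.mem φ _)]
  rfl

theorem flux_sub {X : 𝒯.Φ → VF E 𝒦} (hX : IsSmoothMap 𝒦 𝒦 (vecT E M) fun ψ => (X ψ).1)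
    (φ : 𝒯.Φ) (v w : Var 𝒦 ρ) : 𝒯.flux S X φ (v - w) = 𝒯.flux S X φ v - 𝒯.flux S X φ w := by
  have hN := isSmoothLin_fluxForm h𝒯 hX
  simp only [flux_eq h𝒯 S hX]
  rw [hN.map_sub, chainIntegral_sub S (hN.mem φ v) (hN.mem φ w)]

/-- The exterior derivative of a flux that vanishes on the boundary conditions. -/
theorem dForm1_flux_of_vanish {X Y Z : 𝒯.Φ → VF E 𝒦}
    (hX : IsSmoothMap 𝒦 𝒦 (vecT E M) fun ψ => (X ψ).1)
    (hY : IsSmoothMap 𝒦 𝒦 (vecT E M) fun ψ => (Y ψ).1)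
    (hZ : IsSmoothMap 𝒦 𝒦 (vecT E M) fun ψ => (Z ψ).1) {φ : 𝒯.Φ}
    (h1 : ddir (fun ψ => 𝒯.flux S X ψ (vert Z ψ)) φ (vert Y φ) = 0)
    (h2 : ddir (fun ψ => 𝒯.flux S X ψ (vert Y ψ)) φ (vert Z φ) = 0)
    (h3 : 𝒯.flux S X φ (vert (extBracket Y Z) φ) = 0) :
    dForm1 (𝒯.flux S X) φ (vert Y φ) (vert Z φ) = 0 := by
  rw [ddir_flux_vert h𝒯 S hX hZ] at h1
  rw [ddir_flux_vert h𝒯 S hX hY] at h2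
  rw [vert_extBracket h𝒯.isOpen hY hZ, flux_sub h𝒯 S hX] at h3
  rw [dForm1]
  linear_combination h1 - h2 - h3

theorem moment_map {X : 𝒯.Φ → VF E 𝒦} (hX : IsSmoothMap 𝒦 𝒦 (vecT E M) fun ψ => (X ψ).1)
    {φ : 𝒯.Φ} (hφ : φ ∈ 𝒯.onShell) (v : Var 𝒦 ρ) (h : 𝒯.flux S X φ v = 0) :
    𝒯.presymplectic S φ (vert X φ) v = -ddir (𝒯.charge S X) φ v := by
  rw [presymplectic_vert h𝒯 S hX, h, hφ, iota_zero_right, chainIntegral_zero]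
  ring

theorem smoothOn_charge {X : 𝒯.Φ → VF E 𝒦}
    (hX : IsSmoothMap 𝒦 𝒦 (vecT E M) fun ψ => (X ψ).1) : SmoothOn 𝒦 (𝒯.charge S X) :=
  contDiff_chainIntegral_of_isSmoothMap h𝒯.isOpen S ((isSmoothLin_current h𝒯).apply hX)

theorem charge_add_smul (X Y : 𝒯.Φ → VF E 𝒦) (r : ℝ) (φ : 𝒯.Φ) :
    𝒯.charge S (r • X + Y) φ = r * 𝒯.charge S X φ + 𝒯.charge S Y φ := by
  have m := (isSmoothLin_current h𝒯).mem φ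
  have h : 𝒯.current ((r • X + Y) φ) φ = r • 𝒯.current (X φ) φ + 𝒯.current (Y φ) φ :=
    (isSmoothLin_current h𝒯).lin φ r (X φ) (Y φ)
  rw [charge, h, chainIntegral_add S (Submodule.smul_mem _ _ (m _)) (m _), chainIntegral_smul]
  rfl

section Cocycle

variable {A : VF E 𝒦 → VF E 𝒦 → 𝒯.Φ → Form E M m} (hA : 𝒯.IsPotential A)
include hA

/-- A potential is not assumed to be smooth in the field; smoothness comes from the integrand
`cocycleForm`. The same integrand supplies the algebraic properties below for potentials that are
neither bilinear nor antisymmetric. -/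
theorem smoothOn_cocycleBar {X Y : 𝒯.Φ → VF E 𝒦}
    (hX : IsSmoothMap 𝒦 𝒦 (vecT E M) fun ψ => (X ψ).1)
    (hY : IsSmoothMap 𝒦 𝒦 (vecT E M) fun ψ => (Y ψ).1) :
    SmoothOn 𝒦 (𝒯.cocycleBar A S X Y) := by
  have h : 𝒯.cocycleBar A S X Y = fun φ => chainIntegral S (𝒯.cocycleForm X Y φ) :=
    funext fun φ => cocycleBar_eq h𝒯 S hA X Y φ
  rw [h]
  exact contDiff_chainIntegral_of_isSmoothMap h𝒯.isOpen S (isSmoothMap_cocycleForm h𝒯 hX hY)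

theorem cocycleBar_swap (X Y : 𝒯.Φ → VF E 𝒦) :
    𝒯.cocycleBar A S X Y = -𝒯.cocycleBar A S Y X := by
  funext φ
  rw [Pi.neg_apply, cocycleBar_eq h𝒯 S hA, cocycleBar_eq h𝒯 S hA, cocycleForm_swap h𝒯,
    chainIntegral_neg]

theorem cocycleBar_add_smul {X X' Y : 𝒯.Φ → VF E 𝒦}
    (hX : IsSmoothMap 𝒦 𝒦 (vecT E M) fun ψ => (X ψ).1)
    (hX' : IsSmoothMap 𝒦 𝒦 (vecT E M) fun ψ => (X' ψ).1)
    (hY : IsSmoothMap 𝒦 𝒦 (vecT E M) fun ψ => (Y ψ).1) (r : ℝ) :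
    𝒯.cocycleBar A S (r • X + X') Y = r • 𝒯.cocycleBar A S X Y + 𝒯.cocycleBar A S X' Y := by
  funext φ
  have m := fun U => cocycleForm_mem h𝒯 U Y φ
  rw [Pi.add_apply, Pi.smul_apply, cocycleBar_eq h𝒯 S hA, cocycleBar_eq h𝒯 S hA,
    cocycleBar_eq h𝒯 S hA, cocycleForm_add_smul h𝒯 hX hX' hY,
    chainIntegral_add S (Submodule.smul_mem _ _ (m _)) (m _), chainIntegral_smul, smul_eq_mul]

theorem chargeBracket_onShell (X Y : 𝒯.Φ → VF E 𝒦) {φ : 𝒯.Φ} (hφ : φ ∈ 𝒯.onShell) :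
    𝒯.chargeBracket S X Y φ = 𝒯.charge S (extBracket X Y) φ + 𝒯.cocycleBar A S X Y φ := by
  rw [chargeBracket_eq h𝒯 S hA, hφ, hφ, iota_zero_right, iota_zero_right, sub_zero,
    chainIntegral_zero, add_zero]

end Cocycle

end LagrangianData

/-- An antisymmetric map that is linear in its first argument, as a bilinear map. -/
def bilinOfAntisymm {V W : Type*} [AddCommGroup V] [Module ℝ V] [AddCommGroup W] [Module ℝ W]
    (f : V → V → W) (h : ∀ (r : ℝ) x x' y, f (r • x + x') y = r • f x y + f x' y)
    (h' : ∀ x y, f x y = -f y x) : V →ₗ[ℝ] V →ₗ[ℝ] W :=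
  have h0 : ∀ y, f 0 y = 0 := fun y => by simpa using h 1 0 0 y
  have ha : ∀ x x' y, f (x + x') y = f x y + f x' y := fun x x' y => by simpa using h 1 x x' y
  have hs : ∀ (r : ℝ) x y, f (r • x) y = r • f x y := fun r x y => by simpa [h0] using h r x 0 y
  LinearMap.mk₂ ℝ f ha hs
    (fun x y y' => by rw [h', ha, h' x y, h' x y', neg_add])
    (fun r x y => by rw [h', hs, h' x y, smul_neg])

theorem antisymm_self {W : Type*} [AddCommGroup W] [Module ℝ W] {x : W} (h : x = -x) : x = 0 := by
  have h2 : (2 : ℝ) • x = 0 := by rw [two_smul]; nth_rw 2 [h]; exact add_neg_cancel x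
  exact (smul_eq_zero.1 h2).resolve_left two_ne_zero

theorem exists_bilin_submodule {V : Type*} [AddCommGroup V] [Module ℝ V] (𝔤 : Submodule ℝ V)
    (f : V → V → V) (hf : ∀ X ∈ 𝔤, ∀ Y ∈ 𝔤, f X Y ∈ 𝔤)
    (h : ∀ X ∈ 𝔤, ∀ X' ∈ 𝔤, ∀ Y ∈ 𝔤, ∀ r : ℝ, f (r • X + X') Y = r • f X Y + f X' Y)
    (h' : ∀ X Y, f X Y = -f Y X) :
    ∃ br : 𝔤 →ₗ[ℝ] 𝔤 →ₗ[ℝ] 𝔤, (∀ X, br X X = 0) ∧ ∀ X Y, (br X Y).1 = f X.1 Y.1 :=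
  ⟨bilinOfAntisymm (fun X Y => ⟨f X.1 Y.1, hf X.1 X.2 Y.1 Y.2⟩)
    (fun r X X' Y => Subtype.ext (h X.1 X.2 X'.1 X'.2 Y.1 Y.2 r))
    (fun X Y => Subtype.ext (h' X.1 Y.1)),
    fun X => antisymm_self (Subtype.ext (h' X.1 X.1)), fun _ _ => rfl⟩

/-! ### The charge algebra as a central extension. -/

namespace LagrangianData

variable {E : Type uE} [NormedAddCommGroup E] [NormedSpace ℝ E] [FiniteDimensional ℝ E]
  {M : Type uM} [TopologicalSpace M] [ChartedSpace E M] [IsManifold 𝓘(ℝ, E) ∞ M]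
  {F : Type uF} [NormedAddCommGroup F] [NormedSpace ℝ F] [FiniteDimensional ℝ F]
  {𝒦 : SupportFamily M} {ρ : TensorType E F} {m : ℕ}
  {𝒯 : LagrangianData 𝒦 ρ m}

/-- A smooth function, restricted to a subset. -/
def smoothRestr {Φ : Set (Fld M ρ)} (P : Set Φ) (f : Φ → ℝ) (hf : SmoothOn 𝒦 f) : SmoothFun 𝒦 P :=
  ⟨restr P f, fun k c hc => hf k (fun p => (c p).1) hc⟩

section

variable (h𝒯 : 𝒯.IsCovariant) (S : Chain E M (m + 1)) {𝔤 : Submodule ℝ (𝒯.Φ → VF E 𝒦)}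
  (h𝔤 : ∀ X : 𝔤, IsSmoothMap 𝒦 𝒦 (vecT E M) fun ψ => (X.1 ψ).1) (P₀ : Set 𝒯.Φ)
include h𝒯 h𝔤

theorem exists_bracket_map (hbr : ∀ X ∈ 𝔤, ∀ Y ∈ 𝔤, extBracket X Y ∈ 𝔤) :
    ∃ br : 𝔤 →ₗ[ℝ] 𝔤 →ₗ[ℝ] 𝔤, (∀ X, br X X = 0) ∧ ∀ X Y, (br X Y).1 = extBracket X.1 Y.1 := by
  have h1 : ∀ X ∈ 𝔤, ∀ X' ∈ 𝔤, ∀ Y ∈ 𝔤, ∀ r : ℝ,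
      extBracket (r • X + X') Y = r • extBracket X Y + extBracket X' Y :=
    fun X hX X' hX' Y hY r => extBracket_add_smul h𝒯.isOpen (h𝔤 ⟨X, hX⟩) (h𝔤 ⟨X', hX'⟩)
      (h𝔤 ⟨Y, hY⟩) r
  have h2 : ∀ X Y : 𝒯.Φ → VF E 𝒦, extBracket X Y = -extBracket Y X := extBracket_swap
  have h3 := exists_bilin_submodule 𝔤 extBracket hbr h1
  exact h3 h2

theorem exists_cocycle_map {A : VF E 𝒦 → VF E 𝒦 → 𝒯.Φ → Form E M m} (hA : 𝒯.IsPotential A) :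
    ∃ c : 𝔤 →ₗ[ℝ] 𝔤 →ₗ[ℝ] SmoothFun 𝒦 P₀,
      (∀ X, c X X = 0) ∧ ∀ X Y, (c X Y).1 = restr P₀ (𝒯.cocycleBar A S X.1 Y.1) := by
  let f : 𝔤 → 𝔤 → SmoothFun 𝒦 P₀ := fun X Y => smoothRestr P₀ (𝒯.cocycleBar A S X.1 Y.1)
    (smoothOn_cocycleBar h𝒯 S hA (h𝔤 X) (h𝔤 Y))
  have h1 : ∀ (r : ℝ) X X' Y, f (r • X + X') Y = r • f X Y + f X' Y := fun r X X' Y =>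
    Subtype.ext (congrArg (restr P₀) (cocycleBar_add_smul h𝒯 S hA (h𝔤 X) (h𝔤 X') (h𝔤 Y) r))
  have h2 : ∀ X Y, f X Y = -f Y X := fun X Y =>
    Subtype.ext (congrArg (restr P₀) (cocycleBar_swap h𝒯 S hA X.1 Y.1))
  exact ⟨bilinOfAntisymm f h1 h2, fun _ => antisymm_self (h2 _ _), fun _ _ => rfl⟩

theorem exists_charge_map :
    ∃ Q : 𝔤 →ₗ[ℝ] SmoothFun 𝒦 P₀, ∀ X, (Q X).1 = restr P₀ (𝒯.charge S X.1) :=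
  ⟨{ toFun := fun X => smoothRestr P₀ (𝒯.charge S X.1) (smoothOn_charge h𝒯 S (h𝔤 X))
     map_add' := fun X Y => Subtype.ext <| funext fun φ => by
      have := charge_add_smul h𝒯 S X.1 Y.1 1 φ.1
      rw [one_smul, one_mul] at this
      exact this
     map_smul' := fun r X => Subtype.ext <| funext fun φ => by
      have h0 := charge_add_smul h𝒯 S (0 : 𝒯.Φ → VF E 𝒦) 0 1 φ.1
      rw [one_smul, one_mul, add_zero, left_eq_add] at h0
      have := charge_add_smul h𝒯 S X.1 0 r φ.1
      rw [add_zero, h0, add_zero] at this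
      exact this }, fun _ => rfl⟩

end

/-- The central extension of a Lie algebra of field-dependent parameters by the smooth functions
that is defined by the charges. -/
theorem exists_charge_algebra (h𝒯 : 𝒯.IsCovariant) (S : Chain E M (m + 1))
    {A : VF E 𝒦 → VF E 𝒦 → 𝒯.Φ → Form E M m} (hA : 𝒯.IsPotential A)
    (𝔤 : Submodule ℝ (𝒯.Φ → VF E 𝒦)) (h𝔤 : 𝔤 ≤ FieldDepParam 𝒦 𝒯.Φ)
    (hbr : ∀ X ∈ 𝔤, ∀ Y ∈ 𝔤, extBracket X Y ∈ 𝔤) (P₀ : Set 𝒯.Φ)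
    (hP₀ : P₀ ⊆ 𝒯.onShell)
    (hcoc : ∀ X ∈ 𝔤, ∀ Y ∈ 𝔤, ∀ Z ∈ 𝔤, ∀ φ ∈ P₀,
      𝒯.cocycleBar A S X (extBracket Y Z) φ + 𝒯.cocycleBar A S Y (extBracket Z X) φ
        + 𝒯.cocycleBar A S Z (extBracket X Y) φ = 0) :
    ∃ (G : Type (max uE uM uF)) (_ : LieRing G) (_ : LieAlgebra ℝ G) (e : 𝔤 ≃ₗ[ℝ] G)
      (P : Type (max uE uM uF)) (_ : LieRing P) (_ : LieAlgebra ℝ P)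
      (i : SmoothFun 𝒦 P₀ →ₗ⁅ℝ⁆ P) (p : P →ₗ⁅ℝ⁆ G) (q : G →ₗ[ℝ] P)
      (ev : P →ₗ[ℝ] SmoothFun 𝒦 P₀),
      (∀ X Y : 𝔤, (e.symm ⁅e X, e Y⁆).1 = extBracket X.1 Y.1) ∧
      LieAlgebra.IsExtension i p ∧
      (∀ f (z : P), ⁅i f, z⁆ = 0) ∧
      (∀ g, p (q g) = g) ∧
      (∀ f, ev (i f) = f) ∧
      (∀ X : 𝔤, (ev (q (e X))).1 = restr P₀ (𝒯.charge S X.1)) ∧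
      (∀ X Y : 𝔤, ∃ c : SmoothFun 𝒦 P₀,
        c.1 = restr P₀ (𝒯.cocycleBar A S X.1 Y.1) ∧
        ⁅q (e X), q (e Y)⁆ = q ⁅e X, e Y⁆ + i c) ∧
      (∀ X Y : 𝔤, (ev ⁅q (e X), q (e Y)⁆).1 = restr P₀ (𝒯.chargeBracket S X.1 Y.1)) := by
  have hs : ∀ X : 𝔤, IsSmoothMap 𝒦 𝒦 (vecT E M) fun ψ => (X.1 ψ).1 := fun X =>
    mem_fieldDepParam_iff.1 (h𝔤 X.2)
  obtain ⟨br, br0, hbr'⟩ := exists_bracket_map h𝒯 hs hbr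
  obtain ⟨c, c0, hc⟩ := exists_cocycle_map h𝒯 S hs P₀ hA
  obtain ⟨Q, hQ⟩ := exists_charge_map h𝒯 S hs P₀
  have brJ : ∀ X Y Z, br X (br Y Z) + br Y (br Z X) + br Z (br X Y) = 0 := fun X Y Z =>
    Subtype.ext (by
      have h := extBracket_jacobi h𝒯.isOpen (hs X) (hs Y) (hs Z)
      simp only [← hbr'] at h
      exact h)
  have cJ : ∀ X Y Z, c X (br Y Z) + c Y (br Z X) + c Z (br X Y) = 0 := fun X Y Z =>
    Subtype.ext (funext fun φ => by
      have h := hcoc _ X.2 _ Y.2 _ Z.2 φ.1 φ.2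
      simp only [← hbr'] at h
      refine Eq.trans ?_ h
      change (c X (br Y Z)).1 φ + (c Y (br Z X)).1 φ + (c Z (br X Y)).1 φ = _
      rw [hc, hc, hc]
      rfl)
  have hA' : ∀ f g : SmoothFun 𝒦 P₀, ⁅f, g⁆ = 0 := fun f g => by
    rw [Ring.lie_def, mul_comm, sub_self]
  have h := exists_centralExtension (L := 𝔤) (A := SmoothFun 𝒦 P₀) br br0 brJ hA' c c0 cJ Q
  obtain ⟨G, iG, iG', e, P, iP, iP', i, p, q, ev, h1, h2, h3, h4, h5, h6, h7⟩ := h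
  refine ⟨G, iG, iG', e, P, iP, iP', i, p, q, ev, fun X Y => by rw [h1, hbr'], h2, h3,
    h4, h5, fun X => by rw [h6, hQ], fun X Y => ⟨c X Y, hc X Y, h7 X Y⟩, fun X Y => ?_⟩
  -- Evaluation of the bracket thus gives the charge of {X, Y} plus the cocycle, which is the
  -- bracket of charges because `P₀` lies on shell.
  have h8 : ⁅e X, e Y⁆ = e (br X Y) := (e.symm_apply_eq).1 (h1 X Y)
  rw [h7, map_add, h5, h8, h6]
  funext φ
  change (Q (br X Y)).1 φ + (c X Y).1 φ = _
  rw [hQ, hc, hbr']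
  exact (chargeBracket_onShell h𝒯 S hA X.1 Y.1 (hP₀ φ.2)).symm

end LagrangianData

end CovPhaseSpace

end

/-! ### Assembly of the theorem. -/

theorem mainTheorem11
    {E : Type uE} [NormedAddCommGroup E] [NormedSpace ℝ E] [FiniteDimensional ℝ E]
    {M : Type uM} [TopologicalSpace M] [ChartedSpace E M] [IsManifold 𝓘(ℝ, E) ∞ M]
    {F : Type uF} [NormedAddCommGroup F] [NormedSpace ℝ F] [FiniteDimensional ℝ F]
    (m : ℕ) (hdim : Module.finrank ℝ E = m + 2)
    (𝒦 : SupportFamily M) (ρ : TensorType E F)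
    (𝒯 : LagrangianData 𝒦 ρ m) (h𝒯 : 𝒯.IsCovariant) (S : Chain E M (m + 1)) :
    -- the extended bracket makes the field-dependent parameters a Lie algebra
    (∀ X ∈ FieldDepParam 𝒦 𝒯.Φ, ∀ Y ∈ FieldDepParam 𝒦 𝒯.Φ,
      extBracket X Y ∈ FieldDepParam 𝒦 𝒯.Φ ∧ extBracket X Y = -extBracket Y X) ∧
    (∀ X ∈ FieldDepParam 𝒦 𝒯.Φ, ∀ X' ∈ FieldDepParam 𝒦 𝒯.Φ, ∀ Y ∈ FieldDepParam 𝒦 𝒯.Φ, ∀ r : ℝ,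
      extBracket (r • X + X') Y = r • extBracket X Y + extBracket X' Y) ∧
    (∀ X ∈ FieldDepParam 𝒦 𝒯.Φ, ∀ Y ∈ FieldDepParam 𝒦 𝒯.Φ, ∀ Z ∈ FieldDepParam 𝒦 𝒯.Φ,
      extBracket X (extBracket Y Z) + extBracket Y (extBracket Z X)
        + extBracket Z (extBracket X Y) = 0) ∧
    -- which acts by vertical vector fields, with their bracket as vector fields on field space
    (∀ X ∈ FieldDepParam 𝒦 𝒯.Φ, ∀ Y ∈ FieldDepParam 𝒦 𝒯.Φ, ∀ φ,
      (vert (extBracket X Y) φ).1 =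
        ddirSec (fun ψ => (vert Y ψ).1) φ (vert X φ)
          - ddirSec (fun ψ => (vert X ψ).1) φ (vert Y φ)) ∧
    ((∀ (X : VF E 𝒦) (φ : 𝒯.Φ), vertAt X φ.1 = 0 → X = 0) →
      ∀ X Y : 𝒯.Φ → VF E 𝒦, vert X = vert Y → X = Y) ∧
    -- the relation of the charges with the presymplectic form
    (∀ X ∈ FieldDepParam 𝒦 𝒯.Φ, ∀ (φ : 𝒯.Φ) (v : Var 𝒦 ρ),
      𝒯.presymplectic S φ (vert X φ) v =
        -ddir (𝒯.charge S X) φ v + 𝒯.flux S X φ v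
          - chainIntegral S (iota (X φ).1 (𝒯.eom φ v))) ∧
    -- the anomaly is closed, and has a bilinear antisymmetric potential if closed forms are exact
    (∀ X Y φ, extD (𝒯.anomaly X Y φ) = 0) ∧
    ((∀ η : Form E M (m + 1), extD η.1 = 0 → ∃ α : Form E M m, extD α.1 = η.1) →
      ∃ A : VF E 𝒦 →ₗ[ℝ] VF E 𝒦 →ₗ[ℝ] (𝒯.Φ → Form E M m),
        (∀ X Y, A X Y = -A Y X) ∧ 𝒯.IsPotential (fun X Y φ => A X Y φ)) ∧
    ∀ A : VF E 𝒦 → VF E 𝒦 → 𝒯.Φ → Form E M m, 𝒯.IsPotential A →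
      (∀ X Y φ, 𝒯.cocycleBar A S X Y φ
        = 𝒯.cocycle A S X Y φ - 𝒯.charge S (antiDeriv X Y) φ) ∧
      -- bilinear, antisymmetric, with values in the smooth functions
      (∀ X ∈ FieldDepParam 𝒦 𝒯.Φ, ∀ Y ∈ FieldDepParam 𝒦 𝒯.Φ,
        SmoothOn 𝒦 (𝒯.cocycleBar A S X Y) ∧
        𝒯.cocycleBar A S X Y = -𝒯.cocycleBar A S Y X) ∧
      (∀ X ∈ FieldDepParam 𝒦 𝒯.Φ, ∀ X' ∈ FieldDepParam 𝒦 𝒯.Φ,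
        ∀ Y ∈ FieldDepParam 𝒦 𝒯.Φ, ∀ r : ℝ,
        𝒯.cocycleBar A S (r • X + X') Y
          = r • 𝒯.cocycleBar A S X Y + 𝒯.cocycleBar A S X' Y) ∧
      -- the bracket of charges, off shell and on shell
      (∀ X ∈ FieldDepParam 𝒦 𝒯.Φ, ∀ Y ∈ FieldDepParam 𝒦 𝒯.Φ, ∀ φ : 𝒯.Φ,
        𝒯.chargeBracket S X Y φ =
          𝒯.charge S (extBracket X Y) φ + 𝒯.cocycleBar A S X Y φ
            + chainIntegral S (iota (Y φ).1 (𝒯.eom φ (vert X φ))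
                - iota (X φ).1 (𝒯.eom φ (vert Y φ)))) ∧
      (∀ X ∈ FieldDepParam 𝒦 𝒯.Φ, ∀ Y ∈ FieldDepParam 𝒦 𝒯.Φ, ∀ φ ∈ 𝒯.onShell,
        𝒯.chargeBracket S X Y φ =
          𝒯.charge S (extBracket X Y) φ + 𝒯.cocycleBar A S X Y φ) ∧
      -- the obstruction to the cocycle condition, on shell
      (∀ X ∈ FieldDepParam 𝒦 𝒯.Φ, ∀ Y ∈ FieldDepParam 𝒦 𝒯.Φ, ∀ Z ∈ FieldDepParam 𝒦 𝒯.Φ,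
        ∀ φ ∈ 𝒯.onShell,
        (𝒯.cocycleBar A S X (extBracket Y Z) φ + 𝒯.cocycleBar A S Y (extBracket Z X) φ
            + 𝒯.cocycleBar A S Z (extBracket X Y) φ
          = dForm1 (fun ψ v => 𝒯.presymplectic S ψ (vert X ψ) v) φ (vert Y φ) (vert Z φ)
            + dForm1 (fun ψ v => 𝒯.presymplectic S ψ (vert Y ψ) v) φ (vert Z φ) (vert X φ)
            + dForm1 (fun ψ v => 𝒯.presymplectic S ψ (vert Z ψ) v) φ (vert X φ) (vert Y φ)) ∧
        (𝒯.cocycleBar A S X (extBracket Y Z) φ + 𝒯.cocycleBar A S Y (extBracket Z X) φ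
            + 𝒯.cocycleBar A S Z (extBracket X Y) φ
          = dForm1 (𝒯.flux S X) φ (vert Y φ) (vert Z φ)
            + dForm1 (𝒯.flux S Y) φ (vert Z φ) (vert X φ)
            + dForm1 (𝒯.flux S Z) φ (vert X φ) (vert Y φ))) ∧
      -- boundary conditions `B`, preserved by a Lie algebra `𝔤` of field-dependent parameters,
      -- under which the fluxes vanish
      ∀ (𝔤 : Submodule ℝ (𝒯.Φ → VF E 𝒦)) (B : Set 𝒯.Φ),
        𝔤 ≤ FieldDepParam 𝒦 𝒯.Φ →
        (∀ X ∈ 𝔤, ∀ Y ∈ 𝔤, extBracket X Y ∈ 𝔤) →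
        (∀ f : 𝒯.Φ → ℝ, SmoothOn 𝒦 f → (∀ φ ∈ B, f φ = 0) →
          ∀ X ∈ 𝔤, ∀ φ ∈ B, ddir f φ (vert X φ) = 0) →
        (∀ X ∈ 𝔤, ∀ Y ∈ 𝔤, ∀ φ ∈ B, 𝒯.flux S X φ (vert Y φ) = 0) →
        -- the charges are moment maps
        (∀ X ∈ 𝔤, ∀ Y ∈ 𝔤, ∀ φ ∈ 𝒯.onShell ∩ B,
          𝒯.presymplectic S φ (vert X φ) (vert Y φ)
            = -ddir (𝒯.charge S X) φ (vert Y φ)) ∧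
        -- the cocycle condition
        (∀ X ∈ 𝔤, ∀ Y ∈ 𝔤, ∀ Z ∈ 𝔤, ∀ φ ∈ 𝒯.onShell ∩ B,
          𝒯.cocycleBar A S X (extBracket Y Z) φ + 𝒯.cocycleBar A S Y (extBracket Z X) φ
            + 𝒯.cocycleBar A S Z (extBracket X Y) φ = 0) ∧
        -- the charge algebra `P` is a central extension of `G`, a copy of `𝔤` with the extended
        -- bracket, by the smooth functions; `q` is the linear section given by the charges, and
        -- `ev` evaluates the elements of `P` as functions on the fields
        ∃ (G : Type (max uE uM uF)) (_ : LieRing G) (_ : LieAlgebra ℝ G) (e : 𝔤 ≃ₗ[ℝ] G)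
          (P : Type (max uE uM uF)) (_ : LieRing P) (_ : LieAlgebra ℝ P)
          (i : SmoothFun 𝒦 (𝒯.onShell ∩ B) →ₗ⁅ℝ⁆ P) (p : P →ₗ⁅ℝ⁆ G) (q : G →ₗ[ℝ] P)
          (ev : P →ₗ[ℝ] SmoothFun 𝒦 (𝒯.onShell ∩ B)),
          (∀ X Y : 𝔤, (e.symm ⁅e X, e Y⁆).1 = extBracket X.1 Y.1) ∧
          LieAlgebra.IsExtension i p ∧
          (∀ f (z : P), ⁅i f, z⁆ = 0) ∧
          (∀ g, p (q g) = g) ∧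
          (∀ f, ev (i f) = f) ∧
          (∀ X : 𝔤, (ev (q (e X))).1 = restr (𝒯.onShell ∩ B) (𝒯.charge S X.1)) ∧
          (∀ X Y : 𝔤, ∃ c : SmoothFun 𝒦 (𝒯.onShell ∩ B),
            c.1 = restr (𝒯.onShell ∩ B) (𝒯.cocycleBar A S X.1 Y.1) ∧
            ⁅q (e X), q (e Y)⁆ = q ⁅e X, e Y⁆ + i c) ∧
          (∀ X Y : 𝔤, (ev ⁅q (e X), q (e Y)⁆).1
            = restr (𝒯.onShell ∩ B) (𝒯.chargeBracket S X.1 Y.1)) := by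
  have sm : ∀ {X : 𝒯.Φ → VF E 𝒦}, X ∈ FieldDepParam 𝒦 𝒯.Φ →
      IsSmoothMap 𝒦 𝒦 (vecT E M) fun ψ => (X ψ).1 := fun h => mem_fieldDepParam_iff.1 h
  refine ⟨fun X hX Y hY => ⟨mem_fieldDepParam_iff.2 ((sm hX).extBracket h𝒯.isOpen (sm hY)),
    extBracket_swap X Y⟩, fun X hX X' hX' Y hY r => extBracket_add_smul h𝒯.isOpen (sm hX) (sm hX')
    (sm hY) r, fun X hX Y hY Z hZ => extBracket_jacobi h𝒯.isOpen (sm hX) (sm hY) (sm hZ),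
    fun X hX Y hY φ => ?_, fun hfree X Y hXY => funext fun φ => ?_,
    fun X hX φ v => LagrangianData.presymplectic_vert h𝒯 S (sm hX) φ v,
    LagrangianData.extD_anomaly h𝒯 hdim, LagrangianData.exists_potential h𝒯 hdim,
    fun A hA => ⟨fun X Y φ => rfl, fun X hX Y hY =>
      ⟨LagrangianData.smoothOn_cocycleBar h𝒯 S hA (sm hX) (sm hY),
        LagrangianData.cocycleBar_swap h𝒯 S hA X Y⟩,
      fun X hX X' hX' Y hY r =>
        LagrangianData.cocycleBar_add_smul h𝒯 S hA (sm hX) (sm hX') (sm hY) r,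
      fun X _ Y _ φ => LagrangianData.chargeBracket_eq h𝒯 S hA X Y φ,
      fun X _ Y _ φ hφ => LagrangianData.chargeBracket_onShell h𝒯 S hA X Y hφ,
      fun X hX Y hY Z hZ φ hφ => ?_, fun 𝔤 B h𝔤 hbr htan hflux => ?_⟩⟩
  · rw [vert_extBracket h𝒯.isOpen (sm hX) (sm hY), ← dSec_coe h𝒯.isOpen (sm hX).vert,
      ← dSec_coe h𝒯.isOpen (sm hY).vert]
    rfl
  -- Freeness is applied to X - Y at each field, by linearity of the vertical vector in the
  -- parameter.
  · refine sub_eq_zero.1 (hfree _ φ ?_)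
    rw [vertAt_sub]
    exact sub_eq_zero.2 (congrFun hXY φ)
  · have h := LagrangianData.cocycle_obstruction h𝒯 S hA (sm hX) (sm hY) (sm hZ) hφ
    exact ⟨h, by rw [LagrangianData.dForm1_flux h𝒯 S (sm hX) hφ,
      LagrangianData.dForm1_flux h𝒯 S (sm hY) hφ, LagrangianData.dForm1_flux h𝒯 S (sm hZ) hφ, h]⟩
  -- Tangency is used for the smooth functions F_X(Z^v) and F_X(Y^v), which vanish on B; the
  -- remaining term F_X({Y, Z}^v) vanishes because {Y, Z} lies in 𝔤.
  · have key : ∀ X ∈ 𝔤, ∀ Y ∈ 𝔤, ∀ Z ∈ 𝔤, ∀ φ ∈ B,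
        dForm1 (𝒯.flux S X) φ (vert Y φ) (vert Z φ) = 0 := fun X hX Y hY Z hZ φ hφ =>
      LagrangianData.dForm1_flux_of_vanish h𝒯 S (sm (h𝔤 hX)) (sm (h𝔤 hY)) (sm (h𝔤 hZ))
        (htan _ (LagrangianData.smoothOn_flux_vert h𝒯 S (sm (h𝔤 hX)) (sm (h𝔤 hZ)))
          (fun ψ hψ => hflux X hX Z hZ ψ hψ) Y hY φ hφ)
        (htan _ (LagrangianData.smoothOn_flux_vert h𝒯 S (sm (h𝔤 hX)) (sm (h𝔤 hY)))
          (fun ψ hψ => hflux X hX Y hY ψ hψ) Z hZ φ hφ)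
        (hflux X hX _ (hbr Y hY Z hZ) φ hφ)
    have hcoc : ∀ X ∈ 𝔤, ∀ Y ∈ 𝔤, ∀ Z ∈ 𝔤, ∀ φ ∈ 𝒯.onShell ∩ B,
        𝒯.cocycleBar A S X (extBracket Y Z) φ + 𝒯.cocycleBar A S Y (extBracket Z X) φ
          + 𝒯.cocycleBar A S Z (extBracket X Y) φ = 0 := by
      intro X hX Y hY Z hZ φ hφ
      rw [LagrangianData.cocycle_obstruction h𝒯 S hA (sm (h𝔤 hX)) (sm (h𝔤 hY)) (sm (h𝔤 hZ)) hφ.1,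
        ← LagrangianData.dForm1_flux h𝒯 S (sm (h𝔤 hX)) hφ.1,
        ← LagrangianData.dForm1_flux h𝒯 S (sm (h𝔤 hY)) hφ.1,
        ← LagrangianData.dForm1_flux h𝒯 S (sm (h𝔤 hZ)) hφ.1, key X hX Y hY Z hZ φ hφ.2,
        key Y hY Z hZ X hX φ hφ.2, key Z hZ X hX Y hY φ hφ.2, add_zero, add_zero]
    exact ⟨fun X hX Y hY φ hφ => LagrangianData.moment_map h𝒯 S (sm (h𝔤 hX)) hφ.1 _
      (hflux X hX Y hY φ hφ.2), hcoc, LagrangianData.exists_charge_algebra h𝒯 S hA 𝔤 h𝔤 hbr _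
        Set.inter_subset_left hcoc⟩
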